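/- **Setting.** Let $n\ge 1$, $p_0\ge p_1\ge\dots\ge p_n\ge 1$, $N=p_0+\dots+p_n$, and write $x=(x^{(p_0)},\dots,x^{(p_n)})\in\mathbb R^{p_0}\times\dots\times\mathbb R^{p_n}=\mathbb R^N$. Let $B\in\mathbb R^{N\times N}$ be the block matrix whose only nonzero blocks are the blocks $\mathbb B_j$ ($j=1,\dots,n$) immediately above the diagonal, where $\mathbb B_j$ has size $p_{j-1}\times p_j$ and rank $p_j$. Put $E(s)=\exp(-sB^T)$, and for $(x,t),(\xi,\tau)\in\mathbb R^{N}\times\mathbb R$ $$(x,t)\circ(\xi,\tau)=(\xi+E(\tau)x,\;t+\tau),\qquad |x|_B=\sum_{i=0}^n|x^{(p_i)}|^{\frac1{2i+1}},$$ $$\mathcal Q_r^{t_1,t_2}(z_0)=z_0\circ\big(\{x\in\mathbb R^N:|x|_B<r\}\times(t_1,t_2)\big)\qquad (z_0\in\mathbb R^{N+1},\ r>0,\ t_1<t_2).$$ Let $\lambda,\Lambda>0$, and let $\omega:[0,1)\to[0,1)$ be non-decreasing with $\lim_{s\to0^+}\omega(s)=\omega(0)=0$. For an open set $\Omega\subseteq\mathbb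 R^{N+1}$ we consider operators $$\mathcal L_A=\mathrm{tr}(A(z)D_x^2)+\langle x,B\nabla_x\rangle-\partial_t,\qquad A(z)=\begin{bmatrix}\mathbb A(z)&0\\0&0\end{bmatrix},\quad z=(x,t)\in\Omega,$$ where $\mathbb A(z)\in\mathbb R^{p_0\times p_0}$ is symmetric, $\lambda\mathbb I_{p_0}\le\mathbb A(z)\le\Lambda\mathbb I_{p_0}$ for all $z\in\Omega$, and $\mathbb A$ admits the uniform modulus of continuity $\omega$ in $\Omega$: for all $0<\epsilon<1$ and $z_0\in\Omega$, $$\sup\big\{\|\mathbb A(z)-\mathbb A(z_0)\|: z\in\Omega\cap\mathcal Q_\epsilon^{-\epsilon^2,\epsilon^2}(z_0)\big\}\le\omega(\epsilon).$$ **Theorem.** There exist constants $b_B,K,\sigma,C>0$ with $\sigma<K$, depending only on $n,p_0,\dots,p_n,B,\lambda,\Lambda$ and $\omega$ (and not on $\Omega$, $A$, $z_0$, $r$, $u$), such that for every $\Omega$ and $A$ as above, all $z_0\in\mathbb R^{N+1}$ and $0<r\le1$ with $\mathcal Q_{Kr}^{-b_Br^2,0}(z_0)\Subset\Omega$, and every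 $u\in C^2(\Omega)$ satisfying $$u\ge0\quad\text{and}\quad\mathcal L_Au=0\qquad\text{in }\mathcal Q_{Kr}^{-b_Br^2,0}(z_0),$$ one has $$\sup_{\mathcal Q_r^-}u\le C\inf_{\mathcal Q_r^+}u,$$ where $\mathcal Q_r^-=\mathcal Q_{\sigma r}^{-\frac{3b_B}4r^2,-\frac{5b_B}8r^2}(z_0)$ and $\mathcal Q_r^+=\mathcal Q_{\sigma r}^{-\frac{b_B}8r^2,0}(z_0)$. -/

import Mathlib

/-! Kolmogorov-type operators `tr(A(z)D²) + ⟨x, B∇⟩ - ∂ₜ` in non-divergence form, and the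
homogeneous group structure attached to the matrix `B`. -/

namespace Kolmogorov

open Filter Topology

/-- The coordinates of `ℝ^N = ℝ^{p₀} × ⋯ × ℝ^{pₙ}`: the pair `⟨i, j⟩` is the `j`-th coordinate of
the `i`-th block, so `N = p₀ + ⋯ + pₙ`. -/
abbrev Coord {n : ℕ} (p : Fin (n + 1) → ℕ) : Type := (i : Fin (n + 1)) × Fin (p i)

/-- The space `ℝ^N`, with its Euclidean norm. -/
abbrev Space {n : ℕ} (p : Fin (n + 1) → ℕ) : Type := EuclideanSpace ℝ (Coord p)

/-- The space `ℝ^{N+1} = ℝ^N × ℝ` of points `z = (x, t)`. -/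
abbrev SpaceTime {n : ℕ} (p : Fin (n + 1) → ℕ) : Type := Space p × ℝ

/-- The structure of the drift matrix: `n ≥ 1`, `p₀ ≥ p₁ ≥ ⋯ ≥ pₙ ≥ 1`, the only nonzero blocks
of `B` are the blocks `𝔹_{j+1}` of size `p_j × p_{j+1}` immediately above the diagonal, and
`𝔹_{j+1}` has rank `p_{j+1}`. -/
structure IsDrift {n : ℕ} (p : Fin (n + 1) → ℕ) (B : Matrix (Coord p) (Coord p) ℝ) : Prop where
  one_le_n : 1 ≤ n
  antitone : Antitone p
  one_le_last : 1 ≤ p (Fin.last n)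
  zero_of_ne : ∀ k l : Coord p, (l.1 : ℕ) ≠ (k.1 : ℕ) + 1 → B k l = 0
  rank_block : ∀ j : Fin n,
    (B.submatrix (Sigma.mk (β := fun i => Fin (p i)) j.castSucc)
      (Sigma.mk (β := fun i => Fin (p i)) j.succ)).rank = p j.succ

section Geometry

variable {n : ℕ} {p : Fin (n + 1) → ℕ}

/-- The `i`-th block `x^{(p_i)}` of `x`, with the Euclidean norm of `ℝ^{p_i}`. -/
noncomputable def block (i : Fin (n + 1)) (x : Space p) : EuclideanSpace ℝ (Fin (p i)) :=
  WithLp.toLp 2 fun j => x ⟨i, j⟩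

/-- The homogeneous norm `|x|_B = ∑ᵢ |x^{(p_i)}|^{1/(2i+1)}`. -/
noncomputable def homNorm (x : Space p) : ℝ :=
  ∑ i : Fin (n + 1), ‖block i x‖ ^ (1 / (2 * (i : ℝ) + 1))

/-- `E(s) = exp(-s Bᵀ)`. -/
noncomputable def flow (B : Matrix (Coord p) (Coord p) ℝ) (s : ℝ) :
    Matrix (Coord p) (Coord p) ℝ :=
  NormedSpace.exp (-(s • B.transpose))

/-- The group law `(x, t) ∘ (ξ, τ) = (ξ + E(τ) x, t + τ)`. -/
noncomputable def comp (B : Matrix (Coord p) (Coord p) ℝ) (z ζ : SpaceTime p) : SpaceTime p :=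
  (ζ.1 + WithLp.toLp 2 ((flow B ζ.2).mulVec z.1.ofLp), z.2 + ζ.2)

/-- The cylinder `Q_r^{t₁,t₂}(z₀) = z₀ ∘ ({|x|_B < r} × (t₁, t₂))`. -/
noncomputable def cylinder (B : Matrix (Coord p) (Coord p) ℝ) (r t₁ t₂ : ℝ) (z₀ : SpaceTime p) :
    Set (SpaceTime p) :=
  comp B z₀ '' ({x : Space p | homNorm x < r} ×ˢ Set.Ioo t₁ t₂)

/-- `S ⋐ Ω`. -/
def CompactlyContained (S Ω : Set (SpaceTime p)) : Prop :=
  IsCompact (closure S) ∧ closure S ⊆ Ω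

end Geometry

section Operator

variable {n : ℕ} {p : Fin (n + 1) → ℕ}

/-- The gradient `∇_x u (x, t)` in the space variables. -/
noncomputable def spaceGradient (u : SpaceTime p → ℝ) (z : SpaceTime p) : Space p :=
  gradient (fun x : Space p => u (x, z.2)) z.1

/-- The Hessian `D²_x u (x, t)` in the space variables. -/
noncomputable def hessian (u : SpaceTime p → ℝ) (z : SpaceTime p) :
    Matrix (Coord p) (Coord p) ℝ :=
  Matrix.of fun k l => iteratedFDeriv ℝ 2 (fun x : Space p => u (x, z.2)) z.1
    ![EuclideanSpace.single k 1, EuclideanSpace.single l 1]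

/-- `𝓛_A u (x, t) = tr(A(x,t) D²_x u) + ⟨x, B ∇_x u⟩ - ∂ₜ u`. -/
noncomputable def operator (B : Matrix (Coord p) (Coord p) ℝ)
    (A : SpaceTime p → Matrix (Coord p) (Coord p) ℝ) (u : SpaceTime p → ℝ) (z : SpaceTime p) : ℝ :=
  (A z * hessian u z).trace
    + inner ℝ z.1 (WithLp.toLp 2 (B.mulVec (spaceGradient u z).ofLp))
    - deriv (fun t => u (z.1, t)) z.2

/-- The leading block `𝔸` of size `p₀ × p₀` of an `N × N` matrix. -/
def leadingBlock (M : Matrix (Coord p) (Coord p) ℝ) : Matrix (Fin (p 0)) (Fin (p 0)) ℝ :=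
  M.submatrix (Sigma.mk (β := fun i => Fin (p i)) 0) (Sigma.mk (β := fun i => Fin (p i)) 0)

/-- On `Ω` the matrix `A(z)` is symmetric, vanishes outside of its leading block `𝔸(z)`, and
`lam 𝕀 ≤ 𝔸(z) ≤ Lam 𝕀` in the sense of quadratic forms. -/
structure IsCoeff (lam Lam : ℝ) (Ω : Set (SpaceTime p))
    (A : SpaceTime p → Matrix (Coord p) (Coord p) ℝ) : Prop where
  isSymm : ∀ z ∈ Ω, (A z).IsSymm
  zero_of_ne : ∀ z ∈ Ω, ∀ k l : Coord p, k.1 ≠ 0 ∨ l.1 ≠ 0 → A z k l = 0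
  lower : ∀ z ∈ Ω, (leadingBlock (A z) - lam • 1).PosSemidef
  upper : ∀ z ∈ Ω, (Lam • 1 - leadingBlock (A z)).PosSemidef

/-- A modulus of continuity: a non-decreasing `ω : [0, 1) → [0, 1)` with `ω(s) → ω(0) = 0` as
`s → 0⁺`. Values of `ω` outside of `[0, 1)` play no role. -/
structure IsModulus (ω : ℝ → ℝ) : Prop where
  mapsTo : Set.MapsTo ω (Set.Ico 0 1) (Set.Ico 0 1)
  monotoneOn : MonotoneOn ω (Set.Ico 0 1)
  zero : ω 0 = 0
  tendsto : Tendsto ω (𝓝[>] 0) (𝓝 0)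

/-- `A` admits the uniform modulus of continuity `ω` in `Ω`: the operator norm of
`𝔸(z) - 𝔸(z₀)` is at most `ω(ε)` for `z₀ ∈ Ω` and `z ∈ Ω ∩ Q_ε^{-ε²,ε²}(z₀)`, `0 < ε < 1`. -/
def HasModulus (B : Matrix (Coord p) (Coord p) ℝ) (ω : ℝ → ℝ) (Ω : Set (SpaceTime p))
    (A : SpaceTime p → Matrix (Coord p) (Coord p) ℝ) : Prop :=
  ∀ ε : ℝ, 0 < ε → ε < 1 → ∀ z₀ ∈ Ω, ∀ z ∈ Ω ∩ cylinder B ε (-ε ^ 2) (ε ^ 2) z₀,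
    ‖Matrix.toEuclideanCLM (n := Fin (p 0)) (𝕜 := ℝ)
      (leadingBlock (A z) - leadingBlock (A z₀))‖ ≤ ω ε

end Operator

end Kolmogorov

/-! The proof is a barrier argument in the style of Krylov–Safonov, in which the modulus of
continuity is used only once: on a cylinder of small enough size, `A(z)` lies between `(1 - ε) A₀`
and `(1 + ε) A₀`, with `A₀ = A(z₀)` frozen at the vertex. Nothing else about the dependence of `A`
on `z` is needed, so the constants depend only on the structure of `B`, the ellipticity bounds and
the size at which `ω` becomes small.

For constant `A₀` the fundamental solution is, up to a factor, `t^{-Q/2} exp(-⟨M y, y⟩/4)`, where `y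
= δ_{1/√t} x`, `Q` is the homogeneous dimension of space and `M` is the inverse of the covariance
matrix `C = ∫₀¹ E(s) A₀ E(s)ᵀ ds`. The scaling of `E` turns the equation into the algebraic identity
`lyapunov_covariance`, and the Kalman rank condition (`energy_pos`) makes `C` positive definite,
uniformly in the ellipticity class. Replacing `Q/2` by `S = Q/2 + 1/2` and `4` by `4(1 - ε)` gives a
kernel that is a subsolution simultaneously for all coefficients `ε`-close to `A₀`
(`neg_cutoffDeriv_le`), while its singularity stays integrable: a time slice has mass of order
`t^{-1/2}`.

The potential of this kernel over a compact set `E` of early times is therefore bounded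
independently of `E`, and at late times it is at least a constant multiple of `|E|`. Comparing it
with a nonnegative supersolution that is at least `k` on `E` gives the growth lemma `exists_growth`:
at late times the supersolution is at least `c k |E|`.

The linear dependence on `|E|` matches the scaling of Lebesgue measure, of degree `Q + 2`, and this
gives Harnack without a covering argument (`exists_unit_harnack`). Maximise `u · dist^{Q+2}`, where
`dist` measures the distance to the parabolic boundary. If the value is too large at the maximum
point, the growth lemma for `u` shows that `u` is at most half of its value there on half of the
early box of a small cylinder hanging from that point. Since `u` is almost maximal at the point, the
growth lemma for `(1 + h) u(z₁) - u` on this cylinder then gives a contradiction. Left translations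
and dilations transport the unit-scale result to all cylinders. -/

namespace Kolmogorov

open Filter Topology MeasureTheory
open scoped Matrix

/-! ### The flow `E`, the dilations and their commutation -/

section FlowDilation

variable {n : ℕ} {p : Fin (n + 1) → ℕ}

/-- The operator on `ℝ^N` with a given matrix. -/
noncomputable def op (M : Matrix (Coord p) (Coord p) ℝ) : Space p →L[ℝ] Space p :=
  Matrix.toEuclideanCLM (𝕜 := ℝ) M

/-- The homogeneity degree `2i+1` of a coordinate in the `i`-th block. -/
def weight (k : Coord p) : ℕ := 2 * (k.1 : ℕ) + 1

/-- The homogeneous dimension, of space alone. -/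
def homDim (p : Fin (n + 1) → ℕ) : ℕ := ∑ k : Coord p, weight k

/-- The matrix of the dilation `δ_r`. -/
def dilMatrix (p : Fin (n + 1) → ℕ) (r : ℝ) : Matrix (Coord p) (Coord p) ℝ :=
  Matrix.diagonal fun k => r ^ weight k

/-- The dilation `δ_r` of `ℝ^N`. -/
noncomputable def dil (r : ℝ) : Space p →L[ℝ] Space p := op (dilMatrix p r)

/-- The flow `E(τ)` as an operator. -/
noncomputable def flowOp (B : Matrix (Coord p) (Coord p) ℝ) (τ : ℝ) : Space p →L[ℝ] Space p :=
  op (flow B τ)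

theorem op_apply (M : Matrix (Coord p) (Coord p) ℝ) (x : Space p) (k : Coord p) :
    op M x k = ∑ l, M k l * x l := rfl

theorem op_mul (M M' : Matrix (Coord p) (Coord p) ℝ) (x : Space p) :
    op (M * M') x = op M (op M' x) := by
  simp [op, map_mul]

theorem op_one (x : Space p) : op (1 : Matrix (Coord p) (Coord p) ℝ) x = x := by
  simp [op]

theorem op_add (M M' : Matrix (Coord p) (Coord p) ℝ) (x : Space p) :
    op (M + M') x = op M x + op M' x := by
  simp [op]

theorem op_smul (c : ℝ) (M : Matrix (Coord p) (Coord p) ℝ) (x : Space p) :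
    op (c • M) x = c • op M x := by
  simp [op]

theorem inner_eq_sum (x y : Space p) : inner ℝ x y = ∑ k, x k * y k := by
  simp [PiLp.inner_apply, mul_comm]

theorem inner_op (M : Matrix (Coord p) (Coord p) ℝ) (x y : Space p) :
    inner ℝ x (op M y) = inner ℝ (op Mᵀ x) y := by
  simp only [inner_eq_sum, op_apply, Matrix.transpose_apply, Finset.mul_sum, Finset.sum_mul]
  rw [Finset.sum_comm]
  exact Finset.sum_congr rfl fun k _ => Finset.sum_congr rfl fun l _ => by ring

@[simp] theorem dil_apply (r : ℝ) (x : Space p) (k : Coord p) :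
    dil r x k = r ^ weight k * x k := by
  simp [dil, op_apply, dilMatrix, Matrix.diagonal_apply]

theorem dil_dil (r s : ℝ) (x : Space p) : dil r (dil s x) = dil (r * s) x := by
  ext k; simp [mul_pow, mul_assoc]

@[simp] theorem dil_one (x : Space p) : dil 1 x = x := by ext k; simp

theorem dil_dil_inv {r : ℝ} (hr : r ≠ 0) (x : Space p) : dil r (dil r⁻¹ x) = x := by
  rw [dil_dil, mul_inv_cancel₀ hr, dil_one]

theorem continuous_dil_apply : Continuous fun q : ℝ × Space p => dil q.1 q.2 := by
  refine (PiLp.continuous_toLp 2 _).comp (continuous_pi fun k => ?_)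
  change Continuous fun q : ℝ × Space p => dil q.1 q.2 k
  simp only [dil_apply]
  fun_prop

theorem norm_le_norm_of_abs_le {x y : Space p} (h : ∀ k, |x k| ≤ |y k|) : ‖x‖ ≤ ‖y‖ := by
  rw [EuclideanSpace.norm_eq, EuclideanSpace.norm_eq]
  exact Real.sqrt_le_sqrt (Finset.sum_le_sum fun k _ => by
    simpa only [Real.norm_eq_abs] using pow_le_pow_left₀ (abs_nonneg _) (h k) 2)

theorem norm_dil_le {r : ℝ} (h0 : 0 ≤ r) (h1 : r ≤ 1) (x : Space p) : ‖dil r x‖ ≤ r * ‖x‖ := by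
  have : ‖dil r x‖ ≤ ‖r • x‖ := norm_le_norm_of_abs_le fun k => by
    simp only [dil_apply, PiLp.smul_apply, smul_eq_mul, abs_mul]
    refine mul_le_mul_of_nonneg_right ?_ (abs_nonneg _)
    rw [abs_pow, abs_of_nonneg h0]
    exact pow_le_of_le_one h0 h1 (by simp [weight])
  simpa [norm_smul, abs_of_nonneg h0] using this

theorem flow_zero (B : Matrix (Coord p) (Coord p) ℝ) : flow B 0 = 1 := by
  simp [flow]

theorem flow_add (B : Matrix (Coord p) (Coord p) ℝ) (a b : ℝ) :
    flow B (a + b) = flow B a * flow B b := by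
  unfold flow
  rw [add_smul, neg_add]
  exact Matrix.exp_add_of_commute _ _ (((Commute.refl _).smul_left a).smul_right b).neg_left.neg_right

@[simp] theorem flowOp_zero (B : Matrix (Coord p) (Coord p) ℝ) (x : Space p) :
    flowOp B 0 x = x := by
  rw [flowOp, flow_zero, op_one]

theorem flowOp_add (B : Matrix (Coord p) (Coord p) ℝ) (a b : ℝ) (x : Space p) :
    flowOp B (a + b) x = flowOp B a (flowOp B b x) := by
  rw [flowOp, flow_add, op_mul]; rfl

theorem flowOp_neg_cancel (B : Matrix (Coord p) (Coord p) ℝ) (a : ℝ) (x : Space p) :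
    flowOp B a (flowOp B (-a) x) = x := by
  rw [← flowOp_add, add_neg_cancel, flowOp_zero]

theorem flowOp_cancel_neg (B : Matrix (Coord p) (Coord p) ℝ) (a : ℝ) (x : Space p) :
    flowOp B (-a) (flowOp B a x) = x := by
  rw [← flowOp_add, neg_add_cancel, flowOp_zero]

open scoped Matrix.Norms.L2Operator in
theorem hasDerivAt_flow (B : Matrix (Coord p) (Coord p) ℝ) (τ : ℝ) :
    HasDerivAt (flow B) (-(Bᵀ * flow B τ)) τ := by
  have h := hasDerivAt_exp_smul_const' (𝕂 := ℝ) (-Bᵀ) τ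
  simp only [smul_neg, neg_mul] at h
  exact h

theorem hasDerivAt_flowOp (B : Matrix (Coord p) (Coord p) ℝ) (τ : ℝ) (x : Space p) :
    HasDerivAt (fun τ => flowOp B τ x) (-(op Bᵀ (flowOp B τ x))) τ := by
  open scoped Matrix.Norms.L2Operator in
  have h := hasDerivAt_flow B τ
  let φ : Matrix (Coord p) (Coord p) ℝ →ₗ[ℝ] Space p :=
    { toFun := fun M => op M x, map_add' := fun M M' => op_add M M' x,
      map_smul' := fun c M => op_smul c M x }
  have h2 := (LinearMap.toContinuousLinearMap φ).hasFDerivAt.comp_hasDerivAt τ h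
  have e : (LinearMap.toContinuousLinearMap φ) (-(Bᵀ * flow B τ)) = -(op Bᵀ (flowOp B τ x)) := by
    rw [map_neg]; exact congrArg Neg.neg (op_mul _ _ x)
  rw [e] at h2
  exact h2

theorem hasDerivAt_flow_entry (B : Matrix (Coord p) (Coord p) ℝ) (τ : ℝ) (k l : Coord p) :
    HasDerivAt (fun τ => flow B τ k l) (-(Bᵀ * flow B τ) k l) τ := by
  open scoped Matrix.Norms.L2Operator in
  have h := hasDerivAt_flow B τ
  let φ : Matrix (Coord p) (Coord p) ℝ →ₗ[ℝ] ℝ :=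
    { toFun := fun M => M k l, map_add' := fun M M' => rfl, map_smul' := fun c M => rfl }
  exact (LinearMap.toContinuousLinearMap φ).hasFDerivAt.comp_hasDerivAt τ h

theorem continuous_flow_entry (B : Matrix (Coord p) (Coord p) ℝ) (k l : Coord p) :
    Continuous fun τ => flow B τ k l :=
  continuous_iff_continuousAt.2 fun τ => (hasDerivAt_flow_entry B τ k l).continuousAt

theorem continuous_flowOp_apply (B : Matrix (Coord p) (Coord p) ℝ) :
    Continuous fun q : ℝ × Space p => flowOp B q.1 q.2 := by
  refine (PiLp.continuous_toLp 2 _).comp (continuous_pi fun k => ?_)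
  change Continuous fun q : ℝ × Space p => flowOp B q.1 q.2 k
  simp only [flowOp, op_apply]
  have := continuous_flow_entry B
  fun_prop

@[fun_prop]
theorem continuous_flowOp_comp {X : Type*} [TopologicalSpace X]
    (B : Matrix (Coord p) (Coord p) ℝ) {f : X → ℝ} {g : X → Space p} (hf : Continuous f)
    (hg : Continuous g) : Continuous fun a => flowOp B (f a) (g a) := by
  have h := (continuous_flowOp_apply B).comp (hf.prodMk hg)
  exact h

@[fun_prop]
theorem continuous_dil_comp {X : Type*} [TopologicalSpace X]
    {f : X → ℝ} {g : X → Space p} (hf : Continuous f)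
    (hg : Continuous g) : Continuous fun a => dil (f a) (g a) := by
  have h := continuous_dil_apply.comp (hf.prodMk hg)
  exact h

/-- `Bᵀ` maps each block to the next one, whose weight is larger by exactly `2`. This is the source
of the parabolic scaling of time by `r ^ 2`. -/
theorem dilMatrix_mul_transpose {B : Matrix (Coord p) (Coord p) ℝ} (hB : IsDrift p B) (r : ℝ) :
    dilMatrix p r * Bᵀ = r ^ 2 • (Bᵀ * dilMatrix p r) := by
  ext k l
  simp only [dilMatrix, Matrix.diagonal_mul, Matrix.smul_apply, Matrix.mul_diagonal,
    Matrix.transpose_apply, smul_eq_mul]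
  by_cases h : (k.1 : ℕ) = (l.1 : ℕ) + 1
  · have : weight k = weight l + 2 := by simp only [weight]; omega
    rw [this]; ring
  · rw [hB.zero_of_ne l k h]; ring

theorem dil_op_transpose {B : Matrix (Coord p) (Coord p) ℝ} (hB : IsDrift p B) (r : ℝ)
    (x : Space p) : dil r (op Bᵀ x) = r ^ 2 • op Bᵀ (dil r x) := by
  rw [dil, ← op_mul, dilMatrix_mul_transpose hB, op_smul, op_mul]

theorem dilMatrix_mul_inv {r : ℝ} (hr : r ≠ 0) : dilMatrix p r * dilMatrix p r⁻¹ = 1 := by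
  simp only [dilMatrix, Matrix.diagonal_mul_diagonal, ← mul_pow, mul_inv_cancel₀ hr, one_pow]
  exact Matrix.diagonal_one

/-- Conjugation by the dilation multiplies the exponent `-τ Bᵀ` by `r ^ 2`, and conjugation passes
through the exponential. -/
theorem dilMatrix_mul_flow {B : Matrix (Coord p) (Coord p) ℝ} (hB : IsDrift p B) {r : ℝ}
    (hr : r ≠ 0) (τ : ℝ) :
    dilMatrix p r * flow B τ = flow B (r ^ 2 * τ) * dilMatrix p r := by
  have h1 := dilMatrix_mul_inv (p := p) hr
  have hu : IsUnit (dilMatrix p r) := IsUnit.of_mul_eq_one _ h1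
  have hinv : (dilMatrix p r)⁻¹ = dilMatrix p r⁻¹ := Matrix.inv_eq_right_inv h1
  have h2 : flow B (r ^ 2 * τ) = dilMatrix p r * flow B τ * (dilMatrix p r)⁻¹ := by
    unfold flow
    rw [← Matrix.exp_conj _ _ hu]
    congr 1
    rw [Matrix.mul_neg, Matrix.neg_mul, Matrix.mul_smul, dilMatrix_mul_transpose hB,
      Matrix.smul_mul, Matrix.smul_mul, Matrix.mul_assoc, hinv, h1, Matrix.mul_one, smul_smul,
      mul_comm τ]
  rw [h2, Matrix.mul_assoc, Matrix.nonsing_inv_mul _ ((Matrix.isUnit_iff_isUnit_det _).1 hu),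
    Matrix.mul_one]

theorem dil_flowOp {B : Matrix (Coord p) (Coord p) ℝ} (hB : IsDrift p B) {r : ℝ}
    (hr : r ≠ 0) (τ : ℝ) (x : Space p) :
    dil r (flowOp B τ x) = flowOp B (r ^ 2 * τ) (dil r x) := by
  rw [dil, flowOp, ← op_mul, dilMatrix_mul_flow hB hr, op_mul]; rfl

/-- A uniform bound for the flow over bounded times. -/
theorem exists_flowOp_bound (B : Matrix (Coord p) (Coord p) ℝ) (T : ℝ) :
    ∃ K : ℝ, 1 ≤ K ∧ ∀ τ : ℝ, |τ| ≤ T → ∀ x : Space p, ‖flowOp B τ x‖ ≤ K * ‖x‖ ∧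
      ‖flowOp B τ x - x‖ ≤ K * |τ| * ‖x‖ := by
  have hc : IsCompact (Set.Icc (-T) T ×ˢ Metric.sphere (0 : Space p) 1) :=
    isCompact_Icc.prod (isCompact_sphere _ _)
  obtain ⟨K, hK⟩ := hc.exists_bound_of_continuousOn (continuous_flowOp_apply B).continuousOn
  have hb : ∀ τ : ℝ, |τ| ≤ T → ∀ x : Space p, ‖flowOp B τ x‖ ≤ |K| * ‖x‖ := by
    intro τ hτ x
    rcases eq_or_ne x 0 with rfl | hx
    · simp
    have hx' : 0 < ‖x‖ := norm_pos_iff.2 hx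
    have := hK (τ, ‖x‖⁻¹ • x) ⟨abs_le.1 hτ, by simp [norm_smul, hx'.ne']⟩
    simp only [map_smul, norm_smul, norm_inv, norm_norm] at this
    rw [inv_mul_le_iff₀ hx'] at this
    nlinarith [le_abs_self K]
  refine ⟨1 + |K| + ‖op (p := p) Bᵀ‖ * |K|, ?_, fun τ hτ x => ⟨?_, ?_⟩⟩
  · have : 0 ≤ ‖op (p := p) Bᵀ‖ * |K| := by positivity
    linarith [abs_nonneg K]
  · refine (hb τ hτ x).trans ?_
    have : 0 ≤ ‖op (p := p) Bᵀ‖ * |K| := by positivity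
    gcongr; linarith
  -- Mean value inequality along the flow, whose velocity is `-Bᵀ E(s) x`.
  · have hd := (convex_uIcc (0:ℝ) τ).norm_image_sub_le_of_norm_hasDerivWithin_le
      (f := fun τ => flowOp B τ x) (f' := fun τ => -(op Bᵀ (flowOp B τ x)))
      (C := ‖op (p := p) Bᵀ‖ * |K| * ‖x‖) (x := 0) (y := τ)
      (fun s _ => (hasDerivAt_flowOp B s x).hasDerivWithinAt) (fun s hs => by
        rw [norm_neg]
        refine ((op Bᵀ).le_opNorm _).trans ?_
        rw [mul_assoc]
        refine mul_le_mul_of_nonneg_left (hb s ?_ x) (norm_nonneg _)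
        refine le_trans ?_ hτ
        rcases Set.mem_uIcc.1 hs with h | h
        · rw [abs_of_nonneg h.1, abs_of_nonneg (h.1.trans h.2)]; exact h.2
        · rw [abs_of_nonpos h.2, abs_of_nonpos (h.1.trans h.2)]; linarith [h.1])
      Set.left_mem_uIcc Set.right_mem_uIcc
    simp only [flowOp_zero, sub_zero, Real.norm_eq_abs] at hd
    refine hd.trans ?_
    have : 0 ≤ (1 + |K|) * |τ| * ‖x‖ := by positivity
    nlinarith

end FlowDilation

end Kolmogorov

namespace Kolmogorov

open Filter Topology MeasureTheory
open scoped Matrix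

/-! ### The covariance matrix and its Lyapunov equation -/

section Gram

variable {n : ℕ} {p : Fin (n + 1) → ℕ}

/-- `A` is symmetric and vanishes outside of its leading block. -/
structure IsLeading (A : Matrix (Coord p) (Coord p) ℝ) : Prop where
  isSymm : A.IsSymm
  zero_of_ne : ∀ k l : Coord p, k.1 ≠ 0 ∨ l.1 ≠ 0 → A k l = 0

/-- The squared length `|x^{(p₀)}|²` of the leading block. -/
noncomputable def headSq (v : Space p) : ℝ := ∑ k : Coord p, if k.1 = 0 then v k ^ 2 else 0

/-- The integrand `E(s) A E(s)ᵀ` of the covariance matrix. -/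
noncomputable def gram (B A : Matrix (Coord p) (Coord p) ℝ) (s : ℝ) :
    Matrix (Coord p) (Coord p) ℝ :=
  flow B s * A * (flow B s)ᵀ

/-- The covariance matrix `∫₀¹ E(s) A E(s)ᵀ ds`. -/
noncomputable def covariance (B A : Matrix (Coord p) (Coord p) ℝ) :
    Matrix (Coord p) (Coord p) ℝ :=
  Matrix.of fun k l => ∫ s in (0 : ℝ)..1, gram B A s k l

/-- The generator of the dilations in the time scale: half of the weights. -/
noncomputable def halfWeight (p : Fin (n + 1) → ℕ) : Matrix (Coord p) (Coord p) ℝ :=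
  Matrix.diagonal fun k => (weight k : ℝ) / 2

theorem gram_isSymm {A : Matrix (Coord p) (Coord p) ℝ} (hA : A.IsSymm)
    (B : Matrix (Coord p) (Coord p) ℝ) (s : ℝ) : (gram B A s).IsSymm := by
  simp [Matrix.IsSymm, gram, Matrix.transpose_mul, hA.eq, Matrix.mul_assoc]

theorem gram_apply (B A : Matrix (Coord p) (Coord p) ℝ) (s : ℝ) (k l : Coord p) :
    gram B A s k l = ∑ b, ∑ a, flow B s k a * A a b * flow B s l b := by
  simp only [gram, Matrix.mul_apply, Matrix.transpose_apply, Finset.sum_mul]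

theorem hasDerivAt_gram (B A : Matrix (Coord p) (Coord p) ℝ) (s : ℝ) (k l : Coord p) :
    HasDerivAt (fun s => gram B A s k l) (-(Bᵀ * gram B A s + gram B A s * B) k l) s := by
  simp only [gram_apply]
  have h := HasDerivAt.fun_sum (u := Finset.univ) fun b (_ : b ∈ Finset.univ) =>
    HasDerivAt.fun_sum (u := Finset.univ) fun a (_ : a ∈ Finset.univ) =>
      ((hasDerivAt_flow_entry B s k a).mul_const (A a b)).mul (hasDerivAt_flow_entry B s l b)
  refine h.congr_deriv ?_
  have e : -(Bᵀ * gram B A s + gram B A s * B) k l =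
      ((-(Bᵀ * flow B s)) * A * (flow B s)ᵀ + flow B s * A * (-(Bᵀ * flow B s))ᵀ) k l := by
    rw [gram, Matrix.transpose_neg, Matrix.transpose_mul, Matrix.transpose_transpose]
    simp only [Matrix.neg_mul, Matrix.mul_neg, Matrix.mul_assoc, Matrix.add_apply,
      Matrix.neg_apply]
    ring
  rw [e, Matrix.add_apply, Matrix.mul_apply, Matrix.mul_apply, ← Finset.sum_add_distrib]
  refine Finset.sum_congr rfl fun b _ => ?_
  rw [Matrix.mul_apply (M := -(Bᵀ * flow B s)), Matrix.mul_apply (M := flow B s) (N := A),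
    Finset.sum_mul, Finset.sum_mul, ← Finset.sum_add_distrib]
  rfl

theorem continuous_gram (B A : Matrix (Coord p) (Coord p) ℝ) (k l : Coord p) :
    Continuous fun s => gram B A s k l :=
  continuous_iff_continuousAt.2 fun s => (hasDerivAt_gram B A s k l).continuousAt

/-- With `D = δ_r` and `s = r ^ 2`, `E(s) = D E(1) D⁻¹`, and `D A D = r ^ 2 A` because `A` lives on
the block of weight `1`. Comparing entries leaves the power `weight k + weight l - 2` of `r`. -/
theorem gram_homogeneous {B A : Matrix (Coord p) (Coord p) ℝ} (hB : IsDrift p B)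
    (hA : IsLeading A) {s : ℝ} (hs : 0 < s) (k l : Coord p) :
    gram B A s k l = s ^ ((k.1 : ℕ) + (l.1 : ℕ)) * gram B A 1 k l := by
  obtain ⟨r, hr, rfl⟩ : ∃ r : ℝ, 0 < r ∧ s = r ^ 2 :=
    ⟨√s, Real.sqrt_pos.2 hs, (Real.sq_sqrt hs.le).symm⟩
  have hdA : dilMatrix p r * A * dilMatrix p r = r ^ 2 • A := by
    ext a b
    simp only [dilMatrix, Matrix.mul_diagonal, Matrix.diagonal_mul, Matrix.smul_apply,
      smul_eq_mul]
    by_cases h : a.1 ≠ 0 ∨ b.1 ≠ 0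
    · rw [hA.zero_of_ne a b h]; ring
    · push Not at h
      simp only [weight, h.1, h.2, Fin.val_zero]; ring
  have h1 := dilMatrix_mul_flow hB hr.ne' 1
  have h2 : (dilMatrix p r * gram B A 1 * dilMatrix p r) = r ^ 2 • gram B A (r ^ 2) := by
    have ht : (flow B 1)ᵀ * dilMatrix p r = dilMatrix p r * (flow B (r ^ 2 * 1))ᵀ := by
      have := congrArg Matrix.transpose h1
      simpa [Matrix.transpose_mul, dilMatrix] using this
    calc dilMatrix p r * gram B A 1 * dilMatrix p r
        = (dilMatrix p r * flow B 1) * A * ((flow B 1)ᵀ * dilMatrix p r) := by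
          simp only [gram, Matrix.mul_assoc]
      _ = flow B (r ^ 2 * 1) * (dilMatrix p r * A * dilMatrix p r) * (flow B (r ^ 2 * 1))ᵀ := by
          rw [h1, ht]; simp only [Matrix.mul_assoc]
      _ = _ := by rw [hdA, mul_one]; simp [gram]
  have h3 := congrFun (congrFun h2 k) l
  simp only [dilMatrix, Matrix.mul_diagonal, Matrix.diagonal_mul, Matrix.smul_apply,
    smul_eq_mul] at h3
  have hr2 : r ^ 2 ≠ 0 := by positivity
  apply mul_left_cancel₀ hr2
  rw [← h3]
  simp only [weight]; ring

theorem covariance_isSymm {A : Matrix (Coord p) (Coord p) ℝ} (hA : A.IsSymm)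
    (B : Matrix (Coord p) (Coord p) ℝ) : (covariance B A).IsSymm := by
  ext k l
  simp only [covariance, Matrix.transpose_apply, Matrix.of_apply]
  exact intervalIntegral.integral_congr fun s _ => (gram_isSymm hA B s).apply k l

/-- The integral over `[0, 1]` of the derivative of the integrand, which is `A` at time `0`. -/
theorem transpose_mul_covariance (B A : Matrix (Coord p) (Coord p) ℝ) :
    Bᵀ * covariance B A + covariance B A * B = A - gram B A 1 := by
  ext k l
  have h := intervalIntegral.integral_eq_sub_of_hasDerivAt (a := 0) (b := 1)
    (fun s _ => hasDerivAt_gram B A s k l) (Continuous.intervalIntegrable (by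
      simp only [Matrix.add_apply, Matrix.mul_apply]
      have := continuous_gram B A
      fun_prop) _ _)
  have h0 : gram B A 0 = A := by simp [gram, flow_zero]
  rw [h0, intervalIntegral.integral_neg] at h
  rw [Matrix.sub_apply]
  have e : (Bᵀ * covariance B A + covariance B A * B) k l =
      ∫ s in (0 : ℝ)..1, (Bᵀ * gram B A s + gram B A s * B) k l := by
    have hi : ∀ k l, IntervalIntegrable (fun s => gram B A s k l) volume 0 1 := fun k l =>
      (continuous_gram B A k l).intervalIntegrable _ _
    simp only [Matrix.add_apply, Matrix.mul_apply, covariance, Matrix.of_apply]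
    rw [intervalIntegral.integral_add, intervalIntegral.integral_finsetSum,
      intervalIntegral.integral_finsetSum]
    · simp only [intervalIntegral.integral_const_mul, intervalIntegral.integral_mul_const]
    · exact fun i _ => (hi _ _).mul_const _
    · exact fun i _ => (hi _ _).const_mul _
    all_goals
      refine Continuous.intervalIntegrable ?_ _ _
      have := continuous_gram B A
      fun_prop
  rw [e]; linarith

/-- By homogeneity the integral of the `(k, l)` entry is its value at time `1` divided by `i + j +
1`, where `i`, `j` are the blocks of `k`, `l`; half the sum of the two weights is exactly `i + j +
1`. -/
theorem halfWeight_mul_covariance {B A : Matrix (Coord p) (Coord p) ℝ} (hB : IsDrift p B)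
    (hA : IsLeading A) :
    halfWeight p * covariance B A + covariance B A * halfWeight p = gram B A 1 := by
  ext k l
  have e : covariance B A k l = gram B A 1 k l / ((k.1 : ℕ) + (l.1 : ℕ) + 1) := by
    have : covariance B A k l =
        ∫ s in (0 : ℝ)..1, s ^ ((k.1 : ℕ) + (l.1 : ℕ)) * gram B A 1 k l := by
      simp only [covariance, Matrix.of_apply]
      refine intervalIntegral.integral_congr_ae (Eventually.of_forall fun s hs => ?_)
      rw [Set.uIoc_of_le zero_le_one] at hs
      exact gram_homogeneous hB hA hs.1 k l
    rw [this, intervalIntegral.integral_mul_const, integral_pow]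
    push_cast; simp; ring
  simp only [halfWeight, Matrix.add_apply, Matrix.diagonal_mul, Matrix.mul_diagonal, e, weight]
  have : ((k.1 : ℕ) : ℝ) + (l.1 : ℕ) + 1 ≠ 0 := by positivity
  push_cast
  field_simp
  ring

/-- The Lyapunov equation satisfied by the covariance matrix. -/
theorem lyapunov_covariance {B A : Matrix (Coord p) (Coord p) ℝ} (hB : IsDrift p B)
    (hA : IsLeading A) :
    (halfWeight p + Bᵀ) * covariance B A + covariance B A * (halfWeight p + B) = A := by
  have h1 := transpose_mul_covariance B A
  have h2 := halfWeight_mul_covariance hB hA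
  rw [Matrix.add_mul, Matrix.mul_add]
  calc _ = (halfWeight p * covariance B A + covariance B A * halfWeight p)
        + (Bᵀ * covariance B A + covariance B A * B) := by abel
    _ = A := by rw [h1, h2]; abel

end Gram

end Kolmogorov

namespace Kolmogorov

open Filter Topology MeasureTheory
open scoped Matrix

/-! ### Positivity of the covariance matrix and the properties of its inverse -/

section Frozen

variable {n : ℕ} {p : Fin (n + 1) → ℕ}

theorem inner_op_eq_sum (M : Matrix (Coord p) (Coord p) ℝ) (x y : Space p) :
    inner ℝ x (op M y) = ∑ k, ∑ l, x k * (M k l * y l) := by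
  simp only [inner_eq_sum, op_apply, Finset.mul_sum]

theorem continuous_op_flow_transpose (B : Matrix (Coord p) (Coord p) ℝ) :
    Continuous fun q : ℝ × Space p => op (flow B q.1)ᵀ q.2 := by
  refine (PiLp.continuous_toLp 2 _).comp (continuous_pi fun k => ?_)
  change Continuous fun q : ℝ × Space p => op (flow B q.1)ᵀ q.2 k
  simp only [op_apply, Matrix.transpose_apply]
  have := continuous_flow_entry B
  fun_prop

theorem continuous_headSq : Continuous (headSq (p := p)) := by
  unfold headSq
  refine continuous_finsetSum _ fun k _ => ?_
  split_ifs
  · fun_prop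
  · exact continuous_const

theorem headSq_nonneg (v : Space p) : 0 ≤ headSq v :=
  Finset.sum_nonneg fun k _ => by split_ifs <;> positivity

theorem headSq_smul (c : ℝ) (v : Space p) : headSq (c • v) = c ^ 2 * headSq v := by
  simp only [headSq, Finset.mul_sum]
  refine Finset.sum_congr rfl fun k _ => ?_
  split_ifs
  · simp [mul_pow]
  · simp

theorem inner_op_covariance (B A : Matrix (Coord p) (Coord p) ℝ) (v : Space p) :
    inner ℝ v (op (covariance B A) v) =
      ∫ s in (0 : ℝ)..1, inner ℝ (op (flow B s)ᵀ v) (op A (op (flow B s)ᵀ v)) := by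
  have h : ∀ s, inner ℝ (op (flow B s)ᵀ v) (op A (op (flow B s)ᵀ v)) =
      ∑ k, ∑ l, v k * (gram B A s k l * v l) := fun s => by
    rw [← inner_op_eq_sum, gram, op_mul, op_mul, inner_op (flow B s)]
  have := continuous_gram B A
  simp only [h, inner_op_eq_sum, covariance, Matrix.of_apply]
  rw [intervalIntegral.integral_finsetSum]
  · refine Finset.sum_congr rfl fun k _ => ?_
    rw [intervalIntegral.integral_finsetSum]
    · simp only [intervalIntegral.integral_const_mul, intervalIntegral.integral_mul_const]
    · intro l _
      exact Continuous.intervalIntegrable (by fun_prop) _ _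
  · intro l _
    exact Continuous.intervalIntegrable (by fun_prop) _ _

/-- The quadratic form of the covariance matrix of the identity on the leading block. -/
noncomputable def energy (B : Matrix (Coord p) (Coord p) ℝ) (v : Space p) : ℝ :=
  ∫ s in (0 : ℝ)..1, headSq (op (flow B s)ᵀ v)

theorem continuous_headSq_flow (B : Matrix (Coord p) (Coord p) ℝ) :
    Continuous fun q : ℝ × Space p => headSq (op (flow B q.1)ᵀ q.2) :=
  continuous_headSq.comp (continuous_op_flow_transpose B)

theorem continuous_integral_section {X : Type*} [TopologicalSpace X] [FirstCountableTopology X]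
    {F : ℝ × X → ℝ} (hF : Continuous F) : Continuous fun v => ∫ s in (0 : ℝ)..1, F (s, v) :=
  intervalIntegral.continuous_parametric_intervalIntegral_of_continuous' (μ := volume)
    (f := fun v s => F (s, v)) (hF.comp continuous_swap) 0 1

theorem continuous_section {X Y : Type*} [TopologicalSpace X] [TopologicalSpace Y]
    {F : ℝ × X → Y} (hF : Continuous F) (v : X) : Continuous fun s => F (s, v) := by
  fun_prop

theorem continuous_energy (B : Matrix (Coord p) (Coord p) ℝ) : Continuous (energy B) := by
  have h := continuous_integral_section (continuous_headSq_flow B)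
  exact h

theorem energy_smul (B : Matrix (Coord p) (Coord p) ℝ) (c : ℝ) (v : Space p) :
    energy B (c • v) = c ^ 2 * energy B v := by
  simp only [energy, map_smul, headSq_smul, intervalIntegral.integral_const_mul]

theorem mulVec_injective_of_rank {l m : ℕ} (M : Matrix (Fin l) (Fin m) ℝ) (h : M.rank = m)
    (v : Fin m → ℝ) (hv : M.mulVec v = 0) : v = 0 := by
  have h1 := LinearMap.finrank_range_add_finrank_ker M.mulVecLin
  rw [show Module.finrank ℝ (LinearMap.range M.mulVecLin) = m from h] at h1
  simp only [Module.finrank_fintype_fun_eq_card, Fintype.card_fin] at h1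
  have h2 : Module.finrank ℝ (LinearMap.ker M.mulVecLin) = 0 := by omega
  have h3 := Submodule.finrank_eq_zero.1 h2
  have : v ∈ LinearMap.ker M.mulVecLin := by simpa using hv
  rw [h3] at this
  simpa using this

/-- The Kalman rank condition in the form of unique continuation along the powers of `B`. -/
theorem eq_zero_of_head_pow_eq_zero {B : Matrix (Coord p) (Coord p) ℝ} (hB : IsDrift p B)
    (y : Space p) (h : ∀ j : ℕ, ∀ k : Coord p, k.1 = 0 → op (B ^ j) y k = 0) : y = 0 := by
  have key : ∀ i : ℕ, ∀ j : ℕ, ∀ k : Coord p, (k.1 : ℕ) = i → op (B ^ j) y k = 0 := by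
    intro i
    induction i with
    | zero => exact fun j k hk => h j k (Fin.ext hk)
    | succ i ih =>
      rintro j ⟨⟨i', hi'⟩, a⟩ hk
      simp only at hk
      subst hk
      let q : Fin n := ⟨i, by omega⟩
      -- The `i`-th block of `B ^ (j + 1) y` is the block `𝔹_{i+1}` applied to the `(i+1)`-st block
      -- of `B ^ j y`; full column rank makes that block of `y` vanish in turn.
      have hz := mulVec_injective_of_rank _ (hB.rank_block q)
        (fun a => op (B ^ j) y ⟨q.succ, a⟩) (by
          ext b
          have h1 := ih (j + 1) ⟨q.castSucc, b⟩ rfl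
          rw [pow_succ', op_mul, op_apply, ← Finset.univ_sigma_univ, Finset.sum_sigma] at h1
          rw [Finset.sum_eq_single q.succ] at h1
          · exact h1
          · intro i'' _ hne
            refine Finset.sum_eq_zero fun c _ => ?_
            rw [hB.zero_of_ne, zero_mul]
            intro h3
            exact hne (Fin.ext h3)
          · simp)
      exact congrFun hz a
  ext k
  have := key k.1 0 k rfl
  rwa [pow_zero, op_one] at this

theorem hasDerivAt_op_flow_transpose (B : Matrix (Coord p) (Coord p) ℝ) (j : ℕ) (v : Space p)
    (k : Coord p) (s : ℝ) :
    HasDerivAt (fun s => op (B ^ j) (op (flow B s)ᵀ v) k)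
      (-(op (B ^ (j + 1)) (op (flow B s)ᵀ v) k)) s := by
  have hc : Bᵀ * flow B s = flow B s * Bᵀ := by
    have : Commute (-(s • Bᵀ)) Bᵀ := ((Commute.refl Bᵀ).smul_left s).neg_left
    open scoped Matrix.Norms.L2Operator in
    exact (this.exp_left).eq.symm
  have hc' : B * (flow B s)ᵀ = (flow B s)ᵀ * B := by
    have := congrArg Matrix.transpose hc
    simpa [Matrix.transpose_mul] using this.symm
  rw [pow_succ, op_mul, ← op_mul B, hc']
  simp only [op_apply]
  have h := HasDerivAt.fun_sum (u := Finset.univ) fun l (_ : l ∈ Finset.univ) =>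
    (HasDerivAt.fun_sum (u := Finset.univ) fun a (_ : a ∈ Finset.univ) =>
      (hasDerivAt_flow_entry B s a l).mul_const (v a)).const_mul ((B ^ j) k l)
  refine h.congr_deriv ?_
  rw [← Finset.sum_neg_distrib]
  refine Finset.sum_congr rfl fun l _ => ?_
  rw [← mul_neg, ← Finset.sum_neg_distrib]
  congr 1
  refine Finset.sum_congr rfl fun a _ => ?_
  rw [hc, ← Matrix.transpose_apply ((flow B s) * Bᵀ), Matrix.transpose_mul, Matrix.transpose_transpose,
    ← hc']
  ring

/-- If the integral vanishes, so does the head of `E(s)ᵀ v` for all `s`. Differentiating `j` times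
in `s` brings down `B ^ j`, so all heads of `B ^ j E(s)ᵀ v` vanish and the rank condition applies.
-/
theorem energy_pos {B : Matrix (Coord p) (Coord p) ℝ} (hB : IsDrift p B) {v : Space p}
    (hv : v ≠ 0) : 0 < energy B v := by
  by_contra hcon
  have hcont := continuous_section (continuous_headSq_flow B) v
  dsimp only at hcont
  have hz : ∀ s ∈ Set.Icc (0 : ℝ) 1, headSq (op (flow B s)ᵀ v) = 0 := by
    by_contra hne
    push Not at hne
    obtain ⟨s, hs, hne⟩ := hne
    exact hcon (intervalIntegral.integral_pos zero_lt_one hcont.continuousOn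
      (fun _ _ => headSq_nonneg _) ⟨s, hs, lt_of_le_of_ne (headSq_nonneg _) hne.symm⟩)
  have hj : ∀ j : ℕ, ∀ s ∈ Set.Ioo (0 : ℝ) 1, ∀ k : Coord p, k.1 = 0 →
      op (B ^ j) (op (flow B s)ᵀ v) k = 0 := by
    intro j
    induction j with
    | zero =>
      intro s hs k hk
      have := (Finset.sum_eq_zero_iff_of_nonneg (fun k _ => by split_ifs <;> positivity)).1
        (hz s ⟨hs.1.le, hs.2.le⟩) k (Finset.mem_univ k)
      rw [if_pos hk] at this
      rw [pow_zero, op_one]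
      exact pow_eq_zero_iff two_ne_zero |>.1 this
    | succ j ih =>
      intro s hs k hk
      have h1 := hasDerivAt_op_flow_transpose B j v k s
      have h2 : (fun s => op (B ^ j) (op (flow B s)ᵀ v) k) =ᶠ[𝓝 s] fun _ => 0 := by
        filter_upwards [isOpen_Ioo.mem_nhds hs] with s' hs' using ih s' hs' k hk
      have h3 := h1.unique ((hasDerivAt_const s (0 : ℝ)).congr_of_eventuallyEq h2)
      linarith
  have h0 := eq_zero_of_head_pow_eq_zero hB _ fun j k hk => hj j (1 / 2) (by norm_num) k hk
  apply hv
  have h1 : (flow B (-(1 / 2)))ᵀ * (flow B (1 / 2))ᵀ = 1 := by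
    rw [← Matrix.transpose_mul, ← flow_add]
    norm_num [flow_zero]
  have h2 := op_mul (flow B (-(1 / 2)))ᵀ (flow B (1 / 2))ᵀ v
  rw [h1, op_one, h0, map_zero] at h2
  exact h2

/-- Continuity, positivity and homogeneity of degree two, by compactness of the unit sphere. -/
theorem exists_energy_bounds {B : Matrix (Coord p) (Coord p) ℝ} (hB : IsDrift p B) :
    ∃ a b : ℝ, 0 < a ∧ 0 < b ∧ ∀ v : Space p, a * ‖v‖ ^ 2 ≤ energy B v ∧ energy B v ≤ b * ‖v‖ ^ 2 := by
  have hs : IsCompact (Metric.sphere (0 : Space p) 1) := isCompact_sphere _ _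
  have hscale : ∀ v : Space p, v ≠ 0 → energy B v = energy B (‖v‖⁻¹ • v) * ‖v‖ ^ 2 := by
    intro v hv
    have : ‖v‖ ≠ 0 := norm_ne_zero_iff.2 hv
    rw [energy_smul]; field_simp
  have hmem : ∀ v : Space p, v ≠ 0 → ‖v‖⁻¹ • v ∈ Metric.sphere (0 : Space p) 1 := by
    intro v hv
    simp [norm_smul, norm_ne_zero_iff.2 hv]
  have h00 : energy B (0 : Space p) = 0 := by simpa using energy_smul B 0 (0 : Space p)
  rcases (Metric.sphere (0 : Space p) 1).eq_empty_or_nonempty with he | hne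
  · refine ⟨1, 1, one_pos, one_pos, fun v => ?_⟩
    have : v = 0 := by
      by_contra hv
      have := hmem v hv
      rw [he] at this
      exact this
    subst this
    simp [h00]
  · obtain ⟨v1, hv1, hmin⟩ := hs.exists_isMinOn hne (continuous_energy B).continuousOn
    obtain ⟨v2, hv2, hmax⟩ := hs.exists_isMaxOn hne (continuous_energy B).continuousOn
    have hnz : ∀ w ∈ Metric.sphere (0 : Space p) 1, w ≠ 0 := by
      rintro w hw rfl
      simp at hw
    refine ⟨energy B v1, energy B v2, energy_pos hB (hnz _ hv1), energy_pos hB (hnz _ hv2),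
      fun v => ?_⟩
    rcases eq_or_ne v 0 with rfl | hv
    · simp [h00]
    · rw [hscale v hv]
      exact ⟨mul_le_mul_of_nonneg_right (hmin (hmem v hv)) (by positivity),
        mul_le_mul_of_nonneg_right (hmax (hmem v hv)) (by positivity)⟩

/-- A family of vectors of the leading block whose square `∑ sᵢ sᵢᵀ` is `ε`-close to `A`. -/
structure Admissible (ε : ℝ) (A : Matrix (Coord p) (Coord p) ℝ) {m : ℕ}
    (s : Fin m → Space p) : Prop where
  zero_of_ne : ∀ i, ∀ k : Coord p, k.1 ≠ 0 → s i k = 0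
  lower : ∀ v, (1 - ε) * inner ℝ v (op A v) ≤ ∑ i, inner ℝ (s i) v ^ 2
  upper : ∀ v, ∑ i, inner ℝ (s i) v ^ 2 ≤ (1 + ε) * inner ℝ v (op A v)

/-- The properties of the inverse `M` of the covariance matrix of a constant matrix `A`. -/
structure IsPrecision (B A : Matrix (Coord p) (Coord p) ℝ) (c₁ c₂ : ℝ)
    (M : Space p →L[ℝ] Space p) : Prop where
  symm : ∀ x y, inner ℝ (M x) y = inner ℝ x (M y)
  lower : ∀ x, c₁ * ‖x‖ ^ 2 ≤ inner ℝ x (M x)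
  upper : ∀ x, inner ℝ x (M x) ≤ c₂ * ‖x‖ ^ 2
  nonneg : ∀ x, 0 ≤ inner ℝ x (op A x)
  lyapunov : ∀ x, 2 * inner ℝ (M x) (op (halfWeight p + Bᵀ) x) = inner ℝ (M x) (op A (M x))
  trace : ∀ ε : ℝ, ∀ m : ℕ, ∀ s : Fin m → Space p, Admissible ε A s →
    ∑ i, inner ℝ (s i) (M (s i)) ≤ (1 + ε) * homDim p

/-- This number is the trace of `A C⁻¹`, with `C` the covariance matrix of `A`, by the Lyapunov
equation; half of it is the decay exponent of the fundamental solution. -/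
theorem trace_halfWeight_add_transpose {B : Matrix (Coord p) (Coord p) ℝ} (hB : IsDrift p B) :
    (halfWeight p + Bᵀ).trace + (halfWeight p + B).trace = homDim p := by
  have hB0 : ∀ k, B k k = 0 := fun k => hB.zero_of_ne k k (by omega)
  simp only [Matrix.trace, Matrix.diag_apply, Matrix.add_apply, halfWeight, Matrix.diagonal_apply_eq,
    Matrix.transpose_apply, hB0, add_zero, homDim, ← Finset.sum_add_distrib]
  push_cast
  exact Finset.sum_congr rfl fun k _ => by ring

/-- Everything is read off from the Lyapunov equation for the covariance matrix, tested with `C⁻¹ x`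
for the quadratic identity and multiplied by `C⁻¹` for the trace. For the trace bound `C⁻¹` is
written as a sum of squares `∑ w_j w_jᵀ`, so that `ε`-closeness of quadratic forms can be applied to
each `w_j`. -/
theorem isPrecision_inv_covariance {B A : Matrix (Coord p) (Coord p) ℝ} (hB : IsDrift p B)
    (hA : IsLeading A) (hA0 : ∀ x, 0 ≤ inner ℝ x (op A x)) {a b : ℝ} (ha : 0 < a) (hb : 0 < b)
    (hlow : ∀ v, a * ‖v‖ ^ 2 ≤ inner ℝ v (op (covariance B A) v))
    (hupp : ∀ v, inner ℝ v (op (covariance B A) v) ≤ b * ‖v‖ ^ 2) :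
    IsPrecision B A b⁻¹ a⁻¹ (op (covariance B A)⁻¹) := by
  set C := covariance B A with hC
  have hCs : C.IsSymm := covariance_isSymm hA.isSymm B
  have hquad : ∀ v : Space p, v.ofLp ⬝ᵥ C *ᵥ v.ofLp = inner ℝ v (op C v) := fun v =>
    (Matrix.inner_toEuclideanCLM C v v).symm
  have hpd : C.PosDef := by
    refine Matrix.PosDef.of_dotProduct_mulVec_pos (by
      simpa [Matrix.IsHermitian, Matrix.conjTranspose_eq_transpose_of_trivial] using hCs.eq)
      fun x hx => ?_
    have h1 : (WithLp.toLp 2 x : Space p) ≠ 0 := by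
      intro h; apply hx; simpa using congrArg WithLp.ofLp h
    have h2 := hquad (WithLp.toLp 2 x)
    simp only [star_trivial]
    rw [show x ⬝ᵥ C *ᵥ x = _ from h2]
    exact lt_of_lt_of_le (by positivity [norm_pos_iff.2 h1]) (hlow _)
  have hdet : IsUnit C.det := hpd.isUnit.map Matrix.detMonoidHom
  have hCM : ∀ x, op C (op C⁻¹ x) = x := fun x => by
    rw [← op_mul, Matrix.mul_nonsing_inv _ hdet, op_one]
  have hMs : (C⁻¹)ᵀ = C⁻¹ := by rw [Matrix.transpose_nonsing_inv, hCs.eq]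
  have hsymm : ∀ x y, inner ℝ (op C⁻¹ x) y = inner ℝ x (op C⁻¹ y) := fun x y => by
    rw [inner_op, hMs]
  have hCsymm : ∀ x y, inner ℝ (op C x) y = inner ℝ x (op C y) := fun x y => by
    rw [inner_op, hCs.eq]
  refine ⟨hsymm, fun x => ?_, fun x => ?_, hA0, fun x => ?_, fun ε m s hs => ?_⟩
  · -- the discriminant of `t ↦ ⟨C (M x - t x), M x - t x⟩`
    set v := op C⁻¹ x with hv
    have hx : op C v = x := hCM x
    have h1 := (mul_nonneg ha.le (sq_nonneg _)).trans (hlow (v - b⁻¹ • x))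
    have h2 : inner ℝ (v - b⁻¹ • x) (op C (v - b⁻¹ • x)) =
        inner ℝ x v - 2 * b⁻¹ * ‖x‖ ^ 2 + b⁻¹ ^ 2 * inner ℝ x (op C x) := by
      simp only [map_sub, map_smul, inner_sub_left, inner_sub_right, inner_smul_left,
        inner_smul_right, hx, ← hCsymm, real_inner_self_eq_norm_sq, RCLike.conj_to_real]
      rw [real_inner_comm x v]; ring
    rw [h2] at h1
    have h3 : b⁻¹ ^ 2 * inner ℝ x (op C x) ≤ b⁻¹ * ‖x‖ ^ 2 := by
      calc _ ≤ b⁻¹ ^ 2 * (b * ‖x‖ ^ 2) := by gcongr; exact hupp x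
        _ = _ := by field_simp
    linarith
  · set v := op C⁻¹ x with hv
    have hx : op C v = x := hCM x
    have h1 := hlow v
    rw [hx] at h1
    have h2 : inner ℝ x v ≤ ‖x‖ * ‖v‖ := real_inner_le_norm x v
    rw [real_inner_comm] at h1
    have h3 : a * ‖v‖ ≤ ‖x‖ := by
      rcases (norm_nonneg v).eq_or_lt with h | h
      · rw [← h]; simp
      · nlinarith
    calc inner ℝ x v ≤ ‖x‖ * ‖v‖ := h2
      _ ≤ ‖x‖ * (a⁻¹ * ‖x‖) := by
        gcongr
        rw [inv_mul_eq_div, le_div_iff₀ ha]; linarith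
      _ = _ := by ring
  · set v := op C⁻¹ x with hv
    have hx : op C v = x := hCM x
    have h1 := congrArg (fun N => inner ℝ v (op N v)) (lyapunov_covariance hB hA)
    simp only [op_add, op_mul, inner_add_right] at h1
    rw [← hC, hx] at h1
    rw [← h1, op_add, inner_add_right, ← hCsymm, hx, two_mul]
    congr 1
    rw [← inner_add_right, ← op_add, ← op_add, real_inner_comm,
      ← Matrix.transpose_transpose (halfWeight p + B), inner_op (halfWeight p + B)ᵀᵀ,
      Matrix.transpose_transpose, Matrix.transpose_add]
    simp [halfWeight]
  · obtain ⟨m', w, hw⟩ := Matrix.posSemidef_iff_eq_sum_vecMulVec.1 hpd.inv.posSemidef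
    set w' : Fin m' → Space p := fun j => WithLp.toLp 2 (w j) with hw'
    have hM : ∀ x : Space p, inner ℝ x (op C⁻¹ x) = ∑ j, inner ℝ (w' j) x ^ 2 := by
      intro x
      rw [inner_op_eq_sum]
      simp only [hw, Matrix.sum_apply, Matrix.vecMulVec_apply, star_trivial, inner_eq_sum, hw',
        Finset.sum_mul, Finset.mul_sum, sq]
      rw [Finset.sum_comm' (t' := Finset.univ) (s' := fun _ => Finset.univ) (by simp)]
      simp only [Finset.sum_comm (s := (Finset.univ : Finset (Coord p))) (t := (Finset.univ : Finset (Fin m')))]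
      exact Finset.sum_congr rfl fun j _ => Finset.sum_congr rfl fun k _ =>
        Finset.sum_congr rfl fun l _ => by ring
    have htr : ∑ j, inner ℝ (w' j) (op A (w' j)) = homDim p := by
      have h1 : ∑ j, inner ℝ (w' j) (op A (w' j)) = (A * C⁻¹).trace := by
        simp only [inner_op_eq_sum, Matrix.trace, Matrix.diag_apply, Matrix.mul_apply, hw,
          Matrix.sum_apply, Matrix.vecMulVec_apply, star_trivial, hw', Finset.mul_sum]
        rw [Finset.sum_comm]
        refine Finset.sum_congr rfl fun k _ => ?_
        refine Finset.sum_congr rfl fun j _ => Finset.sum_congr rfl fun l _ => ?_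
        ring
      rw [h1, ← trace_halfWeight_add_transpose hB]
      nth_rewrite 1 [← lyapunov_covariance hB hA]
      rw [← hC, Matrix.add_mul, Matrix.trace_add, Matrix.mul_assoc, Matrix.mul_nonsing_inv _ hdet,
        Matrix.mul_one, Matrix.trace_mul_comm, ← Matrix.mul_assoc, Matrix.nonsing_inv_mul _ hdet,
        Matrix.one_mul]
    calc ∑ i, inner ℝ (s i) (op C⁻¹ (s i)) = ∑ j, ∑ i, inner ℝ (s i) (w' j) ^ 2 := by
          simp only [hM]
          rw [Finset.sum_comm]
          exact Finset.sum_congr rfl fun j _ => Finset.sum_congr rfl fun i _ => by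
            rw [real_inner_comm]
      _ ≤ ∑ j, (1 + ε) * inner ℝ (w' j) (op A (w' j)) :=
          Finset.sum_le_sum fun j _ => hs.upper (w' j)
      _ = _ := by rw [← Finset.mul_sum, htr]

/-- The precision matrix exists, with bounds depending only on the ellipticity constants. -/
theorem exists_isPrecision {B : Matrix (Coord p) (Coord p) ℝ} (hB : IsDrift p B) {lam Lam : ℝ}
    (hlam : 0 < lam) (hLam : 0 < Lam) :
    ∃ c₁ c₂ : ℝ, 0 < c₁ ∧ 0 < c₂ ∧ ∀ A : Matrix (Coord p) (Coord p) ℝ, IsLeading A →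
      (∀ v, lam * headSq v ≤ inner ℝ v (op A v)) → (∀ v, inner ℝ v (op A v) ≤ Lam * headSq v) →
      ∃ M : Space p →L[ℝ] Space p, IsPrecision B A c₁ c₂ M := by
  obtain ⟨a, b, ha, hb, hab⟩ := exists_energy_bounds hB
  refine ⟨(Lam * b)⁻¹, (lam * a)⁻¹, by positivity, by positivity, fun A hA h1 h2 => ⟨_,
    isPrecision_inv_covariance hB hA (fun x => (mul_nonneg hlam.le (headSq_nonneg x)).trans (h1 x))
      (mul_pos hlam ha) (mul_pos hLam hb) (fun v => ?_) (fun v => ?_)⟩⟩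
  all_goals
    have hc1 := (continuous_section (continuous_headSq_flow B) v).intervalIntegrable
      (μ := volume) 0 1
    dsimp only at hc1
    have hc2 : IntervalIntegrable (fun s => inner ℝ (op (flow B s)ᵀ v) (op A (op (flow B s)ᵀ v)))
        volume 0 1 := by
      have := continuous_section (continuous_op_flow_transpose B) v
      dsimp only at this
      exact Continuous.intervalIntegrable (by fun_prop) _ _
    rw [inner_op_covariance]
  · calc lam * a * ‖v‖ ^ 2 = lam * (a * ‖v‖ ^ 2) := by ring
      _ ≤ lam * energy B v := by gcongr; exact (hab v).1
      _ = ∫ s in (0 : ℝ)..1, lam * headSq (op (flow B s)ᵀ v) := by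
        rw [intervalIntegral.integral_const_mul]; rfl
      _ ≤ _ := intervalIntegral.integral_mono zero_le_one (hc1.const_mul _) hc2 fun s => h1 _
  · calc _ ≤ ∫ s in (0 : ℝ)..1, Lam * headSq (op (flow B s)ᵀ v) :=
        intervalIntegral.integral_mono zero_le_one hc2 (hc1.const_mul _) fun s => h2 _
      _ = Lam * energy B v := by
        rw [intervalIntegral.integral_const_mul]; rfl
      _ ≤ Lam * (b * ‖v‖ ^ 2) := by gcongr; exact (hab v).2
      _ = _ := by ring

end Frozen

end Kolmogorov

namespace Kolmogorov

open Filter Topology MeasureTheory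
open scoped Matrix

/-! ### One-sided and second derivative tests in one variable -/

section SecondDeriv

/-- `g` is differentiable around `x`, with a derivative that has derivative `a` at `x`. -/
def HasSecondDerivAt (g : ℝ → ℝ) (a x : ℝ) : Prop :=
  ∃ g' : ℝ → ℝ, (∀ᶠ y in 𝓝 x, HasDerivAt g (g' y) y) ∧ HasDerivAt g' a x

variable {g h : ℝ → ℝ} {a b x : ℝ}

theorem HasSecondDerivAt.sub (hg : HasSecondDerivAt g a x) (hh : HasSecondDerivAt h b x) :
    HasSecondDerivAt (fun y => g y - h y) (a - b) x := by
  obtain ⟨g', hg1, hg2⟩ := hg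
  obtain ⟨h', hh1, hh2⟩ := hh
  refine ⟨fun y => g' y - h' y, ?_, hg2.fun_sub hh2⟩
  filter_upwards [hg1, hh1] with y h1 h2 using h1.fun_sub h2

theorem HasSecondDerivAt.const_mul (c : ℝ) (hg : HasSecondDerivAt g a x) :
    HasSecondDerivAt (fun y => c * g y) (c * a) x := by
  obtain ⟨g', hg1, hg2⟩ := hg
  refine ⟨fun y => c * g' y, ?_, hg2.const_mul c⟩
  filter_upwards [hg1] with y h1 using h1.const_mul c

theorem hasSecondDerivAt_const (c : ℝ) : HasSecondDerivAt (fun _ => c) 0 x :=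
  ⟨fun _ => 0, Eventually.of_forall fun y => hasDerivAt_const y c, hasDerivAt_const x 0⟩

theorem HasSecondDerivAt.comp_mul_right (c : ℝ) (hg : HasSecondDerivAt g a 0) :
    HasSecondDerivAt (fun y => g (y * c)) (c ^ 2 * a) 0 := by
  obtain ⟨g', hg1, hg2⟩ := hg
  have hc : Tendsto (fun y : ℝ => y * c) (𝓝 0) (𝓝 0) := by
    have : Continuous fun y : ℝ => y * c := by fun_prop
    simpa using this.tendsto 0
  refine ⟨fun y => g' (y * c) * c, ?_, ?_⟩
  · filter_upwards [hc.eventually hg1] with y h1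
    have := h1.comp y ((hasDerivAt_id y).mul_const c)
    exact this.congr_deriv (by simp)
  · have h2 : HasDerivAt g' a (0 * c) := by simpa using hg2
    have := (h2.comp 0 ((hasDerivAt_id (0 : ℝ)).mul_const c)).mul_const c
    refine this.congr_deriv ?_
    ring

/-- A negative second derivative would make the point a local maximum too, so `g` would be locally
constant. -/
theorem HasSecondDerivAt.nonneg_of_isLocalMin (hg : HasSecondDerivAt g a x)
    (hmin : IsLocalMin g x) : 0 ≤ a := by
  obtain ⟨g', hg1, hg2⟩ := hg
  by_contra! ha
  have hd : deriv g =ᶠ[𝓝 x] g' := by filter_upwards [hg1] with y h1 using h1.deriv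
  have hcont : ContinuousAt g x := hg1.self_of_nhds.continuousAt
  have hdd : deriv (deriv g) x = a := by rw [hd.deriv_eq, hg2.deriv]
  have hmax : IsLocalMax g x := isLocalMax_of_deriv_deriv_neg (by rw [hdd]; exact ha)
    hmin.deriv_eq_zero hcont
  have hconst : g =ᶠ[𝓝 x] fun _ => g x := by
    filter_upwards [hmin, hmax] with y h1 h2 using le_antisymm h2 h1
  have h0 : deriv g =ᶠ[𝓝 x] fun _ => 0 := by
    filter_upwards [hconst.eventuallyEq_nhds] with y hy
    rw [hy.deriv_eq]; simp
  rw [h0.deriv_eq] at hdd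
  simp at hdd
  linarith

theorem HasDerivAt.nonneg_of_eventually_ge {g : ℝ → ℝ} {a x : ℝ} (hg : HasDerivAt g a x)
    (h : ∀ᶠ y in 𝓝[>] x, g x ≤ g y) : 0 ≤ a := by
  have h1 : Tendsto (slope g x) (𝓝[>] x) (𝓝 a) := (hasDerivAt_iff_tendsto_slope.1 hg).mono_left
    (nhdsWithin_mono x fun y (hy : y ∈ Set.Ioi x) => ne_of_gt hy)
  refine ge_of_tendsto h1 ?_
  filter_upwards [h, self_mem_nhdsWithin] with y hy hxy
  rw [slope_def_field]
  exact div_nonneg (sub_nonneg.2 hy) (sub_nonneg.2 (le_of_lt hxy))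

end SecondDeriv

/-! ### The operator through derivatives along lines and drift curves -/

section HasLop

variable {n : ℕ} {p : Fin (n + 1) → ℕ} {m : ℕ} {B : Matrix (Coord p) (Coord p) ℝ}
  {s : Fin m → Space p} {u v : SpaceTime p → ℝ} {z : SpaceTime p} {a b : ℝ}

/-- `a` is the value at `z` of `∑ᵢ ∂²_{sᵢ} u + Y u`, where `Y = ⟨x, B∇⟩ - ∂ₜ` is the derivative
along the integral curves of the drift. -/
def HasLop (B : Matrix (Coord p) (Coord p) ℝ) (s : Fin m → Space p) (u : SpaceTime p → ℝ)
    (z : SpaceTime p) (a : ℝ) : Prop :=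
  ∃ (d : Fin m → ℝ) (y : ℝ),
    (∀ i, HasSecondDerivAt (fun ε => u (z.1 + ε • s i, z.2)) (d i) 0) ∧
    HasDerivAt (fun σ => u (flowOp B (-σ) z.1, z.2 - σ)) y 0 ∧ a = ∑ i, d i + y

theorem HasLop.sub (hu : HasLop B s u z a) (hv : HasLop B s v z b) :
    HasLop B s (fun w => u w - v w) z (a - b) := by
  obtain ⟨d, y, h1, h2, rfl⟩ := hu
  obtain ⟨d', y', h1', h2', rfl⟩ := hv
  refine ⟨fun i => d i - d' i, y - y', fun i => (h1 i).sub (h1' i), h2.fun_sub h2', ?_⟩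
  rw [Finset.sum_sub_distrib]; ring

theorem HasLop.const_mul (c : ℝ) (hu : HasLop B s u z a) :
    HasLop B s (fun w => c * u w) z (c * a) := by
  obtain ⟨d, y, h1, h2, rfl⟩ := hu
  refine ⟨fun i => c * d i, c * y, fun i => (h1 i).const_mul c, h2.const_mul c, ?_⟩
  rw [← Finset.mul_sum]; ring

theorem hasLop_const (c : ℝ) : HasLop B s (fun _ => c) z 0 :=
  ⟨fun _ => 0, 0, fun _ => hasSecondDerivAt_const c, hasDerivAt_const _ _, by simp⟩

theorem hasLop_time : HasLop B s (fun w => w.2) z (-1) :=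
  ⟨fun _ => 0, -1, fun _ => hasSecondDerivAt_const z.2, by
    simpa using (hasDerivAt_id (0 : ℝ)).const_sub z.2, by simp⟩

/-- The drift curve runs backwards in time, so minimality over times up to `z.2` suffices; a minimum
at the top of a cylinder is allowed. -/
theorem HasLop.nonneg_of_min (hu : HasLop B s u z a) {t₀ : ℝ} (ht : t₀ < z.2) {O : Set (Space p)}
    (hO : O ∈ 𝓝 z.1) (hmin : ∀ x ∈ O, ∀ t, t₀ < t → t ≤ z.2 → u z ≤ u (x, t)) : 0 ≤ a := by
  obtain ⟨d, y, h1, h2, rfl⟩ := hu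
  refine add_nonneg (Finset.sum_nonneg fun i _ => (h1 i).nonneg_of_isLocalMin ?_)
    (HasDerivAt.nonneg_of_eventually_ge h2 ?_)
  · have hc : Tendsto (fun ε : ℝ => z.1 + ε • s i) (𝓝 0) (𝓝 z.1) := by
      have : Continuous fun ε : ℝ => z.1 + ε • s i := by fun_prop
      simpa using this.tendsto 0
    filter_upwards [hc.eventually hO] with ε hε
    simpa using hmin _ hε z.2 ht le_rfl
  · have hc : Tendsto (fun σ : ℝ => flowOp B (-σ) z.1) (𝓝[>] 0) (𝓝 z.1) := by
      have h3 : Continuous fun σ : ℝ => flowOp B (-σ) z.1 :=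
        (continuous_section (continuous_flowOp_apply B) z.1).comp continuous_neg
      have := h3.tendsto 0
      simp only [neg_zero, flowOp_zero] at this
      exact this.mono_left nhdsWithin_le_nhds
    filter_upwards [hc.eventually hO, Ioo_mem_nhdsGT (sub_pos.2 ht)] with σ hσ hσ'
    have := hmin _ hσ (z.2 - σ) (by linarith [hσ'.2]) (by linarith [hσ'.1])
    simpa using this

/-- The map `y ↦ z₀ ∘ δ_r y` of space-time. -/
noncomputable def place (B : Matrix (Coord p) (Coord p) ℝ) (z₀ : SpaceTime p) (r : ℝ)
    (y : SpaceTime p) : SpaceTime p :=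
  (dil r y.1 + flowOp B (r ^ 2 * y.2) z₀.1, z₀.2 + r ^ 2 * y.2)

theorem place_eq_comp (z₀ : SpaceTime p) (r : ℝ) (y : SpaceTime p) :
    place B z₀ r y = comp B z₀ (dil r y.1, r ^ 2 * y.2) := rfl

theorem continuous_place (B : Matrix (Coord p) (Coord p) ℝ) (z₀ : SpaceTime p) (r : ℝ) :
    Continuous (place B z₀ r) := by
  have h : Continuous fun y : SpaceTime p => flowOp B (r ^ 2 * y.2) z₀.1 :=
    (continuous_section (continuous_flowOp_apply B) z₀.1).comp (by fun_prop)
  unfold place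
  fun_prop

theorem dil_of_leading {ξ : Space p} (hξ : ∀ k : Coord p, k.1 ≠ 0 → ξ k = 0) (r : ℝ) :
    dil r ξ = r • ξ := by
  ext k
  by_cases hk : k.1 = 0
  · simp [weight, hk]
  · simp [hξ k hk]

/-- Left translations preserve the directions `s i` and the drift curves; the dilation multiplies
the vectors `s i`, of weight one, by `r` and speeds up the drift by `r ^ 2`. -/
theorem HasLop.comp_place (hB : IsDrift p B) {r : ℝ} (hr : 0 < r)
    (hs : ∀ i, ∀ k : Coord p, k.1 ≠ 0 → s i k = 0) {z₀ : SpaceTime p}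
    (hu : HasLop B s u (place B z₀ r z) a) :
    HasLop B s (fun y => u (place B z₀ r y)) z (r ^ 2 * a) := by
  obtain ⟨d, y, h1, h2, rfl⟩ := hu
  refine ⟨fun i => r ^ 2 * d i, y * r ^ 2, fun i => ?_, ?_, ?_⟩
  · have h3 := (h1 i).comp_mul_right r
    have e : (fun ε : ℝ => u (place B z₀ r (z.1 + ε • s i, z.2))) = fun ε =>
        u ((place B z₀ r z).1 + (ε * r) • s i, (place B z₀ r z).2) := by
      funext ε
      simp only [place, map_add, map_smul, dil_of_leading (hs i)]
      rw [smul_smul]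
      congr 2
      abel
    rw [e]; exact h3
  · have e : (fun σ : ℝ => u (place B z₀ r (flowOp B (-σ) z.1, z.2 - σ))) = fun σ =>
        u (flowOp B (-(σ * r ^ 2)) (place B z₀ r z).1, (place B z₀ r z).2 - σ * r ^ 2) := by
      funext σ
      simp only [place, map_add, dil_flowOp hB hr.ne', ← flowOp_add]
      congr 2
      · congr 2 <;> ring_nf
      · ring
    rw [e]
    have h3 : HasDerivAt (fun σ => u (flowOp B (-σ) (place B z₀ r z).1, (place B z₀ r z).2 - σ)) y
        (0 * r ^ 2) := by simpa using h2
    have := h3.comp 0 ((hasDerivAt_id (0 : ℝ)).mul_const (r ^ 2))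
    exact this.congr_deriv (by simp)
  · rw [← Finset.mul_sum]; ring

theorem eq_sum_single (x : Space p) : x = ∑ k, x k • EuclideanSpace.single k (1 : ℝ) := by
  ext l
  simp [Finset.sum_apply, Pi.single_apply]

theorem hasSecondDerivAt_line {E : Type*} [NormedAddCommGroup E] [NormedSpace ℝ E] {f : E → ℝ}
    {x : E} (hf : ContDiffAt ℝ 2 f x) (ξ : E) :
    HasSecondDerivAt (fun ε : ℝ => f (x + ε • ξ)) (iteratedFDeriv ℝ 2 f x ![ξ, ξ]) 0 := by
  have hline : ∀ ε : ℝ, HasDerivAt (fun ε : ℝ => x + ε • ξ) ξ ε := fun ε => by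
    simpa using ((hasDerivAt_id ε).smul_const ξ).const_add x
  have hc : Tendsto (fun ε : ℝ => x + ε • ξ) (𝓝 0) (𝓝 x) := by
    have : Continuous fun ε : ℝ => x + ε • ξ := by fun_prop
    simpa using this.tendsto 0
  refine ⟨fun ε => fderiv ℝ f (x + ε • ξ) ξ, ?_, ?_⟩
  · have hev : ∀ᶠ y in 𝓝 x, DifferentiableAt ℝ f y := by
      filter_upwards [hf.eventually (by simp)] with y hy
      exact hy.differentiableAt two_ne_zero
    filter_upwards [hc.eventually hev] with ε hε
    exact HasFDerivAt.comp_hasDerivAt (f := fun ε : ℝ => x + ε • ξ) ε hε.hasFDerivAt (hline ε)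
  · have h1 : DifferentiableAt ℝ (fderiv ℝ f) (x + (0 : ℝ) • ξ) := by
      rw [zero_smul, add_zero]
      exact (hf.fderiv_right (m := 1) (by norm_num)).differentiableAt one_ne_zero
    have h3 := HasFDerivAt.comp_hasDerivAt (f := fun ε : ℝ => x + ε • ξ) 0 h1.hasFDerivAt (hline 0)
    have h2 := h3.clm_apply (hasDerivAt_const 0 ξ)
    rw [iteratedFDeriv_two_apply]
    simpa using h2

/-- Once `A(z) = ∑ sᵢ sᵢᵀ`, the trace term is the sum of the second derivatives along the `sᵢ`, and
the remaining terms are the derivative along a curve with velocity `(Bᵀ x, -1)`. -/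
theorem hasLop_operator {A : SpaceTime p → Matrix (Coord p) (Coord p) ℝ}
    (hu : ContDiffAt ℝ 2 u z) (hA : ∀ k l, A z k l = ∑ i, s i k * s i l) :
    HasLop B s u z (operator B A u z) := by
  have hf : ContDiffAt ℝ 2 (fun x : Space p => u (x, z.2)) z.1 := by
    have h1 : ContDiffAt ℝ 2 (fun x : Space p => ((x, z.2) : SpaceTime p)) z.1 := by fun_prop
    exact ContDiffAt.comp z.1 hu h1
  set f : Space p → ℝ := fun x => u (x, z.2) with hfdef
  have hud : HasFDerivAt u (fderiv ℝ u z) z := (hu.differentiableAt two_ne_zero).hasFDerivAt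
  refine ⟨fun i => iteratedFDeriv ℝ 2 f z.1 ![s i, s i], fderiv ℝ u z (op Bᵀ z.1, -1),
    fun i => hasSecondDerivAt_line hf (s i), ?_, ?_⟩
  · have h1 : HasDerivAt (fun σ : ℝ => flowOp B (-σ) z.1) (op Bᵀ z.1) 0 := by
      have h2 : HasDerivAt (fun τ => flowOp B τ z.1) (-(op Bᵀ (flowOp B (-0) z.1))) (-0) :=
        hasDerivAt_flowOp B (-0) z.1
      have := h2.scomp (0 : ℝ) (hasDerivAt_neg (0 : ℝ))
      exact this.congr_deriv (by simp)
    have h2 : HasDerivAt (fun σ : ℝ => z.2 - σ) (-1) 0 := by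
      simpa using (hasDerivAt_id (0 : ℝ)).const_sub z.2
    have h3 := h1.prodMk h2
    have h4 : HasFDerivAt u (fderiv ℝ u z) ((fun σ : ℝ => (flowOp B (-σ) z.1, z.2 - σ)) 0) := by
      simpa using hud
    exact h4.comp_hasDerivAt 0 h3
  · have hx : HasFDerivAt f ((fderiv ℝ u z).comp (ContinuousLinearMap.inl ℝ (Space p) ℝ)) z.1 := by
      have h1 : HasFDerivAt (fun x : Space p => ((x, z.2) : SpaceTime p))
          (ContinuousLinearMap.inl ℝ (Space p) ℝ) z.1 := hasFDerivAt_prodMk_left z.1 z.2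
      exact HasFDerivAt.comp z.1 hud h1
    have ht : HasDerivAt (fun t => u (z.1, t)) (fderiv ℝ u z (0, 1)) z.2 := by
      have h1 : HasDerivAt (fun t : ℝ => ((z.1, t) : SpaceTime p)) (0, 1) z.2 :=
        (hasDerivAt_const z.2 z.1).prodMk (hasDerivAt_id z.2)
      exact HasFDerivAt.comp_hasDerivAt z.2 hud h1
    have h1 : fderiv ℝ u z (op Bᵀ z.1, -1) = inner ℝ z.1 (op B (spaceGradient u z))
        - deriv (fun t => u (z.1, t)) z.2 := by
      have e1 : inner ℝ z.1 (op B (spaceGradient u z)) = fderiv ℝ u z (op Bᵀ z.1, 0) := by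
        rw [inner_op, spaceGradient, real_inner_comm, inner_gradient_left, hx.fderiv]
        rfl
      have e2 : ((op Bᵀ z.1, -1) : SpaceTime p) = (op Bᵀ z.1, 0) - (0, 1) := by simp
      rw [ht.deriv, e1, e2, map_sub]
    have h2 : (A z * hessian u z).trace = ∑ i, iteratedFDeriv ℝ 2 f z.1 ![s i, s i] := by
      have e1 : ∀ ξ : Space p, iteratedFDeriv ℝ 2 f z.1 ![ξ, ξ] =
          ∑ k, ∑ l, ξ k * (ξ l * hessian u z l k) := by
        intro ξ
        simp only [hessian, Matrix.of_apply, iteratedFDeriv_two_apply, ← hfdef]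
        simp only [Matrix.cons_val_zero, Matrix.cons_val_one]
        conv_lhs => rw [eq_sum_single ξ]
        simp only [map_sum, map_smul, _root_.sum_apply, _root_.smul_apply,
          smul_eq_mul, Finset.mul_sum]
      simp only [e1, Matrix.trace, Matrix.diag_apply, Matrix.mul_apply, hA, Finset.sum_mul]
      rw [Finset.sum_comm (s := (Finset.univ : Finset (Fin m)))]
      refine Finset.sum_congr rfl fun k _ => ?_
      rw [Finset.sum_comm]
      exact Finset.sum_congr rfl fun l _ => Finset.sum_congr rfl fun i _ => by ring
    rw [h1, ← h2, operator]
    change _ + inner ℝ z.1 (op B (spaceGradient u z)) - _ = _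
    ring

end HasLop

end Kolmogorov

namespace Kolmogorov

open Filter Topology MeasureTheory
open scoped Matrix

/-! ### Potentials over compact sets, differentiated along left-invariant curves -/

section Potential

/-- Differentiation under an integral over a compact set. -/
theorem hasDerivAt_setIntegral_of_continuous {Z : Type*} [TopologicalSpace Z] [T2Space Z]
    [MeasurableSpace Z] [OpensMeasurableSpace Z] [SecondCountableTopology Z] {μ : Measure Z}
    [IsFiniteMeasureOnCompacts μ]
    {E : Set Z} (hE : IsCompact E) {F F' : ℝ → Z → ℝ} (hF : Continuous fun q : ℝ × Z => F q.1 q.2)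
    (hF' : Continuous fun q : ℝ × Z => F' q.1 q.2)
    (hd : ∀ σ ζ, HasDerivAt (fun σ => F σ ζ) (F' σ ζ) σ) (σ₀ : ℝ) :
    HasDerivAt (fun σ => ∫ ζ in E, F σ ζ ∂μ) (∫ ζ in E, F' σ₀ ζ ∂μ) σ₀ := by
  have hcF : ∀ σ, Continuous (F σ) := fun σ => hF.comp (by fun_prop : Continuous fun ζ : Z => (σ, ζ))
  have hcF' : ∀ σ, Continuous (F' σ) := fun σ =>
    hF'.comp (by fun_prop : Continuous fun ζ : Z => (σ, ζ))
  obtain ⟨K, hK⟩ := ((isCompact_Icc (a := σ₀ - 1) (b := σ₀ + 1)).prod hE).exists_bound_of_continuousOn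
    hF'.continuousOn
  refine (hasDerivAt_integral_of_dominated_loc_of_deriv_le (bound := fun _ => K)
    (s := Set.Icc (σ₀ - 1) (σ₀ + 1)) (Icc_mem_nhds (by linarith) (by linarith))
    (Eventually.of_forall fun σ => (hcF σ).aestronglyMeasurable)
    ((hcF σ₀).continuousOn.integrableOn_compact hE) (hcF' σ₀).aestronglyMeasurable ?_ ?_ ?_).2
  · filter_upwards [ae_restrict_mem hE.measurableSet] with ζ hζ σ hσ using hK (σ, ζ) ⟨hσ, hζ⟩
  · exact integrableOn_const (hs := hE.measure_lt_top.ne)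
  · exact Eventually.of_forall fun ζ σ _ => hd σ ζ

variable {n : ℕ} {p : Fin (n + 1) → ℕ} {m : ℕ}

/-- The point `ζ⁻¹ ∘ z`. -/
noncomputable def rel (B : Matrix (Coord p) (Coord p) ℝ) (ζ z : SpaceTime p) : SpaceTime p :=
  (z.1 - flowOp B (z.2 - ζ.2) ζ.1, z.2 - ζ.2)

/-- The integral curve of the drift through `z`. -/
noncomputable def driftLine (B : Matrix (Coord p) (Coord p) ℝ) (z : SpaceTime p) (σ : ℝ) :
    SpaceTime p :=
  (flowOp B (-σ) z.1, z.2 - σ)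

/-- The line through `z` in the space direction `ξ`. -/
noncomputable def spaceLine (ξ : Space p) (z : SpaceTime p) (ε : ℝ) : SpaceTime p :=
  (z.1 + ε • ξ, z.2)

theorem rel_spaceLine (B : Matrix (Coord p) (Coord p) ℝ) (ξ : Space p) (ζ z : SpaceTime p)
    (ε : ℝ) : rel B ζ (spaceLine ξ z ε) = spaceLine ξ (rel B ζ z) ε := by
  simp only [rel, spaceLine]
  congr 1
  abel

theorem rel_driftLine (B : Matrix (Coord p) (Coord p) ℝ) (ζ z : SpaceTime p)
    (σ : ℝ) : rel B ζ (driftLine B z σ) = driftLine B (rel B ζ z) σ := by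
  simp only [rel, driftLine, map_sub, ← flowOp_add]
  congr 1
  · congr 3; ring
  · ring

theorem spaceLine_spaceLine (ξ : Space p) (z : SpaceTime p) (ε δ : ℝ) :
    spaceLine ξ (spaceLine ξ z ε) δ = spaceLine ξ z (ε + δ) := by
  simp only [spaceLine, add_smul, add_assoc]

theorem driftLine_driftLine (B : Matrix (Coord p) (Coord p) ℝ) (z : SpaceTime p) (ε δ : ℝ) :
    driftLine B (driftLine B z ε) δ = driftLine B z (ε + δ) := by
  simp only [driftLine, ← flowOp_add]
  congr 1
  · congr 2; ring
  · ring

theorem continuous_rel (B : Matrix (Coord p) (Coord p) ℝ) :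
    Continuous fun q : SpaceTime p × SpaceTime p => rel B q.1 q.2 := by
  unfold rel
  fun_prop

theorem continuous_driftLine (B : Matrix (Coord p) (Coord p) ℝ) :
    Continuous fun q : ℝ × SpaceTime p => driftLine B q.2 q.1 := by
  unfold driftLine
  fun_prop

theorem continuous_spaceLine (ξ : Space p) :
    Continuous fun q : ℝ × SpaceTime p => spaceLine ξ q.2 q.1 := by
  unfold spaceLine
  fun_prop

/-- A derivative along a one-parameter flow, known at the initial time, holds at all times. -/
theorem hasDerivAt_flow_of_zero {X : Type*} {γ : X → ℝ → X}
    (hγ : ∀ z ε δ, γ (γ z ε) δ = γ z (ε + δ)) {f f' : X → ℝ}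
    (h : ∀ z, HasDerivAt (fun ε => f (γ z ε)) (f' z) 0) (z : X) (ε : ℝ) :
    HasDerivAt (fun ε => f (γ z ε)) (f' (γ z ε)) ε := by
  have h1 := h (γ z ε)
  simp only [hγ] at h1
  have h2 : HasDerivAt (fun δ => f (γ z (ε + δ))) (f' (γ z ε)) (ε - ε) := by simpa using h1
  have h3 := HasDerivAt.comp (h := fun δ => δ - ε) ε h2 ((hasDerivAt_id ε).sub_const ε)
  refine (h3.congr_deriv (by simp)).congr_of_eventuallyEq (Eventually.of_forall fun δ => ?_)
  simp

variable {B : Matrix (Coord p) (Coord p) ℝ} {s : Fin m → Space p}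

theorem hasDerivAt_potential {γ : SpaceTime p → ℝ → SpaceTime p}
    (hγ : ∀ z ε δ, γ (γ z ε) δ = γ z (ε + δ))
    (hrel : ∀ ζ z ε, rel B ζ (γ z ε) = γ (rel B ζ z) ε)
    (hcγ : Continuous fun q : ℝ × SpaceTime p => γ q.2 q.1)
    {E : Set (SpaceTime p)} (hE : IsCompact E) {k k' : SpaceTime p → ℝ} (hk : Continuous k)
    (hk' : Continuous k') (h : ∀ z, HasDerivAt (fun ε => k (γ z ε)) (k' z) 0) (z : SpaceTime p)
    (ε : ℝ) :
    HasDerivAt (fun ε => ∫ ζ in E, k (rel B ζ (γ z ε))) (∫ ζ in E, k' (rel B ζ (γ z ε))) ε := by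
  have hc : Continuous fun q : ℝ × SpaceTime p => rel B q.2 (γ z q.1) :=
    (continuous_rel B).comp (continuous_snd.prodMk
      (hcγ.comp (by fun_prop : Continuous fun q : ℝ × SpaceTime p => (q.1, z))))
  refine hasDerivAt_setIntegral_of_continuous hE (F := fun ε ζ => k (rel B ζ (γ z ε)))
    (F' := fun ε ζ => k' (rel B ζ (γ z ε))) (hk.comp hc) (hk'.comp hc) (fun σ ζ => ?_) ε
  simp only [hrel]
  exact hasDerivAt_flow_of_zero hγ h _ _

/-- `ζ⁻¹ ∘ ·` commutes with moving along the space lines and the drift curves, so the operator falls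
on the kernel. Continuity of the kernel derivatives, guaranteed later by the cutoff, is what allows
differentiation under the integral. -/
theorem HasLop.potential {E : Set (SpaceTime p)} (hE : IsCompact E) {k kY : SpaceTime p → ℝ}
    {k₁ k₂ : Fin m → SpaceTime p → ℝ} (hk : Continuous k) (hkY : Continuous kY)
    (hk₁ : ∀ i, Continuous (k₁ i)) (hk₂ : ∀ i, Continuous (k₂ i))
    (h₁ : ∀ i z, HasDerivAt (fun ε => k (spaceLine (s i) z ε)) (k₁ i z) 0)
    (h₂ : ∀ i z, HasDerivAt (fun ε => k₁ i (spaceLine (s i) z ε)) (k₂ i z) 0)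
    (hY : ∀ z, HasDerivAt (fun ε => k (driftLine B z ε)) (kY z) 0) (z : SpaceTime p) :
    HasLop B s (fun z => ∫ ζ in E, k (rel B ζ z)) z
      (∫ ζ in E, (∑ i, k₂ i (rel B ζ z) + kY (rel B ζ z))) := by
  have hs0 : ∀ ξ : Space p, spaceLine ξ z 0 = z := fun ξ => by simp [spaceLine]
  have hd0 : driftLine B z 0 = z := by simp [driftLine]
  have hrel : Continuous fun ζ => rel B ζ z :=
    (continuous_rel B).comp (by fun_prop : Continuous fun ζ : SpaceTime p => (ζ, z))
  refine ⟨fun i => ∫ ζ in E, k₂ i (rel B ζ z), ∫ ζ in E, kY (rel B ζ z), fun i =>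
    ⟨fun ε => ∫ ζ in E, k₁ i (rel B ζ (spaceLine (s i) z ε)), Eventually.of_forall fun ε => ?_, ?_⟩,
    ?_, ?_⟩
  · exact hasDerivAt_potential (spaceLine_spaceLine (s i)) (fun ζ z ε => rel_spaceLine B (s i) ζ z ε)
      (continuous_spaceLine _) hE hk (hk₁ i) (h₁ i) z ε
  · have := hasDerivAt_potential (spaceLine_spaceLine (s i))
      (fun ζ z ε => rel_spaceLine B (s i) ζ z ε)
      (continuous_spaceLine _) hE (hk₁ i) (hk₂ i) (h₂ i) z 0
    simpa only [hs0] using this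
  · have := hasDerivAt_potential (driftLine_driftLine B) (rel_driftLine B)
      (continuous_driftLine B) hE hk hkY hY z 0
    simp only [hd0] at this
    exact this
  · rw [integral_add, integral_finsetSum]
    · exact fun i _ => ((hk₂ i).comp hrel).continuousOn.integrableOn_compact hE
    · exact (continuous_finsetSum _ fun i _ => (hk₂ i).comp hrel).continuousOn.integrableOn_compact hE
    · exact (hkY.comp hrel).continuousOn.integrableOn_compact hE

end Potential

end Kolmogorov

namespace Kolmogorov

open Filter Topology MeasureTheory
open scoped Matrix

/-! ### The barrier kernel and its derivatives -/

section Kernel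

variable {n : ℕ} {p : Fin (n + 1) → ℕ} {m : ℕ}

/-- A smooth cutoff of the times before `η`. -/
noncomputable def cutoff (η T : ℝ) : ℝ := Real.smoothTransition (T / η - 1)

/-- The derivative of the cutoff. -/
noncomputable def cutoffDeriv (η T : ℝ) : ℝ := deriv Real.smoothTransition (T / η - 1) / η

/-- The space part of `z`, rescaled to unit time. -/
noncomputable def unitPart (η : ℝ) (z : SpaceTime p) : Space p := dil (√(max z.2 η))⁻¹ z.1

/-- The Gaussian `t^{-S} exp(-⟨My, y⟩ / 4β)`, where `y = δ_{1/√t} x` and `t` is cut off at `η`. -/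
noncomputable def gauss (M : Space p →L[ℝ] Space p) (S β η : ℝ) (z : SpaceTime p) : ℝ :=
  (max z.2 η) ^ (-S) * Real.exp (-(inner ℝ (unitPart η z) (M (unitPart η z)) / (4 * β)))

/-- The kernel of the barrier potential. -/
noncomputable def kern (M : Space p →L[ℝ] Space p) (S β η : ℝ) (z : SpaceTime p) : ℝ :=
  cutoff η z.2 * gauss M S β η z

/-- The first space derivative of the kernel. -/
noncomputable def kernDeriv (M : Space p →L[ℝ] Space p) (S β η : ℝ) (ξ : Space p)
    (z : SpaceTime p) : ℝ :=
  kern M S β η z * (-((√(max z.2 η))⁻¹ * inner ℝ ξ (M (unitPart η z)) / (2 * β)))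

/-- The second space derivative of the kernel. -/
noncomputable def kernDeriv₂ (M : Space p →L[ℝ] Space p) (S β η : ℝ) (ξ : Space p)
    (z : SpaceTime p) : ℝ :=
  kern M S β η z * ((inner ℝ ξ (M (unitPart η z)) ^ 2 / (4 * β ^ 2) - inner ℝ ξ (M ξ) / (2 * β))
    / max z.2 η)

/-- The derivative of the kernel along the drift. -/
noncomputable def kernDrift (A : Matrix (Coord p) (Coord p) ℝ) (M : Space p →L[ℝ] Space p)
    (S β η : ℝ) (z : SpaceTime p) : ℝ :=
  kern M S β η z * ((S - inner ℝ (M (unitPart η z)) (op A (M (unitPart η z))) / (4 * β))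
    / max z.2 η) - cutoffDeriv η z.2 * gauss M S β η z

theorem cutoff_of_le {η T : ℝ} (hη : 0 < η) (h : T ≤ η) : cutoff η T = 0 := by
  refine Real.smoothTransition.zero_of_nonpos ?_
  rw [sub_nonpos, div_le_one hη]; exact h

theorem cutoff_of_ge {η T : ℝ} (hη : 0 < η) (h : 2 * η ≤ T) : cutoff η T = 1 := by
  refine Real.smoothTransition.one_of_one_le ?_
  rw [le_sub_iff_add_le, le_div_iff₀ hη]; linarith

theorem cutoff_nonneg (η T : ℝ) : 0 ≤ cutoff η T := Real.smoothTransition.nonneg _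

theorem cutoff_le_one (η T : ℝ) : cutoff η T ≤ 1 := Real.smoothTransition.le_one _

theorem hasDerivAt_cutoff (η T : ℝ) : HasDerivAt (cutoff η) (cutoffDeriv η T) T := by
  have h1 : HasDerivAt Real.smoothTransition (deriv Real.smoothTransition (T / η - 1)) (T / η - 1) :=
    ((Real.smoothTransition.contDiffAt (n := 1)).differentiableAt (by simp)).hasDerivAt
  have h2 := HasDerivAt.comp (h := fun T => T / η - 1) T h1
    (((hasDerivAt_id T).div_const η).sub_const 1)
  exact h2.congr_deriv (by rw [cutoffDeriv]; ring)

theorem continuous_cutoff (η : ℝ) : Continuous (cutoff η) :=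
  continuous_iff_continuousAt.2 fun T => (hasDerivAt_cutoff η T).continuousAt

theorem continuous_deriv_smoothTransition : Continuous (deriv Real.smoothTransition) :=
  (Real.smoothTransition.contDiff (n := 1)).continuous_deriv (by simp)

theorem continuous_cutoffDeriv (η : ℝ) : Continuous (cutoffDeriv η) :=
  (continuous_deriv_smoothTransition.comp (by fun_prop)).div_const η

theorem cutoffDeriv_of_lt {η T : ℝ} (hη : 0 < η) (h : T < η) : cutoffDeriv η T = 0 := by
  have h1 : cutoff η =ᶠ[𝓝 T] fun _ => 0 := by
    filter_upwards [Iio_mem_nhds h] with x hx using cutoff_of_le hη hx.le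
  exact (hasDerivAt_cutoff η T).unique ((hasDerivAt_const T 0).congr_of_eventuallyEq h1)

theorem cutoffDeriv_of_gt {η T : ℝ} (hη : 0 < η) (h : 2 * η < T) : cutoffDeriv η T = 0 := by
  have h1 : cutoff η =ᶠ[𝓝 T] fun _ => 1 := by
    filter_upwards [Ioi_mem_nhds h] with x hx using cutoff_of_ge hη (le_of_lt hx)
  exact (hasDerivAt_cutoff η T).unique ((hasDerivAt_const T 1).congr_of_eventuallyEq h1)

theorem exists_abs_cutoffDeriv_le : ∃ K : ℝ, 0 < K ∧ ∀ η T : ℝ, 0 < η → |cutoffDeriv η T| ≤ K / η := by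
  obtain ⟨K, hK⟩ := (isCompact_Icc (a := (0 : ℝ)) (b := 1)).exists_bound_of_continuousOn
    continuous_deriv_smoothTransition.continuousOn
  refine ⟨|K| + 1, by positivity, fun η T hη => ?_⟩
  by_cases h1 : T < η
  · rw [cutoffDeriv_of_lt hη h1, abs_zero]; positivity
  by_cases h2 : 2 * η < T
  · rw [cutoffDeriv_of_gt hη h2, abs_zero]; positivity
  push Not at h1 h2
  rw [cutoffDeriv, abs_div, abs_of_pos hη]
  gcongr
  have := hK (T / η - 1) ⟨by rw [sub_nonneg, le_div_iff₀ hη]; linarith,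
    by rw [sub_le_iff_le_add, div_le_iff₀ hη]; linarith⟩
  rw [Real.norm_eq_abs] at this
  linarith [le_abs_self K]

variable {B A : Matrix (Coord p) (Coord p) ℝ} {M : Space p →L[ℝ] Space p} {S β η c₁ c₂ : ℝ}

theorem sqrt_max_pos (hη : 0 < η) (t : ℝ) : 0 < √(max t η) :=
  Real.sqrt_pos.2 (lt_max_of_lt_right hη)

theorem continuous_unitPart (hη : 0 < η) : Continuous (unitPart (p := p) η) := by
  have h : Continuous fun z : SpaceTime p => (√(max z.2 η))⁻¹ :=
    Continuous.inv₀ (by fun_prop) fun z => (sqrt_max_pos hη z.2).ne'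
  unfold unitPart
  fun_prop

theorem continuous_gauss (hη : 0 < η) : Continuous (gauss M S β η) := by
  have h := continuous_unitPart (p := p) hη
  unfold gauss
  refine Continuous.mul ?_ (by fun_prop)
  exact Continuous.rpow_const (by fun_prop) fun z => Or.inl (lt_max_of_lt_right hη).ne'

theorem continuous_kern (hη : 0 < η) : Continuous (kern M S β η) :=
  ((continuous_cutoff η).comp continuous_snd).mul (continuous_gauss hη)

theorem continuous_kernDeriv (hη : 0 < η) (ξ : Space p) : Continuous (kernDeriv M S β η ξ) := by
  have h := continuous_unitPart (p := p) hη
  have h2 := continuous_kern (M := M) (S := S) (β := β) hη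
  have h3 : Continuous fun z : SpaceTime p => (√(max z.2 η))⁻¹ :=
    Continuous.inv₀ (by fun_prop) fun z => (sqrt_max_pos hη z.2).ne'
  unfold kernDeriv
  fun_prop

theorem continuous_kernDeriv₂ (hη : 0 < η) (ξ : Space p) : Continuous (kernDeriv₂ M S β η ξ) := by
  have h := continuous_unitPart (p := p) hη
  have h2 := continuous_kern (M := M) (S := S) (β := β) hη
  unfold kernDeriv₂
  exact h2.mul (Continuous.div (by fun_prop) (by fun_prop) fun z => (lt_max_of_lt_right hη).ne')

theorem continuous_kernDrift (hη : 0 < η) : Continuous (kernDrift A M S β η) := by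
  have h := continuous_unitPart (p := p) hη
  have h2 := continuous_kern (M := M) (S := S) (β := β) hη
  have h3 := continuous_gauss (M := M) (S := S) (β := β) hη
  have h4 := (continuous_cutoffDeriv η).comp (continuous_snd (X := Space p) (Y := ℝ))
  unfold kernDrift
  exact (h2.mul (Continuous.div (by fun_prop) (by fun_prop)
    fun z => (lt_max_of_lt_right hη).ne')).sub (h4.mul h3)

theorem gauss_pos (hη : 0 < η) (z : SpaceTime p) : 0 < gauss M S β η z :=
  mul_pos (Real.rpow_pos_of_pos (lt_max_of_lt_right hη) _) (Real.exp_pos _)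

theorem kern_nonneg (hη : 0 < η) (z : SpaceTime p) : 0 ≤ kern M S β η z :=
  mul_nonneg (cutoff_nonneg _ _) (gauss_pos hη z).le

theorem unitPart_spaceLine {ξ : Space p} (hξ : ∀ k : Coord p, k.1 ≠ 0 → ξ k = 0)
    (z : SpaceTime p) (ε : ℝ) :
    unitPart η (spaceLine ξ z ε) = unitPart η z + (ε * (√(max z.2 η))⁻¹) • ξ := by
  simp only [unitPart, spaceLine, map_add, map_smul, dil_of_leading hξ]
  rw [smul_smul]

theorem hasDerivAt_kern_spaceLine (hM : IsPrecision B A c₁ c₂ M) {ξ : Space p}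
    (hξ : ∀ k : Coord p, k.1 ≠ 0 → ξ k = 0) (z : SpaceTime p) :
    HasDerivAt (fun ε => kern M S β η (spaceLine ξ z ε)) (kernDeriv M S β η ξ z) 0 := by
  set ρ := (√(max z.2 η))⁻¹ with hρ
  set y := unitPart η z with hy
  have hq : ∀ ε : ℝ, inner ℝ (y + (ε * ρ) • ξ) (M (y + (ε * ρ) • ξ)) =
      inner ℝ y (M y) + ε * (2 * ρ * inner ℝ ξ (M y)) + ε ^ 2 * (ρ ^ 2 * inner ℝ ξ (M ξ)) := by
    intro ε
    have : inner ℝ y (M ξ) = inner ℝ ξ (M y) := by rw [← hM.symm, real_inner_comm]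
    simp only [map_add, map_smul, inner_add_left, inner_add_right, inner_smul_left,
      inner_smul_right, RCLike.conj_to_real, this]
    ring
  have hd : HasDerivAt (fun ε : ℝ => -((inner ℝ y (M y) + ε * (2 * ρ * inner ℝ ξ (M y)) +
      ε ^ 2 * (ρ ^ 2 * inner ℝ ξ (M ξ))) / (4 * β))) (-((2 * ρ * inner ℝ ξ (M y)) / (4 * β))) 0 := by
    have h1 := ((((hasDerivAt_id (0 : ℝ)).mul_const (2 * ρ * inner ℝ ξ (M y))).const_add
      (inner ℝ y (M y))).fun_add ((hasDerivAt_pow 2 (0 : ℝ)).mul_const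
        (ρ ^ 2 * inner ℝ ξ (M ξ)))).div_const (4 * β)
    exact h1.neg.congr_deriv (by simp)
  have h2 := (hd.exp.const_mul ((max z.2 η) ^ (-S))).const_mul (cutoff η z.2)
  have e : (fun ε => kern M S β η (spaceLine ξ z ε)) = fun ε : ℝ => cutoff η z.2 *
      ((max z.2 η) ^ (-S) * Real.exp (-((inner ℝ y (M y) + ε * (2 * ρ * inner ℝ ξ (M y)) +
      ε ^ 2 * (ρ ^ 2 * inner ℝ ξ (M ξ))) / (4 * β)))) := by
    funext ε
    rw [kern, gauss, unitPart_spaceLine hξ, hq]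
    rfl
  rw [e]
  refine h2.congr_deriv ?_
  simp only [kernDeriv, kern, gauss, ← hy, ← hρ]
  simp only [zero_mul, add_zero, ne_eq, OfNat.ofNat_ne_zero, not_false_eq_true, zero_pow]
  ring

theorem hasDerivAt_kernDeriv_spaceLine (hη : 0 < η) (hM : IsPrecision B A c₁ c₂ M) {ξ : Space p}
    (hξ : ∀ k : Coord p, k.1 ≠ 0 → ξ k = 0) (z : SpaceTime p) :
    HasDerivAt (fun ε => kernDeriv M S β η ξ (spaceLine ξ z ε)) (kernDeriv₂ M S β η ξ z) 0 := by
  set ρ := (√(max z.2 η))⁻¹ with hρ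
  set y := unitPart η z with hy
  have hd : HasDerivAt (fun ε : ℝ => -(ρ * (inner ℝ ξ (M y) + ε * (ρ * inner ℝ ξ (M ξ)))
      / (2 * β))) (-(ρ * (ρ * inner ℝ ξ (M ξ)) / (2 * β))) 0 := by
    have h1 := ((((hasDerivAt_id (0 : ℝ)).mul_const (ρ * inner ℝ ξ (M ξ))).const_add
      (inner ℝ ξ (M y))).const_mul ρ).div_const (2 * β)
    exact h1.neg.congr_deriv (by simp)
  have h2 := (hasDerivAt_kern_spaceLine (S := S) (β := β) (η := η) hM hξ z).mul hd
  have e : (fun ε => kernDeriv M S β η ξ (spaceLine ξ z ε)) =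
      (fun ε => kern M S β η (spaceLine ξ z ε)) * fun ε : ℝ =>
        -(ρ * (inner ℝ ξ (M y) + ε * (ρ * inner ℝ ξ (M ξ))) / (2 * β)) := by
    funext ε
    rw [Pi.mul_apply, kernDeriv, unitPart_spaceLine hξ]
    simp only [map_add, map_smul, inner_add_right, inner_smul_right, mul_assoc]
    rfl
  rw [e]
  refine h2.congr_deriv ?_
  have hρ2 : ρ ^ 2 = (max z.2 η)⁻¹ := by
    rw [hρ, inv_pow, Real.sq_sqrt (lt_max_of_lt_right hη).le]
  have h0 : spaceLine ξ z 0 = z := by simp [spaceLine]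
  simp only [h0, kernDeriv, kernDeriv₂, ← hy, ← hρ, div_eq_mul_inv, ← hρ2]
  by_cases hβ : β = 0
  · simp [hβ]
  · field_simp
    ring

/-- In self-similar coordinates the drift becomes linear: its generator is the matrix `halfWeight p
+ Bᵀ` of the Lyapunov equation, with half of the weights coming from differentiating `1/√t`. -/
theorem hasDerivAt_dil_flowOp (hB : IsDrift p B) (x : Space p) {t : ℝ} (ht : 0 < t) :
    HasDerivAt (fun σ => dil (√(t - σ))⁻¹ (flowOp B (-σ) x))
      (t⁻¹ • op (halfWeight p + Bᵀ) (dil (√t)⁻¹ x)) 0 := by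
  have hr : HasDerivAt (fun σ : ℝ => (√(t - σ))⁻¹) ((√t)⁻¹ / (2 * t)) 0 := by
    have h1 : HasDerivAt (fun σ : ℝ => t - σ) (-1) 0 := by
      simpa using (hasDerivAt_id (0 : ℝ)).const_sub t
    have h2 := (h1.sqrt (by simpa using ht.ne')).inv (by simpa using (Real.sqrt_pos.2 ht).ne')
    refine h2.congr_deriv ?_
    have : √t ≠ 0 := (Real.sqrt_pos.2 ht).ne'
    simp only [sub_zero, Real.sq_sqrt ht.le]
    field_simp
  have hf : HasDerivAt (fun σ : ℝ => flowOp B (-σ) x) (op Bᵀ x) 0 := by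
    have h2 : HasDerivAt (fun τ => flowOp B τ x) (-(op Bᵀ (flowOp B (-0) x))) (-0) :=
      hasDerivAt_flowOp B (-0) x
    have := h2.scomp (0 : ℝ) (hasDerivAt_neg (0 : ℝ))
    exact this.congr_deriv (by simp)
  have hk : ∀ k : Coord p, HasDerivAt (fun σ => (√(t - σ))⁻¹ ^ weight k * flowOp B (-σ) x k)
      ((t⁻¹ • op (halfWeight p + Bᵀ) (dil (√t)⁻¹ x)) k) 0 := by
    intro k
    have h1 : HasDerivAt (fun σ : ℝ => flowOp B (-σ) x k) (op Bᵀ x k) 0 :=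
      (EuclideanSpace.proj (𝕜 := ℝ) k).hasFDerivAt.comp_hasDerivAt 0 hf
    have h2 := (hr.fun_pow (weight k)).mul h1
    refine h2.congr_deriv ?_
    have h3 : t⁻¹ * op Bᵀ (dil (√t)⁻¹ x) k = (√t)⁻¹ ^ weight k * op Bᵀ x k := by
      have := congrArg (fun y : Space p => y k) (dil_op_transpose hB (√t)⁻¹ x)
      simp only [dil_apply, PiLp.smul_apply, smul_eq_mul, inv_pow, Real.sq_sqrt ht.le] at this ⊢
      exact this.symm
    have h4 : op (halfWeight p) (dil (√t)⁻¹ x) k = (weight k : ℝ) / 2 * ((√t)⁻¹ ^ weight k * x k) := by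
      simp [op_apply, halfWeight, Matrix.diagonal_apply]
    rw [PiLp.smul_apply, op_add, PiLp.add_apply, smul_eq_mul, mul_add, h3, h4]
    simp only [sub_zero, neg_zero, flowOp_zero]
    obtain ⟨w, hw⟩ : ∃ w, weight k = w + 1 := ⟨2 * (k.1 : ℕ), rfl⟩
    rw [hw]
    simp only [Nat.add_sub_cancel, pow_succ]
    field_simp
  have h1 := (hasDerivAt_pi.2 hk)
  have h2 := HasFDerivAt.comp_hasDerivAt (0 : ℝ)
    ((PiLp.continuousLinearEquiv 2 ℝ (fun _ : Coord p => ℝ)).symm :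
      (Coord p → ℝ) →L[ℝ] Space p).hasFDerivAt h1
  refine (h2.congr_deriv rfl).congr_of_eventuallyEq (Eventually.of_forall fun σ => ?_)
  ext k
  simp

/-- The Lyapunov equation replaces the derivative of `⟨M y, y⟩` along the drift by `⟨M y, A M y⟩ /
t`, of the same form as the square of the gradient from the second order part. -/
theorem hasDerivAt_kern_driftLine (hη : 0 < η) (hB : IsDrift p B) (hM : IsPrecision B A c₁ c₂ M)
    (z : SpaceTime p) :
    HasDerivAt (fun σ => kern M S β η (driftLine B z σ)) (kernDrift A M S β η z) 0 := by
  rcases lt_or_ge z.2 η with h | h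
  · have h1 : (fun σ => kern M S β η (driftLine B z σ)) =ᶠ[𝓝 0] fun _ => 0 := by
      filter_upwards [Ioi_mem_nhds (show z.2 - η < 0 by linarith)] with σ hσ
      have : (driftLine B z σ).2 ≤ η := by
        simp only [driftLine]; linarith [Set.mem_Ioi.1 hσ]
      rw [kern, cutoff_of_le hη this, zero_mul]
    have h2 : kernDrift A M S β η z = 0 := by
      rw [kernDrift, kern, cutoff_of_le hη h.le, cutoffDeriv_of_lt hη h]; ring
    rw [h2]
    exact (hasDerivAt_const 0 0).congr_of_eventuallyEq h1
  · have ht : 0 < z.2 := hη.trans_le h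
    have hmax : max z.2 η = z.2 := max_eq_left h
    set t := z.2 with htdef
    set y := unitPart η z with hy
    have hy' : dil (√t)⁻¹ z.1 = y := by rw [hy, unitPart, ← htdef, hmax]
    -- The truncation at `η` may be dropped: it matters only where the cutoff vanishes.
    have h1 : (fun σ => kern M S β η (driftLine B z σ)) =ᶠ[𝓝 0] fun σ => cutoff η (t - σ) *
        ((t - σ) ^ (-S) * Real.exp (-(inner ℝ (dil (√(t - σ))⁻¹ (flowOp B (-σ) z.1))
          (M (dil (√(t - σ))⁻¹ (flowOp B (-σ) z.1))) / (4 * β)))) := by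
      refine Eventually.of_forall fun σ => ?_
      simp only [kern, gauss, unitPart, driftLine, ← htdef]
      rcases le_or_gt η (t - σ) with h3 | h3
      · rw [max_eq_left h3]
      · rw [cutoff_of_le hη h3.le, zero_mul, zero_mul]
    have hs : HasDerivAt (fun σ : ℝ => t - σ) (-1) 0 := by
      simpa using (hasDerivAt_id (0 : ℝ)).const_sub t
    have hc : HasDerivAt (fun σ : ℝ => cutoff η (t - σ)) (-cutoffDeriv η t) 0 := by
      have h3 : HasDerivAt (cutoff η) (cutoffDeriv η t) (t - 0) := by
        simpa using hasDerivAt_cutoff η t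
      exact (HasDerivAt.comp (h := fun σ : ℝ => t - σ) 0 h3 hs).congr_deriv (by ring)
    have hp : HasDerivAt (fun σ : ℝ => (t - σ) ^ (-S)) (t ^ (-S) * (S / t)) 0 := by
      have h3 := hs.rpow_const (p := -S) (Or.inl (by simpa using ht.ne'))
      refine h3.congr_deriv ?_
      rw [sub_zero, Real.rpow_sub_one ht.ne']
      ring
    have hY := hasDerivAt_dil_flowOp hB z.1 ht
    rw [hy'] at hY
    have hq : HasDerivAt (fun σ : ℝ => inner ℝ (dil (√(t - σ))⁻¹ (flowOp B (-σ) z.1))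
          (M (dil (√(t - σ))⁻¹ (flowOp B (-σ) z.1))))
          (inner ℝ (M y) (op A (M y)) / t) 0 := by
      have h3 := hY.inner ℝ (M.hasFDerivAt.comp_hasDerivAt 0 hY)
      refine h3.congr_deriv ?_
      simp only [Function.comp, sub_zero, neg_zero, flowOp_zero, hy', map_smul, inner_smul_left,
        inner_smul_right, RCLike.conj_to_real]
      rw [← hM.lyapunov, ← hM.symm y, real_inner_comm (M y)]
      ring
    have h4 := hc.mul (hp.mul (hq.div_const (4 * β)).neg.exp)
    refine (h4.congr_deriv ?_).congr_of_eventuallyEq h1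
    simp only [Pi.mul_apply, Pi.neg_apply, sub_zero, neg_zero, flowOp_zero, hy', kernDrift, kern,
      gauss, ← hy, ← htdef, hmax]
    ring

/-- The kernel is a subsolution up to the error made by the cutoff. -/
theorem neg_cutoffDeriv_le (hη : 0 < η) (hM : IsPrecision B A c₁ c₂ M) {ε : ℝ}
    (hε : ε < 1) (hS : (1 + ε) * homDim p ≤ 2 * (1 - ε) * S) {s : Fin m → Space p}
    (hs : Admissible ε A s) (z : SpaceTime p) :
    -(cutoffDeriv η z.2 * gauss M S (1 - ε) η z) ≤
      ∑ i, kernDeriv₂ M S (1 - ε) η (s i) z + kernDrift A M S (1 - ε) η z := by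
  have hβ : 0 < 1 - ε := by linarith
  have hτ : 0 < max z.2 η := lt_max_of_lt_right hη
  set β := 1 - ε with hβdef
  set v := M (unitPart η z) with hv
  have h1 := hs.lower v
  have h2 := hM.trace ε m s hs
  have h3 := hM.nonneg v
  have e : ∑ i, kernDeriv₂ M S β η (s i) z = kern M S β η z *
      (((∑ i, inner ℝ (s i) v ^ 2) / (4 * β ^ 2) - (∑ i, inner ℝ (s i) (M (s i))) / (2 * β))
        / max z.2 η) := by
    simp only [kernDeriv₂, Finset.sum_div, ← Finset.mul_sum, ← Finset.sum_sub_distrib, ← hv]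
  rw [e, kernDrift, ← hv]
  -- The choice `β = 1 - ε` makes the quadratic terms nonnegative, by the lower bound in
  -- `Admissible`; the enlarged exponent `S` absorbs the trace term, bounded by `(1 + ε) Q`.
  have h4 : 0 ≤ ((∑ i, inner ℝ (s i) v ^ 2) / (4 * β ^ 2) - (∑ i, inner ℝ (s i) (M (s i))) / (2 * β))
      + (S - inner ℝ v (op A v) / (4 * β)) := by
    have h5 : inner ℝ v (op A v) / (4 * β) ≤ (∑ i, inner ℝ (s i) v ^ 2) / (4 * β ^ 2) := by
      rw [div_le_div_iff₀ (by positivity) (by positivity)]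
      nlinarith
    have h6 : (∑ i, inner ℝ (s i) (M (s i))) / (2 * β) ≤ S := by
      rw [div_le_iff₀ (by positivity)]
      nlinarith
    linarith
  have h7 := mul_nonneg (kern_nonneg (M := M) (S := S) (β := β) hη z) (div_nonneg h4 hτ.le)
  rw [add_div, mul_add] at h7
  linarith

end Kernel

end Kolmogorov

namespace Kolmogorov

open Filter Topology MeasureTheory
open scoped Matrix

/-! ### Upper and lower bounds for the kernel and its potential -/

section Bounds

variable {n : ℕ} {p : Fin (n + 1) → ℕ}

theorem exists_rpow_neg_mul_exp_le {P : ℝ} (hP : 0 ≤ P) :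
    ∃ K : ℝ, 0 < K ∧ ∀ t b : ℝ, 0 < t → 0 < b → t ^ (-P) * Real.exp (-(b / t)) ≤ K * b ^ (-P) := by
  obtain ⟨N, hN⟩ := exists_nat_ge P
  refine ⟨N.factorial * Real.exp 1, by positivity, fun t b ht hb => ?_⟩
  have hx : 0 < b / t := by positivity
  have h1 : (b / t) ^ P ≤ N.factorial * Real.exp (1 + b / t) := by
    calc (b / t) ^ P ≤ (1 + b / t) ^ P := Real.rpow_le_rpow hx.le (by linarith) hP
      _ ≤ (1 + b / t) ^ (N : ℝ) := Real.rpow_le_rpow_of_exponent_le (by linarith) hN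
      _ = (1 + b / t) ^ N := Real.rpow_natCast _ _
      _ ≤ _ := by
        have := Real.pow_div_factorial_le_exp (1 + b / t) (by linarith) N
        rw [div_le_iff₀ (by positivity)] at this
        linarith
  rw [Real.div_rpow hb.le ht.le, div_le_iff₀ (Real.rpow_pos_of_pos ht _), Real.exp_add] at h1
  rw [Real.rpow_neg ht.le, Real.rpow_neg hb.le, Real.exp_neg, ← mul_inv, ← div_eq_mul_inv,
    le_div_iff₀ (Real.rpow_pos_of_pos hb _), inv_mul_le_iff₀ (by positivity)]
  linarith

/-- The unit rescaling expands by at least a multiple of `1/√t`, for bounded times. -/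
theorem norm_le_dil_inv_sqrt {t : ℝ} (ht : 0 < t) (ht8 : t ≤ 8) (x : Space p) :
    ‖x‖ ≤ √t * 8 ^ n * ‖dil (√t)⁻¹ x‖ := by
  have hs : 0 < √t := Real.sqrt_pos.2 ht
  have h1 : ‖x‖ ≤ ‖(√t * 8 ^ n) • dil (√t)⁻¹ x‖ := norm_le_norm_of_abs_le fun k => by
    have h2 : x k = √t ^ weight k * dil (√t)⁻¹ x k := by
      rw [dil_apply, ← mul_assoc, ← mul_pow, mul_inv_cancel₀ hs.ne', one_pow, one_mul]
    conv_lhs => rw [h2]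
    rw [PiLp.smul_apply, smul_eq_mul, abs_mul, abs_mul]
    refine mul_le_mul_of_nonneg_right ?_ (abs_nonneg _)
    rw [abs_of_pos (by positivity), abs_of_pos (by positivity), weight, pow_succ, pow_mul,
      Real.sq_sqrt ht.le, mul_comm]
    refine mul_le_mul_of_nonneg_left ?_ hs.le
    calc t ^ (k.1 : ℕ) ≤ 8 ^ (k.1 : ℕ) := pow_le_pow_left₀ ht.le ht8 _
      _ ≤ 8 ^ n := pow_le_pow_right₀ (by norm_num) (by omega)
  rwa [norm_smul, Real.norm_of_nonneg (by positivity)] at h1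

theorem det_dil (r : ℝ) : LinearMap.det (dil (p := p) r : Space p →ₗ[ℝ] Space p) = r ^ homDim p := by
  have h : (dil (p := p) r : Space p →ₗ[ℝ] Space p) =
      Matrix.toLin (EuclideanSpace.basisFun (Coord p) ℝ).toBasis
        (EuclideanSpace.basisFun (Coord p) ℝ).toBasis (dilMatrix p r) := by
    rw [← Matrix.toEuclideanLin_eq_toLin_orthonormal]
    exact Matrix.coe_toEuclideanCLM_eq_toEuclideanLin _
  rw [h, LinearMap.det_toLin, dilMatrix, Matrix.det_diagonal, Finset.prod_pow_eq_pow_sum]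
  rfl

theorem lintegral_comp_dil {r : ℝ} (hr : 0 < r) {G : Space p → ENNReal} (hG : Measurable G) :
    ∫⁻ w, G (dil r w) = ENNReal.ofReal ((r ^ homDim p)⁻¹) * ∫⁻ w, G w := by
  have hdet : LinearMap.det (dil (p := p) r : Space p →ₗ[ℝ] Space p) ≠ 0 := by
    rw [det_dil]; positivity
  have h := Measure.map_linearMap_addHaar_eq_smul_addHaar (volume : Measure (Space p)) hdet
  rw [det_dil, abs_of_pos (by positivity)] at h
  rw [← smul_eq_mul, ← lintegral_smul_measure, ← h]
  exact (lintegral_map hG (dil r).continuous.measurable).symm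

theorem measurable_dil_comp {X : Type*} [MeasurableSpace X] {f : X → ℝ} {g : X → Space p}
    (hf : Measurable f) (hg : Measurable g) : Measurable fun a => dil (f a) (g a) := by
  have h := continuous_dil_apply.measurable.comp (hf.prodMk hg)
  exact h

theorem lintegral_exp_neg_norm_sq_lt_top {c : ℝ} (hc : 0 < c) :
    ∫⁻ w : Space p, ENNReal.ofReal (Real.exp (-(c * ‖w‖ ^ 2))) < ⊤ := by
  have h : Integrable fun w : Space p => Real.exp (-c * ‖w‖ ^ 2) := by
    by_contra hcon
    have h1 := GaussianFourier.integral_rexp_neg_mul_sq_norm (V := Space p) hc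
    rw [integral_undef hcon] at h1
    have : 0 < (Real.pi / c) ^ ((Module.finrank ℝ (Space p) : ℝ) / 2) :=
      Real.rpow_pos_of_pos (by positivity) _
    linarith
  simpa only [neg_mul] using h.lintegral_lt_top

variable {B A : Matrix (Coord p) (Coord p) ℝ} {M : Space p →L[ℝ] Space p} {S β η c₁ c₂ : ℝ}

/-- The Gaussian profile that bounds the kernel. -/
noncomputable def profile (c : ℝ) (y : Space p) : ENNReal := ENNReal.ofReal (Real.exp (-(c * ‖y‖ ^ 2)))

theorem measurable_profile (c : ℝ) : Measurable (profile (p := p) c) := by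
  unfold profile; fun_prop

/-- After factoring out `E(T)`, the dilation by `1/√T` turns it into `E(1)`. Only reflection,
translation and the determinant of the dilation enter the change of variables; the Jacobian of the
flow is not needed. -/
theorem lintegral_profile_rel (hB : IsDrift p B) (c : ℝ) (x : Space p) {T : ℝ} (hT : 0 < T) :
    ∫⁻ ξ, profile c (dil (√T)⁻¹ (x - flowOp B T ξ)) =
      ENNReal.ofReal (√T ^ homDim p) * ∫⁻ ξ, profile c (flowOp B 1 ξ) := by
  have hs : 0 < √T := Real.sqrt_pos.2 hT
  have h1 : ∀ ξ, dil (√T)⁻¹ (x - flowOp B T ξ) =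
      flowOp B 1 (dil (√T)⁻¹ (flowOp B (-T) x - ξ)) := by
    intro ξ
    have h2 : x - flowOp B T ξ = flowOp B T (flowOp B (-T) x - ξ) := by
      rw [map_sub, flowOp_neg_cancel]
    rw [h2, dil_flowOp hB (inv_pos.2 hs).ne', inv_pow, Real.sq_sqrt hT.le,
      inv_mul_cancel₀ hT.ne']
  have hm : Measurable fun ξ : Space p => profile c (flowOp B 1 ξ) :=
    (measurable_profile c).comp (flowOp B 1).continuous.measurable
  simp only [h1]
  rw [lintegral_sub_left_eq_self (fun w => profile c (flowOp B 1 (dil (√T)⁻¹ w))),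
    lintegral_comp_dil (inv_pos.2 hs) hm, inv_pow, inv_inv]

/-- A bound for the mass of the kernel over a bounded time interval. -/
theorem exists_lintegral_profile_bound (hB : IsDrift p B) {c : ℝ} (hc : 0 < c) :
    ∃ K : ENNReal, K < ⊤ ∧ ∀ z : SpaceTime p, ∫⁻ ζ : SpaceTime p,
      (Set.Ioc 0 7).indicator (fun T => ENNReal.ofReal (T ^ (-((homDim p : ℝ) / 2 + 1 / 2))) *
        profile c (dil (√T)⁻¹ (z.1 - flowOp B T ζ.1))) (z.2 - ζ.2) ≤ K := by
  obtain ⟨K₀, hK₀, hK⟩ := exists_flowOp_bound B 1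
  set J := ∫⁻ ξ, profile c (flowOp B 1 ξ) with hJ
  have hJfin : J < ⊤ := by
    refine lt_of_le_of_lt (lintegral_mono fun ξ => ?_)
      (lintegral_exp_neg_norm_sq_lt_top (p := p) (c := c * (K₀⁻¹) ^ 2) (by positivity))
    refine ENNReal.ofReal_le_ofReal (Real.exp_le_exp.2 (neg_le_neg ?_))
    rw [mul_assoc, ← mul_pow]
    have h1 := (hK (-1) (by simp) (flowOp B 1 ξ)).1
    rw [flowOp_cancel_neg] at h1
    have : K₀⁻¹ * ‖ξ‖ ≤ ‖flowOp B 1 ξ‖ := by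
      rw [inv_mul_le_iff₀ (by linarith)]; exact h1
    gcongr
  -- The factor `T ^ (-(Q/2 + 1/2))` times the slice volume `T ^ (Q/2)` leaves `T ^ (-1/2)`, which
  -- is integrable at `0`. This is the room used to enlarge the exponent.
  refine ⟨∫⁻ T in Set.Ioc (0 : ℝ) 7, ENNReal.ofReal (T ^ (-(1 / 2) : ℝ)) * J, ?_, fun z => ?_⟩
  · rw [lintegral_mul_const _ (by fun_prop)]
    refine ENNReal.mul_lt_top ?_ hJfin
    have : IntegrableOn (fun T : ℝ => T ^ (-(1 / 2) : ℝ)) (Set.Ioc 0 7) :=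
      (intervalIntegrable_iff_integrableOn_Ioc_of_le (by norm_num)).1
        (intervalIntegral.intervalIntegrable_rpow' (by norm_num))
    exact this.lintegral_lt_top
  · have hmeas : Measurable fun ζ : SpaceTime p =>
        (Set.Ioc 0 7).indicator (fun T => ENNReal.ofReal (T ^ (-((homDim p : ℝ) / 2 + 1 / 2))) *
          profile c (dil (√T)⁻¹ (z.1 - flowOp B T ζ.1))) (z.2 - ζ.2) := by
      have e : (fun ζ : SpaceTime p =>
        (Set.Ioc 0 7).indicator (fun T => ENNReal.ofReal (T ^ (-((homDim p : ℝ) / 2 + 1 / 2))) *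
          profile c (dil (√T)⁻¹ (z.1 - flowOp B T ζ.1))) (z.2 - ζ.2)) =
        ((fun ζ : SpaceTime p => z.2 - ζ.2) ⁻¹' Set.Ioc 0 7).indicator fun ζ =>
          ENNReal.ofReal ((z.2 - ζ.2) ^ (-((homDim p : ℝ) / 2 + 1 / 2))) *
          profile c (dil (√(z.2 - ζ.2))⁻¹ (z.1 - flowOp B (z.2 - ζ.2) ζ.1)) := by
        funext ζ
        rfl
      rw [e]
      have hf : Measurable fun ζ : SpaceTime p => flowOp B (z.2 - ζ.2) ζ.1 :=
        (continuous_flowOp_comp B (by fun_prop) (by fun_prop)).measurable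
      have hd : Measurable fun ζ : SpaceTime p =>
          dil (√(z.2 - ζ.2))⁻¹ (z.1 - flowOp B (z.2 - ζ.2) ζ.1) :=
        measurable_dil_comp (by fun_prop) (by fun_prop)
      have hp := (measurable_profile c).comp hd
      exact Measurable.indicator (Measurable.mul (by fun_prop) hp)
        ((by fun_prop : Measurable fun ζ : SpaceTime p => z.2 - ζ.2) measurableSet_Ioc)
    rw [Measure.volume_eq_prod, lintegral_prod_symm _ hmeas.aemeasurable,
      ← lintegral_indicator measurableSet_Ioc]
    have hin : ∀ T : ℝ, ∫⁻ ξ : Space p, (Set.Ioc 0 7).indicator (fun T =>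
        ENNReal.ofReal (T ^ (-((homDim p : ℝ) / 2 + 1 / 2))) *
          profile c (dil (√T)⁻¹ (z.1 - flowOp B T ξ))) T =
        (Set.Ioc 0 7).indicator (fun T => ENNReal.ofReal (T ^ (-(1 / 2) : ℝ)) * J) T := by
      intro T
      by_cases hT : T ∈ Set.Ioc (0 : ℝ) 7
      · simp only [Set.indicator_of_mem hT]
        have hd : Measurable fun ξ : Space p => dil (√T)⁻¹ (z.1 - flowOp B T ξ) := by
          have : Continuous fun ξ : Space p => dil (√T)⁻¹ (z.1 - flowOp B T ξ) := by fun_prop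
          exact this.measurable
        have hd' := (measurable_profile c).comp hd
        simp only [Function.comp_def] at hd'
        rw [lintegral_const_mul _ hd', lintegral_profile_rel hB c _ hT.1,
          ← mul_assoc, ← ENNReal.ofReal_mul (Real.rpow_nonneg hT.1.le _)]
        congr 2
        rw [Real.sqrt_eq_rpow, ← Real.rpow_natCast, ← Real.rpow_mul hT.1.le,
          ← Real.rpow_add hT.1]
        congr 1
        ring
      · simp only [Set.indicator_of_notMem hT, lintegral_zero]
    simp only [hin]
    rw [lintegral_sub_left_eq_self]

theorem gauss_eq_of_le (h : η ≤ t) (x : Space p) : gauss M S β η (x, t) =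
    t ^ (-S) * Real.exp (-(inner ℝ (dil (√t)⁻¹ x) (M (dil (√t)⁻¹ x)) / (4 * β))) := by
  simp only [gauss, unitPart, max_eq_left h]

theorem kern_le_profile (hη : 0 < η) (hβ : 0 < β) (hM : IsPrecision B A c₁ c₂ M) (x : Space p)
    {t : ℝ} (ht : 0 < t) :
    ENNReal.ofReal (kern M S β η (x, t)) ≤
      ENNReal.ofReal (t ^ (-S)) * profile (c₁ / (4 * β)) (dil (√t)⁻¹ x) := by
  rcases le_or_gt η t with h | h
  · rw [profile, ← ENNReal.ofReal_mul (Real.rpow_nonneg ht.le _)]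
    refine ENNReal.ofReal_le_ofReal ?_
    rw [kern, gauss_eq_of_le h]
    refine (mul_le_of_le_one_left ?_ (cutoff_le_one _ _)).trans ?_
    · exact mul_nonneg (Real.rpow_nonneg ht.le _) (Real.exp_pos _).le
    · refine mul_le_mul_of_nonneg_left (Real.exp_le_exp.2 (neg_le_neg ?_)) (Real.rpow_nonneg ht.le _)
      rw [div_mul_eq_mul_div]
      gcongr
      exact hM.lower _
  · simp [kern, cutoff_of_le hη h.le]

/-- The potentials of the kernels over the unit box are uniformly bounded. -/
theorem exists_potential_le (hB : IsDrift p B) {β c₁ : ℝ} (hβ : 0 < β) (hc₁ : 0 < c₁) :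
    ∃ K : ℝ, 0 < K ∧ ∀ (A : Matrix (Coord p) (Coord p) ℝ) (M : Space p →L[ℝ] Space p) (c₂ η : ℝ),
      0 < η → IsPrecision B A c₁ c₂ M → ∀ E : Set (SpaceTime p), MeasurableSet E →
      (∀ ζ ∈ E, -7 ≤ ζ.2) → ∀ z : SpaceTime p, z.2 ≤ 0 →
      ∫ ζ in E, kern M ((homDim p : ℝ) / 2 + 1 / 2) β η (rel B ζ z) ≤ K := by
  obtain ⟨K, hK, hbd⟩ := exists_lintegral_profile_bound hB (c := c₁ / (4 * β)) (by positivity)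
  refine ⟨K.toReal + 1, by positivity, fun A M c₂ η hη hM E hE hE7 z hz => ?_⟩
  have hcont : Continuous fun ζ => kern M ((homDim p : ℝ) / 2 + 1 / 2) β η (rel B ζ z) :=
    (continuous_kern hη).comp
      ((continuous_rel B).comp (by fun_prop : Continuous fun ζ : SpaceTime p => (ζ, z)))
  rw [integral_eq_lintegral_of_nonneg_ae (Eventually.of_forall fun ζ => kern_nonneg hη _)
    hcont.aestronglyMeasurable]
  refine (ENNReal.toReal_mono hK.ne (le_trans ?_ (hbd z))).trans (by linarith)
  rw [← lintegral_indicator hE]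
  refine lintegral_mono fun ζ => ?_
  by_cases hζ : ζ ∈ E
  · rw [Set.indicator_of_mem hζ]
    rcases le_or_gt (z.2 - ζ.2) 0 with h | h
    · have : kern M ((homDim p : ℝ) / 2 + 1 / 2) β η (rel B ζ z) = 0 := by
        rw [kern, cutoff_of_le hη (by simp only [rel]; linarith), zero_mul]
      rw [this, ENNReal.ofReal_zero]
      exact bot_le
    · have h7 : z.2 - ζ.2 ≤ 7 := by linarith [hE7 ζ hζ]
      rw [Set.indicator_of_mem (show z.2 - ζ.2 ∈ Set.Ioc (0 : ℝ) 7 from ⟨h, h7⟩)]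
      exact kern_le_profile hη hβ hM _ h
  · rw [Set.indicator_of_notMem hζ]; exact bot_le

theorem gauss_le (hη : 0 < η) (hβ : 0 < β) (hc₁ : 0 < c₁) (hM : IsPrecision B A c₁ c₂ M) (x : Space p)
    {t : ℝ} (ht : η ≤ t) (ht8 : t ≤ 8) :
    gauss M S β η (x, t) ≤
      t ^ (-S) * Real.exp (-(c₁ / (4 * β) * (8 ^ n)⁻¹ ^ 2 * ‖x‖ ^ 2 / t)) := by
  have ht0 : 0 < t := hη.trans_le ht
  rw [gauss_eq_of_le ht]
  refine mul_le_mul_of_nonneg_left (Real.exp_le_exp.2 (neg_le_neg ?_)) (Real.rpow_nonneg ht0.le _)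
  have h1 := norm_le_dil_inv_sqrt ht0 ht8 x
  have h2 : (8 ^ n)⁻¹ ^ 2 * ‖x‖ ^ 2 / t ≤ ‖dil (√t)⁻¹ x‖ ^ 2 := by
    have h3 : ‖x‖ ^ 2 ≤ (√t * 8 ^ n * ‖dil (√t)⁻¹ x‖) ^ 2 := pow_le_pow_left₀ (norm_nonneg _) h1 2
    rw [mul_pow, mul_pow, Real.sq_sqrt ht0.le] at h3
    rw [div_le_iff₀ ht0, inv_pow, inv_mul_le_iff₀ (by positivity)]
    linarith
  calc c₁ / (4 * β) * (8 ^ n)⁻¹ ^ 2 * ‖x‖ ^ 2 / t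
      = c₁ / (4 * β) * ((8 ^ n)⁻¹ ^ 2 * ‖x‖ ^ 2 / t) := by ring
    _ ≤ c₁ / (4 * β) * ‖dil (√t)⁻¹ x‖ ^ 2 := by gcongr
    _ = c₁ * ‖dil (√t)⁻¹ x‖ ^ 2 / (4 * β) := by ring
    _ ≤ _ := by gcongr; exact hM.lower _

/-- For `t ≥ 1` the rescaling by `1/√t` contracts, so the Gaussian is bounded below on bounded sets
away from the pole in time. -/
theorem le_gauss (hβ : 0 < β) (hS : 0 ≤ S) (hc₂ : 0 < c₂) (hM : IsPrecision B A c₁ c₂ M) {x : Space p} {X : ℝ}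
    (hx : ‖x‖ ≤ X) {t : ℝ} (ht : η ≤ t) (ht1 : 1 ≤ t) (ht8 : t ≤ 8) :
    8 ^ (-S) * Real.exp (-(c₂ * X ^ 2 / (4 * β))) ≤ gauss M S β η (x, t) := by
  rw [gauss_eq_of_le ht]
  have ht0 : 0 < t := by linarith
  have h1 : ‖dil (√t)⁻¹ x‖ ≤ X := by
    have hs : 1 ≤ √t := Real.one_le_sqrt.2 ht1
    have h2 : (√t)⁻¹ ≤ 1 := inv_le_one_of_one_le₀ hs
    refine (norm_dil_le (by positivity) h2 x).trans ?_
    exact (mul_le_of_le_one_left (norm_nonneg _) h2).trans hx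
  refine mul_le_mul ?_ (Real.exp_le_exp.2 (neg_le_neg ?_)) (Real.exp_pos _).le
    (Real.rpow_nonneg ht0.le _)
  · exact Real.rpow_le_rpow_of_nonpos ht0 ht8 (by linarith)
  · gcongr
    exact (hM.upper _).trans (by gcongr)

/-- Away from the pole in space, the error made by the cutoff tends to zero with `η`. -/
theorem exists_cutoffDeriv_mul_gauss_le {β c₁ S : ℝ} (hβ : 0 < β) (hc₁ : 0 < c₁) (hS : 0 ≤ S)
    (n : ℕ) {d : ℝ} (hd : 0 < d) :
    ∃ K : ℝ, 0 < K ∧ ∀ (p : Fin (n + 1) → ℕ) (B A : Matrix (Coord p) (Coord p) ℝ)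
      (M : Space p →L[ℝ] Space p) (c₂ η : ℝ),
      0 < η → η ≤ 4 → IsPrecision B A c₁ c₂ M → ∀ (x : Space p) (t : ℝ),
      (η ≤ t → t ≤ 2 * η → d ≤ ‖x‖) →
      cutoffDeriv η t * gauss M S β η (x, t) ≤ K * η := by
  obtain ⟨K₁, hK₁, h1⟩ := exists_abs_cutoffDeriv_le
  -- The exponent `S + 2` gains a factor `t ^ 2`, of order `η ^ 2` where the cutoff varies; this
  -- beats the `1/η` of its derivative.
  obtain ⟨K₂, hK₂, h2⟩ := exists_rpow_neg_mul_exp_le (P := S + 2) (by linarith)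
  set a := c₁ / (4 * β) * ((8 : ℝ) ^ n)⁻¹ ^ 2 * d ^ 2 with ha
  have ha0 : 0 < a := by positivity
  refine ⟨4 * K₁ * (K₂ * a ^ (-(S + 2))), by positivity, fun p B A M c₂ η hη hη4 hM x t hx => ?_⟩
  have hpos : 0 ≤ 4 * K₁ * (K₂ * a ^ (-(S + 2))) * η := by positivity
  rcases lt_or_ge t η with h | h
  · rw [cutoffDeriv_of_lt hη h, zero_mul]; exact hpos
  rcases lt_or_ge (2 * η) t with h' | h'
  · rw [cutoffDeriv_of_gt hη h', zero_mul]; exact hpos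
  have ht : 0 < t := hη.trans_le h
  have h3 : gauss M S β η (x, t) ≤ t ^ 2 * (K₂ * a ^ (-(S + 2))) := by
    refine (gauss_le hη hβ hc₁ hM x h (by linarith)).trans ?_
    calc _ ≤ t ^ (-S) * Real.exp (-(a / t)) := by
          have hd2 : d ^ 2 ≤ ‖x‖ ^ 2 := pow_le_pow_left₀ hd.le (hx h h') 2
          rw [ha]
          gcongr
      _ = t ^ 2 * (t ^ (-(S + 2)) * Real.exp (-(a / t))) := by
          rw [← mul_assoc, ← Real.rpow_natCast t 2, ← Real.rpow_add ht]
          congr 2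
          push_cast; ring
      _ ≤ _ := mul_le_mul_of_nonneg_left (h2 t a ht ha0) (by positivity)
  calc cutoffDeriv η t * gauss M S β η (x, t)
      ≤ K₁ / η * (t ^ 2 * (K₂ * a ^ (-(S + 2)))) := by
        refine mul_le_mul ((le_abs_self _).trans (h1 η t hη)) h3 (gauss_pos hη _).le (by positivity)
    _ ≤ K₁ / η * ((2 * η) ^ 2 * (K₂ * a ^ (-(S + 2)))) := by gcongr
    _ = _ := by field_simp; ring

/-- The kernel is small far from the pole in space. -/
theorem exists_kern_le {β c₁ S θ : ℝ} (hβ : 0 < β) (hc₁ : 0 < c₁) (hS : 0 < S) (hθ : 0 < θ) (n : ℕ) :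
    ∃ X : ℝ, 0 < X ∧ ∀ (p : Fin (n + 1) → ℕ) (B A : Matrix (Coord p) (Coord p) ℝ)
      (M : Space p →L[ℝ] Space p) (c₂ η : ℝ),
      0 < η → IsPrecision B A c₁ c₂ M → ∀ (x : Space p) (t : ℝ), t ≤ 8 → X ≤ ‖x‖ →
      kern M S β η (x, t) ≤ θ := by
  obtain ⟨K, hK, h1⟩ := exists_rpow_neg_mul_exp_le (P := S) hS.le
  set a := c₁ / (4 * β) * ((8 : ℝ) ^ n)⁻¹ ^ 2 with ha
  have ha0 : 0 < a := by positivity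
  have hlim : Tendsto (fun X : ℝ => K * (a * X ^ 2) ^ (-S)) atTop (𝓝 0) := by
    have h2 : Tendsto (fun X : ℝ => a * X ^ 2) atTop atTop :=
      (tendsto_pow_atTop two_ne_zero).const_mul_atTop ha0
    simpa using ((tendsto_rpow_neg_atTop hS).comp h2).const_mul K
  obtain ⟨X, hX0, hX⟩ := ((eventually_gt_atTop 0).and (hlim.eventually (gt_mem_nhds hθ))).exists
  refine ⟨X, hX0, fun p B A M c₂ η hη hM x t ht8 hx => ?_⟩
  rcases lt_or_ge t η with h | h
  · rw [kern, cutoff_of_le hη h.le, zero_mul]; exact hθ.le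
  have ht : 0 < t := hη.trans_le h
  refine (mul_le_of_le_one_left (gauss_pos hη _).le (cutoff_le_one _ _)).trans ?_
  refine (gauss_le hη hβ hc₁ hM x h ht8).trans (le_trans ?_ hX.le)
  refine le_trans ?_ (h1 t (a * X ^ 2) ht (by positivity))
  gcongr

end Bounds

end Kolmogorov

namespace Kolmogorov

open Filter Topology MeasureTheory
open scoped Matrix

/-! ### The growth lemma -/

section Growth

variable {n : ℕ} {p : Fin (n + 1) → ℕ} {B A : Matrix (Coord p) (Coord p) ℝ}

/-- `v` is, at `z`, a supersolution for some coefficients that are `ε`-close to `A`. -/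
def IsSuperAt (B A : Matrix (Coord p) (Coord p) ℝ) (ε : ℝ) (v : SpaceTime p → ℝ)
    (z : SpaceTime p) : Prop :=
  ∃ (m : ℕ) (s : Fin m → Space p) (a : ℝ), Admissible ε A s ∧ a ≤ 0 ∧ HasLop B s v z a

/-- The unit cylinder with closed radius `R`, on the times `[-8, 0]`. -/
def closedCyl (p : Fin (n + 1) → ℕ) (R : ℝ) : Set (SpaceTime p) :=
  Metric.closedBall 0 R ×ˢ Set.Icc (-8) 0

/-- The interior of the unit cylinder of radius `R`. -/
def openCyl (p : Fin (n + 1) → ℕ) (R : ℝ) : Set (SpaceTime p) :=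
  Metric.ball 0 R ×ˢ Set.Ioo (-8) 0

/-- The box of early times where the solution is measured. -/
def earlyBox (p : Fin (n + 1) → ℕ) : Set (SpaceTime p) :=
  Metric.closedBall 0 1 ×ˢ Set.Icc (-7) (-5)

/-- The box of late times where the solution is bounded below. -/
def lateBox (p : Fin (n + 1) → ℕ) : Set (SpaceTime p) :=
  Metric.closedBall 0 1 ×ˢ Set.Icc (-1) 0

theorem isCompact_closedCyl (R : ℝ) : IsCompact (closedCyl p R) :=
  (isCompact_closedBall _ _).prod isCompact_Icc

theorem isCompact_earlyBox : IsCompact (earlyBox p) :=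
  (isCompact_closedBall _ _).prod isCompact_Icc

theorem eq_of_rel_eq_zero {ζ z : SpaceTime p} (h : rel B ζ z = 0) : z = ζ := by
  have h2 : z.2 - ζ.2 = 0 := congrArg Prod.snd h
  have h1 : z.1 - flowOp B (z.2 - ζ.2) ζ.1 = 0 := congrArg Prod.fst h
  rw [h2, flowOp_zero] at h1
  exact Prod.ext (sub_eq_zero.1 h1) (sub_eq_zero.1 h2)

/-- The distance is merely qualitative. It may depend on the solution, as it will only be used to
choose the cutoff scale, which does not enter the final constant. -/
theorem exists_norm_rel_ge {E Z : Set (SpaceTime p)} (hE : IsCompact E) (hZ : IsCompact Z)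
    (hEZ : Disjoint E Z) : ∃ d : ℝ, 0 < d ∧ ∀ ζ ∈ E, ∀ z ∈ Z, d ≤ ‖rel B ζ z‖ := by
  rcases (E ×ˢ Z).eq_empty_or_nonempty with h | h
  · refine ⟨1, one_pos, fun ζ hζ z hz => ?_⟩
    have : (ζ, z) ∈ E ×ˢ Z := ⟨hζ, hz⟩
    rw [h] at this
    exact this.elim
  · have hc : ContinuousOn (fun q : SpaceTime p × SpaceTime p => ‖rel B q.1 q.2‖) (E ×ˢ Z) :=
      (continuous_rel B).norm.continuousOn
    obtain ⟨q, hq, hmin⟩ := (hE.prod hZ).exists_isMinOn h hc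
    rw [isMinOn_iff] at hmin
    refine ⟨‖rel B q.1 q.2‖, norm_pos_iff.2 fun h0 => ?_, fun ζ hζ z hz => hmin (ζ, z) ⟨hζ, hz⟩⟩
    have := eq_of_rel_eq_zero h0
    exact Set.disjoint_left.1 hEZ hq.1 (this ▸ hq.2)

/-- The growth lemma, with a linear dependence on the measure of the set. -/
theorem exists_growth (hB : IsDrift p B) {c₁ c₂ ε : ℝ} (hc₁ : 0 < c₁) (hc₂ : 0 < c₂)
    (hε : ε < 1)
    (hS : (1 + ε) * homDim p ≤ 2 * (1 - ε) * ((homDim p : ℝ) / 2 + 1 / 2)) :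
    ∃ R c : ℝ, 1 ≤ R ∧ 0 < c ∧ ∀ (A : Matrix (Coord p) (Coord p) ℝ) (M : Space p →L[ℝ] Space p),
      IsPrecision B A c₁ c₂ M → ∀ v : SpaceTime p → ℝ, ContinuousOn v (closedCyl p R) →
      (∀ z ∈ openCyl p R, IsSuperAt B A ε v z) → (∀ z ∈ closedCyl p R, 0 ≤ v z) →
      ∀ E ⊆ earlyBox p, IsCompact E → ∀ k : ℝ, 0 < k → (∀ z ∈ E, k ≤ v z) →
      ∀ z ∈ lateBox p, c * k * volume.real E ≤ v z := by
  set S := (homDim p : ℝ) / 2 + 1 / 2 with hSdef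
  have hS0 : 0 < S := by positivity
  set β := 1 - ε with hβdef
  have hβ : 0 < β := by rw [hβdef]; linarith
  obtain ⟨K, hK1, hK⟩ := exists_flowOp_bound B 8
  -- The lower bound for the kernel between early and late points: they differ in time by between
  -- `4` and `8`, and `1 + K` bounds the relative position in space.
  set c₀ := 8 ^ (-S) * Real.exp (-(c₂ * (1 + K) ^ 2 / (4 * β))) with hc₀def
  have hc₀ : 0 < c₀ := mul_pos (Real.rpow_pos_of_pos (by norm_num) _) (Real.exp_pos _)
  obtain ⟨X, hX0, hX⟩ := exists_kern_le (β := β) (S := S) (θ := c₀ / 2) hβ hc₁ hS0 (half_pos hc₀) n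
  obtain ⟨Mb, hMb0, hMb⟩ := exists_potential_le hB hβ hc₁
  -- Poles in `E` are carried by the flow at most to norm `K`, so on the lateral boundary of radius
  -- `X + K` the kernel is at most `c₀ / 2`.
  have hR1 : 1 ≤ X + K := by linarith
  refine ⟨X + K, c₀ / (8 * Mb), hR1, by positivity,
    fun A M hM v hvc hsup hv0 E hEbox hE k hk hkE => ?_⟩
  set R := X + K with hRdef
  set μ := volume.real E with hμdef
  have hμ0 : 0 ≤ μ := measureReal_nonneg
  have hlate : lateBox p ⊆ closedCyl p R :=
    Set.prod_mono (Metric.closedBall_subset_closedBall hR1) (Set.Icc_subset_Icc (by norm_num) le_rfl)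
  rcases hμ0.eq_or_lt with hμ | hμ
  · intro z hz
    rw [← hμ, mul_zero]
    exact hv0 z (hlate hz)
  have hEcyl : E ⊆ closedCyl p R := hEbox.trans
    (Set.prod_mono (Metric.closedBall_subset_closedBall hR1)
      (Set.Icc_subset_Icc (by norm_num) (by norm_num)))
  have hEnorm : ∀ ζ ∈ E, ‖ζ.1‖ ≤ 1 ∧ -7 ≤ ζ.2 ∧ ζ.2 ≤ -5 := fun ζ hζ =>
    ⟨mem_closedBall_zero_iff.1 (hEbox hζ).1, (hEbox hζ).2.1, (hEbox hζ).2.2⟩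
  have hflow : ∀ ζ ∈ E, ∀ τ : ℝ, |τ| ≤ 8 → ‖flowOp B τ ζ.1‖ ≤ K := fun ζ hζ τ hτ =>
    ((hK τ hτ ζ.1).1).trans (mul_le_of_le_one_right (by linarith) (hEnorm ζ hζ).1)
  set Z := closedCyl p R ∩ v ⁻¹' Set.Iic (k / 2) with hZdef
  have hZ : IsCompact Z := (isCompact_closedCyl R).of_isClosed_subset
    (hvc.preimage_isClosed_of_isClosed (isCompact_closedCyl R).isClosed isClosed_Iic)
    Set.inter_subset_left
  have hEZ : Disjoint E Z := Set.disjoint_left.2 fun z hz hz' => by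
    have h1 := hkE z hz
    have h2 : v z ≤ k / 2 := hz'.2
    linarith
  obtain ⟨d, hd, hdist⟩ := exists_norm_rel_ge (B := B) hE hZ hEZ
  obtain ⟨K₃, hK₃, htail⟩ := exists_cutoffDeriv_mul_gauss_le (S := S) hβ hc₁ hS0.le n hd
  -- The error of the cutoff is kept below `θ`, and the term `-θ t` added to the potential
  -- compensates it, making the barrier strict. Its total cost `8 θ` is a quarter of `c₀ μ`.
  set θ := c₀ * μ / 32 with hθdef
  have hθ : 0 < θ := by positivity
  obtain ⟨η, hη, hη1, hηd, hηθ⟩ : ∃ η : ℝ, 0 < η ∧ η ≤ 1 ∧ 2 * η < d ∧ K₃ * η * μ < θ := by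
    refine ⟨min 1 (min (d / 4) (θ / (2 * K₃ * μ))), by positivity, min_le_left _ _, ?_, ?_⟩
    · have := (min_le_right 1 (min (d / 4) (θ / (2 * K₃ * μ)))).trans (min_le_left _ _)
      linarith
    · have h1 := (min_le_right 1 (min (d / 4) (θ / (2 * K₃ * μ)))).trans (min_le_right _ _)
      rw [le_div_iff₀ (by positivity)] at h1
      nlinarith
  set U : SpaceTime p → ℝ := fun z => ∫ ζ in E, kern M S β η (rel B ζ z) with hU
  have hkc : Continuous (kern M S β η) := continuous_kern hη
  have hrelc : ∀ z, Continuous fun ζ => rel B ζ z := fun z =>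
    (continuous_rel B).comp (by fun_prop : Continuous fun ζ : SpaceTime p => (ζ, z))
  have hint : ∀ z, IntegrableOn (fun ζ => kern M S β η (rel B ζ z)) E := fun z =>
    (hkc.comp (hrelc z)).continuousOn.integrableOn_compact hE
  have hUc : Continuous U := continuous_parametric_integral_of_continuous
    (f := fun z ζ => kern M S β η (rel B ζ z))
    (hkc.comp ((continuous_rel B).comp continuous_swap)) hE
  have hconst : ∀ a : ℝ, ∫ _ in E, a = μ * a := fun a => by
    rw [setIntegral_const, smul_eq_mul]
  -- Normalised so that `W ≤ k / 2` everywhere on the cylinder, by `U ≤ Mb`, and `W ≤ 0` where `U ≤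
  -- μ c₀ / 2`, in particular on the bottom and on the lateral boundary.
  set W : SpaceTime p → ℝ := fun z => k / (2 * Mb) * ((U z - θ * z.2) - (μ * (c₀ / 2) + 8 * θ))
    with hW
  have hUle : ∀ z : SpaceTime p, z.2 ≤ 0 → U z ≤ Mb := fun z hz =>
    hMb A M c₂ η hη hM E hE.measurableSet (fun ζ hζ => (hEnorm ζ hζ).2.1) z hz
  have hkM : 0 < k / (2 * Mb) := by positivity
  -- the comparison on the cylinder below a time `T < 0`
  have hcomp : ∀ T : ℝ, -8 ≤ T → T < 0 → ∀ z ∈ Metric.closedBall (0 : Space p) R ×ˢ Set.Icc (-8) T,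
      W z ≤ v z := by
    -- The operator is controlled only at negative times, hence the truncation at `T`; the minimum
    -- may still be attained at the top time `T`.
    intro T hT8 hT0
    set D := Metric.closedBall (0 : Space p) R ×ˢ Set.Icc (-8) T with hD
    have hDsub : D ⊆ closedCyl p R := Set.prod_mono_right (Set.Icc_subset_Icc_right hT0.le)
    have hDc : IsCompact D := (isCompact_closedBall _ _).prod isCompact_Icc
    have hDne : D.Nonempty := ⟨(0, T), by simp [hD]; exact ⟨by linarith, hT8⟩⟩
    have hWc : Continuous W := by fun_prop
    obtain ⟨z₁, hz₁, hmin⟩ := hDc.exists_isMinOn hDne ((hvc.mono hDsub).sub hWc.continuousOn)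
    suffices h : 0 ≤ v z₁ - W z₁ by
      intro z hz
      have h1 : v z₁ - W z₁ ≤ v z - W z := hmin hz
      linarith
    by_contra! hneg
    have hz₁8 : -8 ≤ z₁.2 := hz₁.2.1
    have hz₁0 : z₁.2 < 0 := hz₁.2.2.trans_lt hT0
    have hv1 := hv0 z₁ (hDsub hz₁)
    have htime : -(θ * z₁.2) - 8 * θ ≤ 0 := by nlinarith
    have hWle : ∀ b, U z₁ ≤ b → W z₁ ≤ k / (2 * Mb) * (b - μ * (c₀ / 2)) := fun b hb => by
      refine mul_le_mul_of_nonneg_left ?_ hkM.le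
      linarith
    -- Since `W ≤ k / 2`, a negative minimum of `v - W` lies where `v ≤ k / 2`, hence away from `E`.
    -- No differential inequality for `v` on `E` against the singular part of the barrier is needed.
    have hz₁Z : z₁ ∈ Z := by
      refine ⟨hDsub hz₁, ?_⟩
      by_contra! hcon
      have hcon' : k / 2 < v z₁ := by simpa using hcon
      have h1 := hWle Mb (hUle z₁ hz₁0.le)
      have h2 : k / (2 * Mb) * (Mb - μ * (c₀ / 2)) ≤ k / (2 * Mb) * Mb := by
        refine mul_le_mul_of_nonneg_left ?_ hkM.le
        have : 0 ≤ μ * (c₀ / 2) := by positivity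
        linarith
      have h3 : k / (2 * Mb) * Mb = k / 2 := by field_simp
      linarith
    have hUpos : ¬ U z₁ ≤ μ * (c₀ / 2) := fun h => by
      have := hWle _ h
      rw [sub_self, mul_zero] at this
      linarith
    have hR' : ‖z₁.1‖ < R := by
      refine lt_of_le_of_ne (mem_closedBall_zero_iff.1 hz₁.1) fun hcon => hUpos ?_
      rw [← hconst]
      refine setIntegral_mono_on (hint z₁) (integrableOn_const (hs := hE.measure_lt_top.ne))
        hE.measurableSet fun ζ hζ => ?_
      obtain ⟨_, h7, h5⟩ := hEnorm ζ hζ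
      refine hX p B A M c₂ η hη hM _ _ (by linarith) ?_
      have h1 := hflow ζ hζ (z₁.2 - ζ.2) (abs_le.2 ⟨by linarith, by linarith⟩)
      have h2 := norm_sub_norm_le z₁.1 (flowOp B (z₁.2 - ζ.2) ζ.1)
      linarith
    have h8 : -8 < z₁.2 := by
      refine lt_of_le_of_ne hz₁8 fun hcon => hUpos ?_
      have : U z₁ = 0 := by
        rw [hU]
        refine setIntegral_eq_zero_of_forall_eq_zero fun ζ hζ => ?_
        rw [kern, cutoff_of_le hη, zero_mul]
        simp only [rel]
        linarith [(hEnorm ζ hζ).2.1]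
      rw [this]; positivity
    obtain ⟨m, s, a, hs, ha, hLv⟩ := hsup z₁ ⟨mem_ball_zero_iff.2 hR', h8, hz₁0⟩
    have hLU := HasLop.potential (B := B) (s := s) hE hkc (continuous_kernDrift (A := A) hη)
      (fun i => continuous_kernDeriv hη (s i)) (fun i => continuous_kernDeriv₂ hη (s i))
      (fun i z => hasDerivAt_kern_spaceLine hM (hs.zero_of_ne i) z)
      (fun i z => hasDerivAt_kernDeriv_spaceLine hη hM (hs.zero_of_ne i) z)
      (fun z => hasDerivAt_kern_driftLine hη hB hM z) z₁
    set ℓ := ∫ ζ in E, (∑ i, kernDeriv₂ M S β η (s i) (rel B ζ z₁) +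
      kernDrift A M S β η (rel B ζ z₁)) with hℓ
    have hLW : HasLop B s W z₁ (k / (2 * Mb) * ((ℓ - θ * (-1)) - 0)) :=
      ((hLU.sub (hasLop_time.const_mul θ)).sub (hasLop_const _)).const_mul _
    have hnn := (hLv.sub hLW).nonneg_of_min h8 (Metric.isOpen_ball.mem_nhds
      (mem_ball_zero_iff.2 hR' : z₁.1 ∈ Metric.ball (0 : Space p) R)) fun x hx t ht1 ht2 =>
        hmin (show (x, t) ∈ D from ⟨Metric.ball_subset_closedBall hx, ht1.le, ht2.trans hz₁.2.2⟩)
    -- Where the cutoff varies, the time separation is at most `2 η < d`, so the separation `d` from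
    -- `E` must be attained in space, and the Gaussian is tiny there.
    have hℓge : -(K₃ * η * μ) ≤ ℓ := by
      have h1 : ∫ _ in E, (-(K₃ * η)) ≤ ℓ := by
        refine setIntegral_mono_on (integrableOn_const (hs := hE.measure_lt_top.ne)) ?_
          hE.measurableSet fun ζ hζ => ?_
        · have hc1 : Continuous fun z => ∑ i, kernDeriv₂ M S β η (s i) z + kernDrift A M S β η z :=
            (continuous_finsetSum _ fun i _ => continuous_kernDeriv₂ hη (s i)).add
              (continuous_kernDrift hη)
          exact (hc1.comp (hrelc z₁)).continuousOn.integrableOn_compact hE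
        · refine le_trans (neg_le_neg ?_) (neg_cutoffDeriv_le hη hM hε hS hs (rel B ζ z₁))
          refine htail p B A M c₂ η hη (by linarith) hM _ _ fun ht1 ht2 => ?_
          have h2 := hdist ζ hζ z₁ hz₁Z
          rw [Prod.norm_def] at h2
          rcases le_max_iff.1 h2 with h3 | h3
          · exact h3
          · rw [Real.norm_eq_abs, abs_of_pos (hη.trans_le ht1)] at h3
            linarith
      rw [hconst] at h1
      linarith
    have : 0 < k / (2 * Mb) * ((ℓ - θ * (-1)) - 0) := mul_pos hkM (by linarith)
    linarith
  have hmain : ∀ x ∈ Metric.closedBall (0 : Space p) 1, ∀ t ∈ Set.Ico (-1 : ℝ) 0,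
      c₀ / (8 * Mb) * k * μ ≤ v (x, t) := by
    intro x hx t ht
    refine le_trans ?_ (hcomp t (by linarith [ht.1]) ht.2 (x, t)
      ⟨Metric.closedBall_subset_closedBall hR1 hx, by linarith [ht.1], le_rfl⟩)
    have hUge : μ * c₀ ≤ U (x, t) := by
      rw [← hconst]
      refine setIntegral_mono_on (integrableOn_const (hs := hE.measure_lt_top.ne)) (hint _)
        hE.measurableSet fun ζ hζ => ?_
      obtain ⟨_, h7, h5⟩ := hEnorm ζ hζ
      have h4 : 4 ≤ t - ζ.2 := by linarith [ht.1]
      have h8 : t - ζ.2 ≤ 8 := by linarith [ht.2]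
      have hk1 : kern M S β η (rel B ζ (x, t)) = gauss M S β η (rel B ζ (x, t)) := by
        rw [kern, cutoff_of_ge hη (by simp only [rel]; linarith), one_mul]
      rw [hk1]
      refine le_gauss hβ hS0.le hc₂ hM ?_ (by simp only; linarith) (by simp only; linarith) h8
      have h1 := hflow ζ hζ (t - ζ.2) (abs_le.2 ⟨by linarith, h8⟩)
      exact (norm_sub_le _ _).trans (add_le_add (mem_closedBall_zero_iff.1 hx) h1)
    -- `μ c₀ - μ c₀ / 2 - 8 θ = μ c₀ / 4`.
    have h2 : k / (2 * Mb) * (μ * c₀ / 4) ≤ W (x, t) := by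
      refine mul_le_mul_of_nonneg_left ?_ hkM.le
      have : θ * t ≤ 0 := mul_nonpos_of_nonneg_of_nonpos hθ.le ht.2.le
      simp only
      linarith
    refine le_trans (le_of_eq ?_) h2
    field_simp
    ring
  rintro ⟨x, t⟩ ⟨hx, ht1, ht0⟩
  simp only at ht1 ht0 hx
  rcases ht0.lt_or_eq with h | rfl
  · exact hmain x hx t ⟨ht1, h⟩
  -- The top time `0` is reached by continuity from below.
  · have hcw : ContinuousWithinAt v (closedCyl p R) (x, 0) := hvc _ (hlate ⟨hx, ht1, le_rfl⟩)
    have htend : Tendsto (fun t : ℝ => ((x, t) : SpaceTime p)) (𝓝[<] 0) (𝓝[closedCyl p R] (x, 0)) := by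
      refine tendsto_nhdsWithin_iff.2 ⟨?_, ?_⟩
      · have : Continuous fun t : ℝ => ((x, t) : SpaceTime p) := by fun_prop
        exact (this.tendsto 0).mono_left nhdsWithin_le_nhds
      · filter_upwards [Ioo_mem_nhdsLT (show (-8 : ℝ) < 0 by norm_num)] with t ht
        exact ⟨Metric.closedBall_subset_closedBall hR1 hx, ht.1.le, ht.2.le⟩
    refine ge_of_tendsto (hcw.tendsto.comp htend) ?_
    filter_upwards [Ioo_mem_nhdsLT (show (-1 : ℝ) < 0 by norm_num)] with t ht
    exact hmain x hx t ⟨ht.1.le, ht.2⟩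

end Growth

end Kolmogorov

namespace Kolmogorov

open Filter Topology MeasureTheory
open scoped Matrix

/-! ### From the growth lemma to the Harnack inequality at unit scale -/

section UnitHarnack

variable {n : ℕ} {p : Fin (n + 1) → ℕ} {B A : Matrix (Coord p) (Coord p) ℝ}

/-- Slice by slice in time: the translation along the flow preserves the measure of a slice, the
dilation contributes `r ^ Q` and time contributes `r ^ 2`. -/
theorem volume_preimage_place {r : ℝ} (hr : 0 < r) (z₀ : SpaceTime p)
    {G : Set (SpaceTime p)} (hG : MeasurableSet G) :
    volume (place B z₀ r ⁻¹' G) = ENNReal.ofReal ((r ^ (homDim p + 2))⁻¹) * volume G := by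
  have hdet : LinearMap.det (dil (p := p) r : Space p →ₗ[ℝ] Space p) ≠ 0 := by
    rw [det_dil]; positivity
  have hm : MeasurableSet (place B z₀ r ⁻¹' G) := (continuous_place B z₀ r).measurable hG
  set g : ℝ → ENNReal := fun τ => volume ((fun x : Space p => (x, τ)) ⁻¹' G) with hg
  have hgm : Measurable g := measurable_measure_prodMk_right hG
  have hsec : ∀ t : ℝ, volume ((fun x : Space p => (x, t)) ⁻¹' (place B z₀ r ⁻¹' G)) =
      ENNReal.ofReal ((r ^ homDim p)⁻¹) * g (z₀.2 + r ^ 2 * t) := by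
    intro t
    have e : (fun x : Space p => (x, t)) ⁻¹' (place B z₀ r ⁻¹' G) =
        (dil (p := p) r : Space p →ₗ[ℝ] Space p) ⁻¹'
          ((fun x => x + flowOp B (r ^ 2 * t) z₀.1) ⁻¹'
            ((fun x : Space p => (x, z₀.2 + r ^ 2 * t)) ⁻¹' G)) := rfl
    rw [e, Measure.addHaar_preimage_linearMap volume hdet, det_dil, measure_preimage_add_right,
      abs_of_pos (by positivity)]
  have h1 : ∫⁻ t : ℝ, g (z₀.2 + r ^ 2 * t) = ENNReal.ofReal ((r ^ 2)⁻¹) * ∫⁻ t, g t := by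
    have h2 := Real.map_volume_mul_left (a := r ^ 2) (by positivity)
    have hgm' : Measurable fun t => g (z₀.2 + t) := hgm.comp (measurable_const_add _)
    calc ∫⁻ t : ℝ, g (z₀.2 + r ^ 2 * t)
        = ∫⁻ t, g (z₀.2 + t) ∂(Measure.map (fun t => r ^ 2 * t) volume) :=
          (lintegral_map hgm' (measurable_const_mul _)).symm
      _ = _ := by
        rw [h2, lintegral_smul_measure, lintegral_add_left_eq_self g, abs_of_pos (by positivity)]
        rfl
  rw [Measure.volume_eq_prod, Measure.prod_apply_symm hm, Measure.prod_apply_symm hG]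
  simp only [hsec]
  have hgm2 : Measurable fun t => g (z₀.2 + r ^ 2 * t) := hgm.comp (by fun_prop)
  rw [lintegral_const_mul _ hgm2, h1, ← mul_assoc,
    ← ENNReal.ofReal_mul (by positivity), pow_add, mul_inv]

/-- `u` is, at `z`, a solution for some coefficients that are `ε`-close to `A`. -/
def IsSolAt (B A : Matrix (Coord p) (Coord p) ℝ) (ε : ℝ) (u : SpaceTime p → ℝ)
    (z : SpaceTime p) : Prop :=
  ∃ (m : ℕ) (s : Fin m → Space p), Admissible ε A s ∧ HasLop B s u z 0

theorem IsSolAt.isSuperAt {ε : ℝ} {u : SpaceTime p → ℝ} {z : SpaceTime p}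
    (h : IsSolAt B A ε u z) : IsSuperAt B A ε u z := by
  obtain ⟨m, s, hs, hu⟩ := h
  exact ⟨m, s, 0, hs, le_rfl, hu⟩

theorem IsSolAt.comp_place (hB : IsDrift p B) {r : ℝ} (hr : 0 < r) {ε : ℝ}
    {u : SpaceTime p → ℝ} {z₀ z : SpaceTime p} (h : IsSolAt B A ε u (place B z₀ r z)) :
    IsSolAt B A ε (fun y => u (place B z₀ r y)) z := by
  obtain ⟨m, s, hs, hu⟩ := h
  have := hu.comp_place hB hr hs.zero_of_ne
  rw [mul_zero] at this
  exact ⟨m, s, hs, this⟩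

theorem IsSolAt.const_sub (c : ℝ) {ε : ℝ} {u : SpaceTime p → ℝ} {z : SpaceTime p}
    (h : IsSolAt B A ε u z) : IsSolAt B A ε (fun y => c - u y) z := by
  obtain ⟨m, s, hs, hu⟩ := h
  have := (hasLop_const (B := B) (s := s) (z := z) c).sub hu
  rw [sub_zero] at this
  exact ⟨m, s, hs, this⟩

theorem volume_real_earlyBox_pos : 0 < volume.real (earlyBox p) := by
  refine ENNReal.toReal_pos (ne_of_gt ?_) isCompact_earlyBox.measure_lt_top.ne
  have ho : IsOpen (Metric.ball (0 : Space p) 1 ×ˢ Set.Ioo (-7 : ℝ) (-5)) :=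
    Metric.isOpen_ball.prod isOpen_Ioo
  refine (ho.measure_pos volume ⟨(0, -6), by simp; norm_num⟩).trans_le (measure_mono ?_)
  exact Set.prod_mono Metric.ball_subset_closedBall Set.Ioo_subset_Icc_self

/-- The region in which the largest weighted value of a solution is sought. -/
def pickBox (p : Fin (n + 1) → ℕ) : Set (SpaceTime p) :=
  Metric.closedBall 0 (1 / 2) ×ˢ Set.Icc (-(13 / 2)) (-5)

/-- The weight that vanishes on the parabolic boundary of `pickBox`. -/
noncomputable def pickDist (z : SpaceTime p) : ℝ := min (1 / 2 - ‖z.1‖) (z.2 + 13 / 2)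

theorem continuous_pickDist : Continuous (pickDist (p := p)) := by
  unfold pickDist; fun_prop

theorem pickDist_nonneg {z : SpaceTime p} (hz : z ∈ pickBox p) : 0 ≤ pickDist z :=
  le_min (by linarith [mem_closedBall_zero_iff.1 hz.1]) (by linarith [hz.2.1])

theorem isCompact_pickBox : IsCompact (pickBox p) :=
  (isCompact_closedBall _ _).prod isCompact_Icc

theorem pickBox_subset_earlyBox : pickBox p ⊆ earlyBox p :=
  Set.prod_mono (Metric.closedBall_subset_closedBall (by norm_num))
    (Set.Icc_subset_Icc (by norm_num) le_rfl)

theorem earlyBox_subset_closedCyl {R : ℝ} (hR : 1 ≤ R) : earlyBox p ⊆ closedCyl p R :=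
  Set.prod_mono (Metric.closedBall_subset_closedBall hR)
    (Set.Icc_subset_Icc (by norm_num) (by norm_num))

theorem pickBox_subset_openCyl {R : ℝ} (hR : 1 ≤ R) : pickBox p ⊆ openCyl p R :=
  Set.prod_mono (Metric.closedBall_subset_ball (by linarith))
    (fun _ ht => ⟨by linarith [ht.1], by linarith [ht.2]⟩)

/-- Small cylinders hanging from a point of `pickBox` stay in `pickBox`. -/
theorem place_mem_pickBox {K R : ℝ}
    (hK : ∀ τ : ℝ, |τ| ≤ 8 → ∀ x : Space p, ‖flowOp B τ x - x‖ ≤ K * |τ| * ‖x‖) (hK0 : 0 ≤ K)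
    (hR : 0 ≤ R) {z₁ : SpaceTime p} (hz₁ : z₁ ∈ pickBox p) {ρ : ℝ} (hρ0 : 0 ≤ ρ) (hρ1 : ρ ≤ 1)
    (hρ : (R + 4 * K + 8) * ρ ≤ pickDist z₁) {y : SpaceTime p} (hy : y ∈ closedCyl p R) :
    place B z₁ ρ y ∈ pickBox p ∧
      pickDist z₁ - (R + 4 * K + 8) * ρ ≤ pickDist (place B z₁ ρ y) := by
  have hy1 : ‖y.1‖ ≤ R := mem_closedBall_zero_iff.1 hy.1
  have hx1 : ‖z₁.1‖ ≤ 1 / 2 := mem_closedBall_zero_iff.1 hz₁.1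
  have hρ2 : ρ ^ 2 ≤ ρ := by nlinarith
  have hτ : |ρ ^ 2 * y.2| ≤ 8 * ρ := by
    rw [abs_mul, abs_of_nonneg (sq_nonneg ρ), abs_of_nonpos hy.2.2]
    nlinarith [hy.2.1, hy.2.2, sq_nonneg ρ]
  have h1 : ‖(place B z₁ ρ y).1‖ ≤ ‖z₁.1‖ + (R + 4 * K) * ρ := by
    have e : (place B z₁ ρ y).1 = z₁.1 + (dil ρ y.1 + (flowOp B (ρ ^ 2 * y.2) z₁.1 - z₁.1)) := by
      simp only [place]; abel
    have h2 := norm_dil_le hρ0 hρ1 y.1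
    have h3 := hK (ρ ^ 2 * y.2) (hτ.trans (by linarith)) z₁.1
    have h4 : K * |ρ ^ 2 * y.2| * ‖z₁.1‖ ≤ K * (8 * ρ) * (1 / 2) := by gcongr
    have h5 : ρ * ‖y.1‖ ≤ ρ * R := by gcongr
    rw [e]
    calc _ ≤ ‖z₁.1‖ + (‖dil ρ y.1‖ + ‖flowOp B (ρ ^ 2 * y.2) z₁.1 - z₁.1‖) :=
          (norm_add_le _ _).trans (add_le_add_right (norm_add_le _ _) _)
      _ ≤ _ := by linarith
  have h2 : (place B z₁ ρ y).2 = z₁.2 + ρ ^ 2 * y.2 := rfl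
  have h3 : -(8 * ρ) ≤ ρ ^ 2 * y.2 := (abs_le.1 hτ).1
  have h4 : ρ ^ 2 * y.2 ≤ 0 := mul_nonpos_of_nonneg_of_nonpos (sq_nonneg ρ) hy.2.2
  have h5 : pickDist z₁ ≤ 1 / 2 - ‖z₁.1‖ := min_le_left _ _
  have h6 : pickDist z₁ ≤ z₁.2 + 13 / 2 := min_le_right _ _
  have h7 : 0 ≤ (R + 4 * K) * ρ := by positivity
  refine ⟨⟨mem_closedBall_zero_iff.2 (by linarith), ?_, ?_⟩, le_min ?_ ?_⟩
  · rw [h2]; linarith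
  · rw [h2]; linarith [hz₁.2.2]
  · linarith
  · rw [h2]; linarith

set_option maxHeartbeats 1000000 in
/-- The Harnack inequality at unit scale. -/
theorem exists_unit_harnack (hB : IsDrift p B) {c₁ c₂ ε : ℝ} (hc₁ : 0 < c₁) (hc₂ : 0 < c₂)
    (hε : ε < 1)
    (hS : (1 + ε) * homDim p ≤ 2 * (1 - ε) * ((homDim p : ℝ) / 2 + 1 / 2)) :
    ∃ R C : ℝ, 1 ≤ R ∧ 0 < C ∧ ∀ (A : Matrix (Coord p) (Coord p) ℝ) (M : Space p →L[ℝ] Space p),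
      IsPrecision B A c₁ c₂ M → ∀ u : SpaceTime p → ℝ, ContinuousOn u (closedCyl p R) →
      (∀ z ∈ openCyl p R, IsSolAt B A ε u z) → (∀ z ∈ closedCyl p R, 0 ≤ u z) →
      ∀ z ∈ Metric.closedBall (0 : Space p) (1 / 4) ×ˢ Set.Icc (-6 : ℝ) (-5),
      ∀ z' ∈ lateBox p, u z ≤ C * u z' := by
  obtain ⟨R, c, hR, hc, hgrow⟩ := exists_growth hB hc₁ hc₂ hε hS
  obtain ⟨K, hK1, hK⟩ := exists_flowOp_bound B 8
  have hK' : ∀ τ : ℝ, |τ| ≤ 8 → ∀ x : Space p, ‖flowOp B τ x - x‖ ≤ K * |τ| * ‖x‖ :=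
    fun τ hτ x => (hK τ hτ x).2
  set V := volume.real (earlyBox p) with hV
  have hV0 : 0 < V := volume_real_earlyBox_pos
  set N := homDim p + 2 with hN
  have hN0 : N ≠ 0 := by omega
  have hNpos : (0 : ℝ) < N := by positivity
  -- Growth from half of the early box at level `Mx / 2` gives `c (Mx / 2) (V / 2) = 2 h Mx`, twice
  -- the gap `h Mx` available at the maximum point.
  set h := c * V / 8 with hh
  have hh0 : 0 < h := by positivity
  set L := R + 4 * K + 8 with hL
  have hL0 : 8 ≤ L := by linarith
  -- Moving by a cylinder of size `ρ ≤ κ d` decreases the weight `d` by a factor at least `1 - L κ`.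
  -- By Bernoulli's inequality, `u` can then exceed its value at the maximum point by at most the
  -- factor `1 + h`.
  set κ := h / ((1 + h) * N * L) with hκ
  have hκ0 : 0 < κ := by positivity
  have hκN : N * (L * κ) = h / (1 + h) := by rw [hκ]; field_simp
  have hLκ : L * κ < 1 := by
    have h1 : h / (1 + h) < 1 := by rw [div_lt_one (by positivity)]; linarith
    have h2 : (1 : ℝ) ≤ N := by exact_mod_cast Nat.one_le_iff_ne_zero.2 hN0
    have h3 : 0 < L * κ := by positivity
    nlinarith
  have hBern : 1 ≤ (1 + h) * (1 - L * κ) ^ N := by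
    have h1 := one_add_mul_le_pow (a := -(L * κ)) (by linarith) N
    have h2 : 1 + (N : ℝ) * -(L * κ) = 1 / (1 + h) := by
      rw [mul_neg, hκN]; field_simp; ring
    rw [h2, ← sub_eq_add_neg, div_le_iff₀ (by positivity)] at h1
    linarith
  set C' := 4 / (c * V * κ ^ N) with hC'
  have hC'0 : 0 < C' := by positivity
  refine ⟨R, 4 ^ N * C', hR, by positivity, fun A M hM u huc hsol hu0 => ?_⟩
  have hcyl : earlyBox p ⊆ closedCyl p R := earlyBox_subset_closedCyl hR
  have hpe : pickBox p ⊆ earlyBox p := pickBox_subset_earlyBox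
  -- A positive majorant `m` stands in for `u z'`, which could vanish; it is needed for the scale
  -- `ρ` to be positive.
  have key : ∀ z' ∈ lateBox p, ∀ m : ℝ, 0 < m → u z' ≤ m → ∀ z ∈ pickBox p,
      u z * pickDist z ^ N ≤ C' * m := by
    intro z' hz' m hm hum
    obtain ⟨z₁, hz₁, hmax⟩ := (isCompact_pickBox (p := p)).exists_isMaxOn
      ⟨(0, -6), by simp [pickBox]; norm_num⟩
      (f := fun z => u z * pickDist z ^ N)
      ((huc.mono (hpe.trans hcyl)).mul (continuous_pickDist.pow N).continuousOn)
    rw [isMaxOn_iff] at hmax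
    suffices hz : u z₁ * pickDist z₁ ^ N ≤ C' * m from fun z hz' => (hmax z hz').trans hz
    by_contra! hcon
    set Mx := u z₁ with hMx
    set d := pickDist z₁ with hd
    have hd0 : 0 ≤ d := pickDist_nonneg hz₁
    have hpos : 0 < Mx * d ^ N := lt_of_le_of_lt (by positivity) hcon
    have hdpos : 0 < d := by
      rcases hd0.eq_or_lt with h0 | h0
      · rw [← h0, zero_pow hN0, mul_zero] at hpos; exact absurd hpos (lt_irrefl _)
      · exact h0
    have hMpos : 0 < Mx := pos_of_mul_pos_left hpos (by positivity)
    -- The scale `ρ` with `ρ ^ N = q` is the one at which the growth bound `2 m / (c Mx)` for the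
    -- measure of `{u ≥ Mx / 2}` equals half the volume of the rescaled early box. The assumption to
    -- be refuted says precisely that `ρ` is small compared with `d`.
    set q := 4 * m / (c * Mx * V) with hq
    have hq0 : 0 < q := by positivity
    set ρ := q ^ ((N : ℝ)⁻¹) with hρ
    have hρ0 : 0 < ρ := Real.rpow_pos_of_pos hq0 _
    have hρN : ρ ^ N = q := Real.rpow_inv_natCast_pow hq0.le hN0
    have hρκ : ρ ≤ κ * d := by
      refine le_of_pow_le_pow_left₀ hN0 (by positivity) ?_
      rw [hρN, hq, mul_pow, div_le_iff₀ (by positivity)]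
      rw [hC', div_mul_eq_mul_div, div_lt_iff₀ (by positivity)] at hcon
      linarith
    have hd1 : d ≤ 1 / 2 := (min_le_left _ _).trans (by linarith [norm_nonneg z₁.1])
    have hLρ : L * ρ ≤ L * κ * d := by
      rw [mul_assoc]; exact mul_le_mul_of_nonneg_left hρκ (by linarith)
    have hLρd : L * ρ ≤ d := hLρ.trans (mul_le_of_le_one_left hd0 hLκ.le)
    have hρ1 : ρ ≤ 1 := by nlinarith
    have hplace : ∀ y ∈ closedCyl p R, place B z₁ ρ y ∈ pickBox p ∧
        d - L * ρ ≤ pickDist (place B z₁ ρ y) := fun y hy =>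
      place_mem_pickBox hK' (by linarith) (by linarith) hz₁ hρ0.le hρ1 hLρd hy
    have hubd : ∀ y ∈ closedCyl p R, u (place B z₁ ρ y) ≤ (1 + h) * Mx := by
      intro y hy
      obtain ⟨h1, h2⟩ := hplace y hy
      have h3 := hmax _ h1
      have hu := hu0 _ (hcyl (hpe h1))
      have h4 : d * (1 - L * κ) ≤ pickDist (place B z₁ ρ y) := by linarith
      have h5 : (d * (1 - L * κ)) ^ N ≤ pickDist (place B z₁ ρ y) ^ N :=
        pow_le_pow_left₀ (mul_nonneg hd0 (by linarith)) h4 N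
      have h6 : u (place B z₁ ρ y) * (d * (1 - L * κ)) ^ N ≤ Mx * d ^ N :=
        (mul_le_mul_of_nonneg_left h5 hu).trans h3
      rw [mul_pow] at h6
      have hdN : 0 < d ^ N := by positivity
      have h7 : u (place B z₁ ρ y) * (1 - L * κ) ^ N ≤ Mx := by
        refine le_of_mul_le_mul_right ?_ hdN
        linarith
      calc u (place B z₁ ρ y) ≤ u (place B z₁ ρ y) * ((1 + h) * (1 - L * κ) ^ N) :=
            le_mul_of_one_le_right hu hBern
        _ = (1 + h) * (u (place B z₁ ρ y) * (1 - L * κ) ^ N) := by ring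
        _ ≤ _ := by gcongr
    have hpc : ContinuousOn (fun y => u (place B z₁ ρ y)) (closedCyl p R) :=
      huc.comp (continuous_place B z₁ ρ).continuousOn fun y hy => hcyl (hpe (hplace y hy).1)
    -- the set where `u` is large has small measure
    set G := earlyBox p ∩ u ⁻¹' Set.Ici (Mx / 2) with hG
    have hGc : IsCompact G := isCompact_earlyBox.of_isClosed_subset
      ((huc.mono hcyl).preimage_isClosed_of_isClosed isCompact_earlyBox.isClosed isClosed_Ici)
      Set.inter_subset_left
    have hGm := hgrow A M hM u huc (fun z hz => (hsol z hz).isSuperAt) hu0 G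
      Set.inter_subset_left hGc (Mx / 2) (by positivity) (fun z hz => hz.2) z' hz'
    set E := earlyBox p ∩ (fun y => u (place B z₁ ρ y)) ⁻¹' Set.Iic (Mx / 2) with hE
    have hEc : IsCompact E := isCompact_earlyBox.of_isClosed_subset
      ((hpc.mono hcyl).preimage_isClosed_of_isClosed isCompact_earlyBox.isClosed isClosed_Iic)
      Set.inter_subset_left
    have hvolG : volume.real (place B z₁ ρ ⁻¹' G) = q⁻¹ * volume.real G := by
      rw [measureReal_def, volume_preimage_place hρ0 z₁ hGc.measurableSet, ENNReal.toReal_mul,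
        ENNReal.toReal_ofReal (by positivity), ← hN, hρN, measureReal_def]
    have hcover : earlyBox p ⊆ E ∪ place B z₁ ρ ⁻¹' G := by
      intro y hy
      rcases le_total (u (place B z₁ ρ y)) (Mx / 2) with h1 | h1
      · exact Or.inl ⟨hy, h1⟩
      · exact Or.inr ⟨hpe (hplace y (hcyl hy)).1, h1⟩
    have hfin : volume (place B z₁ ρ ⁻¹' G) ≠ ⊤ := by
      rw [volume_preimage_place hρ0 z₁ hGc.measurableSet]
      exact ENNReal.mul_ne_top ENNReal.ofReal_ne_top hGc.measure_lt_top.ne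
    have hVE : V ≤ volume.real E + volume.real (place B z₁ ρ ⁻¹' G) :=
      (measureReal_mono hcover (measure_union_ne_top hEc.measure_lt_top.ne hfin)).trans
        (measureReal_union_le _ _)
    have hhalf : V / 2 ≤ volume.real E := by
      have h1 : volume.real (place B z₁ ρ ⁻¹' G) ≤ V / 2 := by
        rw [hvolG, inv_mul_le_iff₀ hq0, hq]
        have h2 : c * (Mx / 2) * volume.real G ≤ m := hGm.trans hum
        have h3 : 4 * m / (c * Mx * V) * (V / 2) = m / (c * (Mx / 2)) := by field_simp; ring
        rw [h3, le_div_iff₀ (by positivity)]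
        linarith
      linarith
    -- The growth lemma at the vertex of the small cylinder, where `(1 + h) Mx - u` equals only `h
    -- Mx`.
    have hfinal := hgrow A M hM (fun y => (1 + h) * Mx - u (place B z₁ ρ y))
      (continuousOn_const.sub hpc)
      (fun y hy => ((IsSolAt.comp_place hB hρ0 (hsol _ (pickBox_subset_openCyl hR
        (hplace y ⟨Metric.ball_subset_closedBall hy.1, hy.2.1.le, hy.2.2.le⟩).1))).const_sub
          _).isSuperAt)
      (fun y hy => sub_nonneg.2 (hubd y hy)) E Set.inter_subset_left hEc (Mx / 2) (by positivity)
      (fun y hy => by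
        have h1 : u (place B z₁ ρ y) ≤ Mx / 2 := hy.2
        nlinarith) (0, 0) (by simp [lateBox])
    have hz0 : place B z₁ ρ (0, 0) = z₁ := by simp [place]
    rw [hz0, ← hMx] at hfinal
    have h1 : c * (Mx / 2) * (V / 2) ≤ c * (Mx / 2) * volume.real E := by gcongr
    have h2 : c * (Mx / 2) * (V / 2) = 2 * (h * Mx) := by rw [hh]; ring
    have h3 : 0 < h * Mx := by positivity
    linarith
  intro z hz z' hz'
  have hzp : z ∈ pickBox p := ⟨Metric.closedBall_subset_closedBall (by norm_num) hz.1,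
    by linarith [hz.2.1], hz.2.2⟩
  have hu'0 : 0 ≤ u z' := hu0 z' (Set.prod_mono (Metric.closedBall_subset_closedBall hR)
    (Set.Icc_subset_Icc (by norm_num) le_rfl) hz')
  have hdz : 1 / 4 ≤ pickDist z :=
    le_min (by linarith [mem_closedBall_zero_iff.1 hz.1]) (by linarith [hz.2.1])
  have huz := hu0 z (hcyl (hpe hzp))
  have hle : ∀ m : ℝ, 0 < m → u z' ≤ m → u z ≤ 4 ^ N * C' * m := by
    intro m hm hum
    have h1 := key z' hz' m hm hum z hzp
    have h2 : u z * (1 / 4) ^ N ≤ u z * pickDist z ^ N := by gcongr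
    have h3 : u z = 4 ^ N * (u z * (1 / 4) ^ N) := by
      rw [mul_comm (u z), ← mul_assoc, ← mul_pow]; norm_num
    rw [h3, mul_assoc]
    exact mul_le_mul_of_nonneg_left (h2.trans h1) (by positivity)
  -- Letting the majorant decrease to `u z'` covers the case `u z' = 0`.
  refine le_of_forall_pos_le_add fun δ hδ => ?_
  have hpos : 0 < 4 ^ N * C' := by positivity
  have := hle (u z' + δ / (4 ^ N * C')) (by positivity) (by linarith [show 0 < δ / (4 ^ N * C') by positivity])
  refine this.trans (le_of_eq ?_)
  rw [mul_add, mul_div_cancel₀ _ hpos.ne']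

end UnitHarnack

end Kolmogorov

namespace Kolmogorov

open Filter Topology MeasureTheory
open scoped Matrix

/-! ### Homogeneous norm, Euclidean norm and cylinders -/

section Geometry

variable {n : ℕ} {p : Fin (n + 1) → ℕ} {B : Matrix (Coord p) (Coord p) ℝ}

theorem norm_sq_eq_sum_block (x : Space p) : ‖x‖ ^ 2 = ∑ i, ‖block i x‖ ^ 2 := by
  simp only [EuclideanSpace.norm_sq_eq, block]
  exact Fintype.sum_sigma fun k : Coord p => ‖x k‖ ^ 2

theorem norm_block_le (i : Fin (n + 1)) (x : Space p) : ‖block i x‖ ≤ ‖x‖ := by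
  refine le_of_sq_le_sq ?_ (norm_nonneg _)
  rw [norm_sq_eq_sum_block]
  exact Finset.single_le_sum (f := fun i => ‖block i x‖ ^ 2) (fun i _ => sq_nonneg _)
    (Finset.mem_univ i)

theorem block_dil (r : ℝ) (i : Fin (n + 1)) (x : Space p) :
    block i (dil r x) = r ^ (2 * (i : ℕ) + 1) • block i x := by
  ext j
  simp [block, weight]

theorem rpow_inv_weight {r : ℝ} (hr : 0 ≤ r) (i : ℕ) :
    (r ^ (2 * i + 1)) ^ (1 / (2 * (i : ℝ) + 1)) = r := by
  have h := Real.pow_rpow_inv_natCast hr (n := 2 * i + 1) (by omega)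
  push_cast at h
  rwa [one_div]

theorem homNorm_dil {r : ℝ} (hr : 0 ≤ r) (x : Space p) : homNorm (dil r x) = r * homNorm x := by
  simp only [homNorm, Finset.mul_sum]
  refine Finset.sum_congr rfl fun i _ => ?_
  rw [block_dil, norm_smul, Real.norm_of_nonneg (by positivity),
    Real.mul_rpow (by positivity) (norm_nonneg _), rpow_inv_weight hr]

theorem homNorm_le_of_norm_le {R : ℝ} (hR : 1 ≤ R) {x : Space p} (hx : ‖x‖ ≤ R) :
    homNorm x ≤ (n + 1) * R := by
  have h : ∀ i : Fin (n + 1), ‖block i x‖ ^ (1 / (2 * (i : ℝ) + 1)) ≤ R := fun i => by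
    calc _ ≤ R ^ (1 / (2 * ((i : ℕ) : ℝ) + 1)) :=
          Real.rpow_le_rpow (norm_nonneg _) ((norm_block_le i x).trans hx) (by positivity)
      _ ≤ R ^ (1 : ℝ) := Real.rpow_le_rpow_of_exponent_le hR (by
          rw [div_le_one (by positivity)]
          have : (0 : ℝ) ≤ (i : ℕ) := by positivity
          linarith)
      _ = R := Real.rpow_one R
  calc homNorm x ≤ ∑ _i : Fin (n + 1), R := Finset.sum_le_sum fun i _ => h i
    _ = (n + 1) * R := by simp

/-- Each block has norm at most `σ ^ (2 i + 1) ≤ σ`, since `σ ≤ 1`; summing the squares gives at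
most `(n + 1) σ ^ 2 = σ / 4`. -/
theorem norm_le_of_homNorm_lt {x : Space p} (hx : homNorm x < 1 / (4 * ((n : ℝ) + 1))) :
    ‖x‖ ≤ 1 / 4 := by
  set σ := 1 / (4 * ((n : ℝ) + 1)) with hσ
  have hσ0 : 0 < σ := by positivity
  have hσ1 : σ ≤ 1 := by
    rw [hσ, div_le_one (by positivity)]
    have : (0 : ℝ) ≤ n := by positivity
    linarith
  have h : ∀ i : Fin (n + 1), ‖block i x‖ ≤ σ := fun i => by
    have h1 : ‖block i x‖ ^ (1 / (2 * (i : ℝ) + 1)) ≤ σ := by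
      refine le_trans ?_ hx.le
      exact Finset.single_le_sum (f := fun i : Fin (n + 1) => ‖block i x‖ ^ (1 / (2 * (i : ℝ) + 1)))
        (fun i _ => Real.rpow_nonneg (norm_nonneg _) _) (Finset.mem_univ i)
    have h2 : ‖block i x‖ ≤ σ ^ (2 * (i : ℕ) + 1) := by
      have h3 := Real.rpow_inv_natCast_pow (norm_nonneg (block i x)) (n := 2 * (i : ℕ) + 1) (by omega)
      rw [← h3]
      refine pow_le_pow_left₀ (Real.rpow_nonneg (norm_nonneg _) _) ?_ _
      push_cast
      rwa [← one_div]
    exact h2.trans (pow_le_of_le_one hσ0.le hσ1 (by omega))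
  refine le_of_sq_le_sq ?_ (by norm_num)
  rw [norm_sq_eq_sum_block]
  calc ∑ i, ‖block i x‖ ^ 2 ≤ ∑ _i : Fin (n + 1), σ ^ 2 :=
        Finset.sum_le_sum fun i _ => pow_le_pow_left₀ (norm_nonneg _) (h i) 2
    _ = ((n : ℝ) + 1) * σ ^ 2 := by simp
    _ ≤ (1 / 4) ^ 2 := by
        have : ((n : ℝ) + 1) * σ = 1 / 4 := by rw [hσ]; field_simp
        nlinarith

/-- Cylinders of all sizes are images of a fixed unit cylinder, as the homogeneous norm scales like
`ρ` and time like `ρ ^ 2`. -/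
theorem mem_cylinder_iff {ρ a t₁ t₂ : ℝ} (hρ : 0 < ρ) {z₀ z : SpaceTime p} :
    z ∈ cylinder B (a * ρ) (t₁ * ρ ^ 2) (t₂ * ρ ^ 2) z₀ ↔
      ∃ y : SpaceTime p, homNorm y.1 < a ∧ y.2 ∈ Set.Ioo t₁ t₂ ∧ place B z₀ ρ y = z := by
  have hρ2 : 0 < ρ ^ 2 := by positivity
  constructor
  · rintro ⟨ζ, ⟨h1, h2, h3⟩, rfl⟩
    refine ⟨(dil ρ⁻¹ ζ.1, ζ.2 / ρ ^ 2), ?_, ⟨?_, ?_⟩, ?_⟩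
    · rw [homNorm_dil (by positivity), inv_mul_lt_iff₀ hρ, mul_comm]; exact h1
    · rw [lt_div_iff₀ hρ2]; exact h2
    · rw [div_lt_iff₀ hρ2]; exact h3
    · rw [place_eq_comp, dil_dil_inv hρ.ne', mul_div_cancel₀ _ hρ2.ne']
  · rintro ⟨y, h1, ⟨h2, h3⟩, rfl⟩
    refine ⟨(dil ρ y.1, ρ ^ 2 * y.2), ⟨?_, ?_, ?_⟩, (place_eq_comp _ _ _).symm⟩
    · change homNorm (dil ρ y.1) < a * ρ
      rw [homNorm_dil hρ.le, mul_comm]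
      exact mul_lt_mul_of_pos_right h1 hρ
    · change t₁ * ρ ^ 2 < ρ ^ 2 * y.2
      rw [mul_comm]
      exact mul_lt_mul_of_pos_left h2 hρ2
    · change ρ ^ 2 * y.2 < t₂ * ρ ^ 2
      rw [mul_comm t₂]
      exact mul_lt_mul_of_pos_left h3 hρ2

end Geometry

/-! ### From coefficients with a modulus of continuity to frozen ones -/

section Coefficients

variable {n : ℕ} {p : Fin (n + 1) → ℕ} {B : Matrix (Coord p) (Coord p) ℝ}

theorem headSq_eq (v : Space p) : headSq v = ‖block 0 v‖ ^ 2 := by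
  rw [headSq, EuclideanSpace.norm_sq_eq, ← Finset.univ_sigma_univ, Finset.sum_sigma,
    Finset.sum_eq_single 0]
  · simp [block]
  · intro i _ hi
    simp [hi]
  · simp

theorem inner_op_of_leading {A : Matrix (Coord p) (Coord p) ℝ}
    (hA : ∀ k l : Coord p, k.1 ≠ 0 ∨ l.1 ≠ 0 → A k l = 0) (v : Space p) :
    inner ℝ v (op A v) =
      inner ℝ (block 0 v) (Matrix.toEuclideanCLM (𝕜 := ℝ) (leadingBlock A) (block 0 v)) := by
  rw [Matrix.inner_toEuclideanCLM, inner_op_eq_sum, ← Finset.univ_sigma_univ, Finset.sum_sigma,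
    Finset.sum_eq_single 0]
  · simp only [dotProduct, Matrix.mulVec]
    refine Finset.sum_congr rfl fun a _ => ?_
    rw [Finset.sum_sigma, Finset.sum_eq_single 0]
    · rw [Finset.mul_sum]
      rfl
    · intro i _ hi
      refine Finset.sum_eq_zero fun b _ => ?_
      rw [hA _ _ (Or.inr hi)]; ring
    · simp
  · intro i _ hi
    refine Finset.sum_eq_zero fun a _ => Finset.sum_eq_zero fun l _ => ?_
    rw [hA _ _ (Or.inl hi)]; ring
  · simp

variable {lam Lam : ℝ} {Ω : Set (SpaceTime p)} {A : SpaceTime p → Matrix (Coord p) (Coord p) ℝ}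

theorem IsCoeff.isLeading (hA : IsCoeff lam Lam Ω A) {z : SpaceTime p} (hz : z ∈ Ω) :
    IsLeading (A z) :=
  ⟨hA.isSymm z hz, hA.zero_of_ne z hz⟩

theorem IsCoeff.mul_headSq_le (hA : IsCoeff lam Lam Ω A) {z : SpaceTime p} (hz : z ∈ Ω)
    (v : Space p) : lam * headSq v ≤ inner ℝ v (op (A z) v) := by
  rw [inner_op_of_leading (hA.zero_of_ne z hz), headSq_eq]
  have h := (hA.lower z hz).dotProduct_mulVec_nonneg (block 0 v).ofLp
  rw [star_trivial, ← Matrix.inner_toEuclideanCLM] at h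
  simp only [map_sub, map_smul, map_one, _root_.sub_apply, _root_.smul_apply,
    inner_sub_right, inner_smul_right] at h
  have e : inner ℝ (block 0 v) ((1 : EuclideanSpace ℝ (Fin (p 0)) →L[ℝ] _) (block 0 v)) =
      ‖block 0 v‖ ^ 2 := real_inner_self_eq_norm_sq _
  rw [e] at h
  linarith

theorem IsCoeff.le_mul_headSq (hA : IsCoeff lam Lam Ω A) {z : SpaceTime p} (hz : z ∈ Ω)
    (v : Space p) : inner ℝ v (op (A z) v) ≤ Lam * headSq v := by
  rw [inner_op_of_leading (hA.zero_of_ne z hz), headSq_eq]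
  have h := (hA.upper z hz).dotProduct_mulVec_nonneg (block 0 v).ofLp
  rw [star_trivial, ← Matrix.inner_toEuclideanCLM] at h
  simp only [map_sub, map_smul, map_one, _root_.sub_apply, _root_.smul_apply,
    inner_sub_right, inner_smul_right] at h
  have e : inner ℝ (block 0 v) ((1 : EuclideanSpace ℝ (Fin (p 0)) →L[ℝ] _) (block 0 v)) =
      ‖block 0 v‖ ^ 2 := real_inner_self_eq_norm_sq _
  rw [e] at h
  linarith

theorem inner_op_eq_sum_sq {M : Matrix (Coord p) (Coord p) ℝ} {m : ℕ} {s : Fin m → Space p}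
    (hM : ∀ k l, M k l = ∑ i, s i k * s i l) (v : Space p) :
    inner ℝ v (op M v) = ∑ i, inner ℝ (s i) v ^ 2 := by
  have h : ∀ i, inner ℝ (s i) v ^ 2 = ∑ k, ∑ l, v k * (s i k * s i l * v l) := fun i => by
    rw [inner_eq_sum, sq, Finset.sum_mul_sum]
    exact Finset.sum_congr rfl fun k _ => Finset.sum_congr rfl fun l _ => by ring
  simp only [h, inner_op_eq_sum, hM, Finset.sum_mul, Finset.mul_sum]
  rw [Finset.sum_comm (s := (Finset.univ : Finset (Fin m)))]
  refine Finset.sum_congr rfl fun k _ => ?_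
  rw [Finset.sum_comm]

/-- A solution for coefficients close to `A₀` is a solution in the sense of `IsSolAt`. -/
theorem isSolAt_of_operator_eq_zero {A₀ : Matrix (Coord p) (Coord p) ℝ} {ε : ℝ}
    {u : SpaceTime p → ℝ} {z : SpaceTime p} (hlead : IsLeading (A z))
    (hpos : ∀ v, 0 ≤ inner ℝ v (op (A z) v))
    (hlow : ∀ v, (1 - ε) * inner ℝ v (op A₀ v) ≤ inner ℝ v (op (A z) v))
    (hupp : ∀ v, inner ℝ v (op (A z) v) ≤ (1 + ε) * inner ℝ v (op A₀ v))
    (hu : ContDiffAt ℝ 2 u z) (h0 : operator B A u z = 0) : IsSolAt B A₀ ε u z := by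
  have hpsd : (A z).PosSemidef := by
    refine Matrix.PosSemidef.of_dotProduct_mulVec_nonneg (by
      simpa [Matrix.IsHermitian, Matrix.conjTranspose_eq_transpose_of_trivial]
        using hlead.isSymm.eq) fun x => ?_
    have := hpos (WithLp.toLp 2 x)
    rwa [op, Matrix.inner_toEuclideanCLM] at this
  -- The decomposition into rank-one squares is chosen at the single point `z`; no regularity in `z`
  -- is required.
  obtain ⟨m, w, hw⟩ := Matrix.posSemidef_iff_eq_sum_vecMulVec.1 hpsd
  set s : Fin m → Space p := fun i => WithLp.toLp 2 (w i) with hs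
  have hA : ∀ k l, A z k l = ∑ i, s i k * s i l := fun k l => by
    rw [hw]
    simp [Matrix.sum_apply, Matrix.vecMulVec_apply, hs]
  refine ⟨m, s, ⟨fun i k hk => ?_, fun v => ?_, fun v => ?_⟩, ?_⟩
  -- A diagonal entry outside of the leading block is a vanishing sum of squares.
  · have h1 := hA k k
    rw [hlead.zero_of_ne k k (Or.inl hk)] at h1
    have h2 := (Finset.sum_eq_zero_iff_of_nonneg fun i _ => mul_self_nonneg (s i k)).1 h1.symm i
      (Finset.mem_univ i)
    exact mul_self_eq_zero.1 h2
  · rw [← inner_op_eq_sum_sq hA]; exact hlow v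
  · rw [← inner_op_eq_sum_sq hA]; exact hupp v
  · have := hasLop_operator (B := B) (s := s) hu hA
    rwa [h0] at this

/-- Turns the bound in operator norm into closeness of quadratic forms; ellipticity of `A₀` then
makes it a relative bound. -/
theorem abs_inner_op_sub_le {A₀ A₁ : Matrix (Coord p) (Coord p) ℝ} (h₀ : IsLeading A₀)
    (h₁ : IsLeading A₁) {δ : ℝ}
    (h : ‖Matrix.toEuclideanCLM (n := Fin (p 0)) (𝕜 := ℝ) (leadingBlock A₁ - leadingBlock A₀)‖ ≤ δ)
    (v : Space p) : |inner ℝ v (op A₁ v) - inner ℝ v (op A₀ v)| ≤ δ * headSq v := by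
  rw [inner_op_of_leading h₀.zero_of_ne, inner_op_of_leading h₁.zero_of_ne, ← inner_sub_right,
    ← _root_.sub_apply, ← map_sub, headSq_eq]
  refine (abs_real_inner_le_norm _ _).trans ?_
  have h2 := (Matrix.toEuclideanCLM (n := Fin (p 0)) (𝕜 := ℝ)
    (leadingBlock A₁ - leadingBlock A₀)).le_of_opNorm_le h (block 0 v)
  calc _ ≤ ‖block 0 v‖ * (δ * ‖block 0 v‖) := by gcongr
    _ = _ := by ring

end Coefficients

/-! ### Harnack inequality on small cylinders and the conclusion -/

section Harnack

variable {n : ℕ} {p : Fin (n + 1) → ℕ} {B : Matrix (Coord p) (Coord p) ℝ}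

/-- Pointwise Harnack inequality on small cylinders `z₀ ∘ δ_ρ(⋅)`, in unit coordinates. -/
theorem exists_harnack_of_modulus (hB : IsDrift p B) {lam Lam : ℝ} (hlam : 0 < lam)
    (hLam : 0 < Lam) {ω : ℝ → ℝ} (hω : IsModulus ω) :
    ∃ K κ C : ℝ, 1 ≤ K ∧ 0 < κ ∧ 0 < C ∧ ∀ Ω : Set (SpaceTime p), IsOpen Ω →
      ∀ A : SpaceTime p → Matrix (Coord p) (Coord p) ℝ,
      IsCoeff lam Lam Ω A → HasModulus B ω Ω A → ∀ (z₀ : SpaceTime p) (ρ : ℝ), 0 < ρ → ρ ≤ κ →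
      ∀ S : Set (SpaceTime p), S = cylinder B (K * ρ) (-8 * ρ ^ 2) (0 * ρ ^ 2) z₀ →
      closure S ⊆ Ω → ∀ u : SpaceTime p → ℝ, ContDiffOn ℝ 2 u Ω →
      (∀ z ∈ S, 0 ≤ u z ∧ operator B A u z = 0) →
      (∀ y' ∈ lateBox p, 0 ≤ u (place B z₀ ρ y')) ∧
      ∀ y ∈ Metric.closedBall (0 : Space p) (1 / 4) ×ˢ Set.Icc (-6 : ℝ) (-5),
      ∀ y' ∈ lateBox p, u (place B z₀ ρ y) ≤ C * u (place B z₀ ρ y') := by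
  set Q : ℝ := (homDim p : ℝ) with hQ
  have hQ0 : 0 ≤ Q := Nat.cast_nonneg _
  -- Small enough for `(1 + ε) Q ≤ (1 - ε) (Q + 1)`, the condition for the barrier exponent `Q/2 +
  -- 1/2`.
  set ε : ℝ := 1 / (2 * Q + 2) with hε
  have hε0 : 0 < ε := by positivity
  have hε1 : ε < 1 := by rw [hε, div_lt_one (by positivity)]; linarith
  have hεQ : ε * (2 * Q + 2) = 1 := by rw [hε]; field_simp
  obtain ⟨c₁, c₂, hc₁, hc₂, hprec⟩ := exists_isPrecision hB hlam hLam
  obtain ⟨R, C, hR, hC, hharnack⟩ := exists_unit_harnack hB hc₁ hc₂ hε1 (by nlinarith)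
  obtain ⟨e, he0, he1, heω⟩ : ∃ e : ℝ, 0 < e ∧ e < 1 ∧ ω e ≤ ε * lam := by
    have h1 := hω.tendsto.eventually (gt_mem_nhds (show (0 : ℝ) < ε * lam by positivity))
    obtain ⟨e, h2, h3⟩ := (h1.and (Ioo_mem_nhdsGT (zero_lt_one (α := ℝ)))).exists
    exact ⟨e, h3.1, h3.2, h2.le⟩
  -- The Euclidean ball of radius `R` has homogeneous norm at most `(n + 1) R`; the extra `R` gives
  -- a strict inequality on the closed ball.
  set K : ℝ := (n + 2) * R with hK
  have hn0 : (0 : ℝ) ≤ n := Nat.cast_nonneg _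
  have hK1 : 1 ≤ K := by nlinarith
  -- The bound on `ρ` gives `K ρ < e` in space and `8 ρ ^ 2 < (3 ρ) ^ 2 ≤ e ^ 2` in time, so the
  -- whole cylinder lies where `A` is within `ε lam` of `A z₀`.
  refine ⟨K, e / (K + 3), C, hK1, by positivity, hC, ?_⟩
  intro Ω hΩ A hA hmod z₀ ρ hρ hρκ S hS hSΩ u hu huS
  have hρe : ρ * (K + 3) ≤ e := by rwa [le_div_iff₀ (by positivity)] at hρκ
  have hmemS : ∀ y : SpaceTime p, homNorm y.1 < K → y.2 ∈ Set.Ioo (-8 : ℝ) 0 →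
      place B z₀ ρ y ∈ S := fun y h1 h2 => by
    rw [hS, mem_cylinder_iff hρ]
    exact ⟨y, h1, h2, rfl⟩
  have hnK : ∀ x : Space p, ‖x‖ ≤ R → homNorm x < K := fun x hx =>
    (homNorm_le_of_norm_le hR hx).trans_lt (by nlinarith)
  have hclos : ∀ y ∈ closedCyl p R, place B z₀ ρ y ∈ closure S := by
    intro y hy
    have h1 : y ∈ closure ({x : Space p | homNorm x < K} ×ˢ Set.Ioo (-8 : ℝ) 0) := by
      rw [closure_prod_eq, closure_Ioo (by norm_num)]
      exact ⟨subset_closure (hnK y.1 (mem_closedBall_zero_iff.1 hy.1)), hy.2⟩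
    refine closure_mono ?_ (image_closure_subset_closure_image (continuous_place B z₀ ρ)
      ⟨y, h1, rfl⟩)
    rintro _ ⟨y', hy', rfl⟩
    exact hmemS y' hy'.1 hy'.2
  -- The vertex lies on the top of the cylinder, hence only in its closure; compact containment is
  -- what allows freezing the coefficients there.
  have hz₀ : z₀ ∈ Ω := by
    have := hclos (0, 0) ⟨by simp; linarith, by norm_num⟩
    have e0 : place B z₀ ρ (0, 0) = z₀ := by simp [place]
    rw [e0] at this
    exact hSΩ this
  have hlead₀ := hA.isLeading hz₀
  obtain ⟨M, hM⟩ := hprec (A z₀) hlead₀ (hA.mul_headSq_le hz₀) (hA.le_mul_headSq hz₀)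
  have hsol : ∀ y ∈ openCyl p R, IsSolAt B (A z₀) ε u (place B z₀ ρ y) := by
    intro y hy
    have hyK := hnK y.1 (mem_ball_zero_iff.1 hy.1).le
    have hzS := hmemS y hyK hy.2
    have hzΩ : place B z₀ ρ y ∈ Ω := hSΩ (subset_closure hzS)
    have hcyl : place B z₀ ρ y ∈ cylinder B e (-e ^ 2) (e ^ 2) z₀ := by
      refine ⟨(dil ρ y.1, ρ ^ 2 * y.2), ⟨?_, ?_, ?_⟩, (place_eq_comp _ _ _).symm⟩
      · change homNorm (dil ρ y.1) < e
        rw [homNorm_dil hρ.le]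
        nlinarith
      · have h1 := hy.2.1
        have h2 : (ρ * 3) ^ 2 ≤ e ^ 2 := pow_le_pow_left₀ (by positivity) (by nlinarith) 2
        have h3 : 0 < ρ ^ 2 := by positivity
        change -e ^ 2 < ρ ^ 2 * y.2
        nlinarith
      · have h1 : ρ ^ 2 * y.2 < 0 := mul_neg_of_pos_of_neg (by positivity) hy.2.2
        exact h1.trans (by positivity)
    have hdiff := abs_inner_op_sub_le hlead₀ (hA.isLeading hzΩ)
      ((hmod e he0 he1 z₀ hz₀ _ ⟨hzΩ, hcyl⟩).trans heω)
    have hsmall : ∀ v, ε * lam * headSq v ≤ ε * inner ℝ v (op (A z₀) v) := fun v => by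
      rw [mul_assoc]
      exact mul_le_mul_of_nonneg_left (hA.mul_headSq_le hz₀ v) hε0.le
    refine isSolAt_of_operator_eq_zero (hA.isLeading hzΩ)
      (fun v => (mul_nonneg hlam.le (headSq_nonneg v)).trans (hA.mul_headSq_le hzΩ v))
      (fun v => ?_) (fun v => ?_) ((hu _ hzΩ).contDiffAt (hΩ.mem_nhds hzΩ)) (huS _ hzS).2
    · have h1 := (abs_le.1 (hdiff v)).1
      have h2 := hsmall v
      linarith
    · have h1 := (abs_le.1 (hdiff v)).2
      have h2 := hsmall v
      linarith
  have hpos : ∀ y ∈ closedCyl p R, 0 ≤ u (place B z₀ ρ y) := fun y hy =>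
    ContinuousWithinAt.closure_le (hclos y hy) continuousWithinAt_const
      ((hu.continuousOn _ (hSΩ (hclos y hy))).mono (subset_closure.trans hSΩ))
      fun z hz => (huS z hz).1
  have hlate : lateBox p ⊆ closedCyl p R :=
    Set.prod_mono (Metric.closedBall_subset_closedBall hR) (Set.Icc_subset_Icc (by norm_num) le_rfl)
  exact ⟨fun y hy => hpos y (hlate hy), hharnack (A z₀) M hM (fun y => u (place B z₀ ρ y))
    (hu.continuousOn.comp (continuous_place B z₀ ρ).continuousOn fun y hy => hSΩ (hclos y hy))
    (fun y hy => (hsol y hy).comp_place hB hρ) hpos⟩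

end Harnack

end Kolmogorov

theorem theorem1p2 {n : ℕ} (p : Fin (n + 1) → ℕ)
    (B : Matrix (Kolmogorov.Coord p) (Kolmogorov.Coord p) ℝ) (hB : Kolmogorov.IsDrift p B)
    (lam Lam : ℝ) (hlam : 0 < lam) (hLam : 0 < Lam)
    (ω : ℝ → ℝ) (hω : Kolmogorov.IsModulus ω) :
    ∃ b K σ C : ℝ, 0 < b ∧ 0 < K ∧ 0 < σ ∧ 0 < C ∧ σ < K ∧
      ∀ (Ω : Set (Kolmogorov.SpaceTime p)), IsOpen Ω →
      ∀ (A : Kolmogorov.SpaceTime p →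
          Matrix (Kolmogorov.Coord p) (Kolmogorov.Coord p) ℝ),
        Kolmogorov.IsCoeff lam Lam Ω A → Kolmogorov.HasModulus B ω Ω A →
      ∀ (z₀ : Kolmogorov.SpaceTime p) (r : ℝ), 0 < r → r ≤ 1 →
        Kolmogorov.CompactlyContained
          (Kolmogorov.cylinder B (K * r) (-b * r ^ 2) 0 z₀) Ω →
      ∀ u : Kolmogorov.SpaceTime p → ℝ, ContDiffOn ℝ 2 u Ω →
        (∀ z ∈ Kolmogorov.cylinder B (K * r) (-b * r ^ 2) 0 z₀,
          0 ≤ u z ∧ Kolmogorov.operator B A u z = 0) →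
        BddAbove (u '' Kolmogorov.cylinder B (σ * r)
            (-(3 * b / 4) * r ^ 2) (-(5 * b / 8) * r ^ 2) z₀) ∧
        BddBelow (u '' Kolmogorov.cylinder B (σ * r) (-(b / 8) * r ^ 2) 0 z₀) ∧
        sSup (u '' Kolmogorov.cylinder B (σ * r)
            (-(3 * b / 4) * r ^ 2) (-(5 * b / 8) * r ^ 2) z₀)
          ≤ C * sInf (u '' Kolmogorov.cylinder B (σ * r) (-(b / 8) * r ^ 2) 0 z₀) := by
  obtain ⟨K, κ, C, hK, hκ, hC, h⟩ := Kolmogorov.exists_harnack_of_modulus hB hlam hLam hω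
  have hn0 : (0 : ℝ) ≤ n := Nat.cast_nonneg _
  have hσ1 : 1 / (4 * ((n : ℝ) + 1)) < 1 := by
    rw [div_lt_one (by positivity)]; linarith
  -- The unit-scale times `-8`, `-6`, `-5`, `-1` are `-b`, `-3b/4`, `-5b/8`, `-b/8` times `r ^ 2`
  -- for `ρ = κ r` and `b = 8 κ ^ 2`. The condition `r ≤ 1` gives `ρ ≤ κ`, and `1 / (4 (n + 1))`
  -- keeps the space variable in the Euclidean ball of radius `1 / 4`.
  refine ⟨8 * κ ^ 2, K * κ, 1 / (4 * ((n : ℝ) + 1)) * κ, C, by positivity, by positivity,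
    by positivity, hC, mul_lt_mul_of_pos_right (hσ1.trans_le hK) hκ, ?_⟩
  intro Ω hΩ A hA hmod z₀ r hr hr1 hcomp u hu huS
  set σ := 1 / (4 * ((n : ℝ) + 1)) with hσ
  have hσ0 : 0 < σ := by positivity
  set ρ := κ * r with hρ
  have hρ0 : 0 < ρ := by positivity
  obtain ⟨hnonneg, hle⟩ := h Ω hΩ A hA hmod z₀ ρ hρ0 (mul_le_of_le_one_right hκ.le hr1) _
    (by congr 1 <;> ring) hcomp.2 u hu huS
  have e₁ : Kolmogorov.cylinder B (σ * κ * r) (-(3 * (8 * κ ^ 2) / 4) * r ^ 2)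
      (-(5 * (8 * κ ^ 2) / 8) * r ^ 2) z₀ =
      Kolmogorov.cylinder B (σ * ρ) (-6 * ρ ^ 2) (-5 * ρ ^ 2) z₀ := by
    congr 1 <;> ring
  have e₂ : Kolmogorov.cylinder B (σ * κ * r) (-(8 * κ ^ 2 / 8) * r ^ 2) 0 z₀ =
      Kolmogorov.cylinder B (σ * ρ) (-1 * ρ ^ 2) (0 * ρ ^ 2) z₀ := by
    congr 1 <;> ring
  rw [e₁, e₂]
  have hzero : Kolmogorov.homNorm (0 : Kolmogorov.Space p) < σ := by
    have h0 := Kolmogorov.homNorm_dil (le_refl (0 : ℝ)) (0 : Kolmogorov.Space p)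
    rw [map_zero, zero_mul] at h0
    rw [h0]; exact hσ0
  have hearly : ∀ z ∈ Kolmogorov.cylinder B (σ * ρ) (-6 * ρ ^ 2) (-5 * ρ ^ 2) z₀,
      ∀ z' ∈ Kolmogorov.cylinder B (σ * ρ) (-1 * ρ ^ 2) (0 * ρ ^ 2) z₀, 0 ≤ u z' ∧ u z ≤ C * u z' := by
    intro z hz z' hz'
    obtain ⟨y, hy1, hy2, rfl⟩ := (Kolmogorov.mem_cylinder_iff hρ0).1 hz
    obtain ⟨y', hy1', hy2', rfl⟩ := (Kolmogorov.mem_cylinder_iff hρ0).1 hz'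
    have hy' : y' ∈ Kolmogorov.lateBox p :=
      ⟨mem_closedBall_zero_iff.2 ((Kolmogorov.norm_le_of_homNorm_lt hy1').trans (by norm_num)),
        hy2'.1.le, hy2'.2.le⟩
    exact ⟨hnonneg y' hy', hle y ⟨mem_closedBall_zero_iff.2 (Kolmogorov.norm_le_of_homNorm_lt hy1),
      hy2.1.le, hy2.2.le⟩ y' hy'⟩
  obtain ⟨z₁, hz₁⟩ : (Kolmogorov.cylinder B (σ * ρ) (-6 * ρ ^ 2) (-5 * ρ ^ 2) z₀).Nonempty :=
    ⟨_, (Kolmogorov.mem_cylinder_iff hρ0).2 ⟨(0, -11 / 2), hzero, by norm_num, rfl⟩⟩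
  obtain ⟨z₂, hz₂⟩ : (Kolmogorov.cylinder B (σ * ρ) (-1 * ρ ^ 2) (0 * ρ ^ 2) z₀).Nonempty :=
    ⟨_, (Kolmogorov.mem_cylinder_iff hρ0).2 ⟨(0, -1 / 2), hzero, by norm_num, rfl⟩⟩
  refine ⟨⟨C * u z₂, ?_⟩, ⟨0, ?_⟩, csSup_le ⟨_, z₁, hz₁, rfl⟩ ?_⟩
  · rintro _ ⟨z, hz, rfl⟩
    exact (hearly z hz z₂ hz₂).2
  · rintro _ ⟨z', hz', rfl⟩
    exact (hearly z₁ hz₁ z' hz').1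
  · rintro _ ⟨z, hz, rfl⟩
    rw [mul_comm, ← div_le_iff₀ hC]
    refine le_csInf ⟨_, z₂, hz₂, rfl⟩ ?_
    rintro _ ⟨z', hz', rfl⟩
    rw [div_le_iff₀ hC, mul_comm]
    exact (hearly z hz z' hz').2
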